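/- Let $k$ be a field, $S=k[x,y,z]=k[x_0,x_1,x_2]$ (indices modulo $3$), $m=(x,y,z)$, $d\ge 1$, and let $M_e$ be the set of monomials of degree $e$ in $S$. Conventions. A polyhedral cell complex is a finite collection of convex polytopes in some $\mathbb R^N$, closed under taking faces, such that any two of them meet in a common face. If its vertices are labeled by monomials, a face is labeled by the least common multiple of the labels of its vertices, and (after a choice of orientations, i.e. of an incidence function with values $\pm1$ on facets) one gets the cellular free complex $\mathcal F_X=\bigoplus_F S(-\mathbf a_F)$, with $\partial(F)=\sum_{G}\mathrm{sign}(G,F)\,\mathbf x^{\mathbf a_F-\mathbf a_G}G$, the sum being over the facets $G$ of $F$. $X$ supports a minimal cellular resolution of a monomial ideal $I$ if $\mathcal F_X$ (over the nonempty faces) is a minimal free resolution of $I$. A polarization of an ideal $I\subseteq k[x_1,\dots,x_n]$ is a square-free monomial ideal $\widetilde I$ in $\widetilde S=k[x_i^{(j)}\mid 1\le i\le n,\ 1\le j\le r_i]$ ($r_i\geq 1$) such that the sequence $\sigma$ of all $x_i^{(1)}-x_i^{(j)}$, $j\ge2$, is regular on $\widetilde S/\widetilde I$ and $x_i^{(j)}\mapsto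 x_i$ induces an isomorphism $\widetilde I\otimes\widetilde S/(\sigma)\cong I$. The triangulated simplex $\Gamma$ has vertex set $M_d$; its triangles are the up triangles $\{qx,qy,qz\}$, $q\in M_{d-1}$, and the down triangles $\{nxy,nxz,nyz\}$, $n\in M_{d-2}$, and its edges are the edges of these triangles. Choose one edge in each down triangle; call $n\in M_{d-2}$ a $v$-triangle if the chosen edge of its down triangle is the one joining the two vertices $nx_vx_j$, $j\ne v$. Let $\Delta$ be the cell complex whose vertices are those of $\Gamma$, whose edges are the edges of $\Gamma$ that were not chosen, and whose $2$-cells are the regions obtained by merging triangles of $\Gamma$ along the chosen edges (each region is one up triangle together with the down triangles whose chosen edge is an edge of that up triangle). Attach to the choice an ideal $I_\Delta\subseteq\widetilde S=k[x_v^{(l)}\mid v\in\{0,1,2\},\,1\le l\le d]$ as follows. For each $v$ define subsets $s_{i,j}=s^{v}_{i,j}$ of $[i]=\{1,\dots,i\}$ ($0\le j\le i\le d$) by $s_{i,0}=\emptyset$ and, with $s'_{i,j}=s_{i,j}\cup\{i+1\}$, for $0\le j\le i<d$: $$s_{i+1,j+1}=s_{i+1,j}\cup(s'_{i,j+1}\setminus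 s'_{i,j})$$ if $j<i$ and $x_v^{\,i-1-j}x_{v+1}^{\,j}x_{v+2}^{\,d-i-1}$ is a $v$-triangle, and $s_{i+1,j+1}=s'_{i,j}$ otherwise. The polarization of $p=x_0^{p_0}x_1^{p_1}x_2^{p_2}\in M_d$ is the square-free monomial $$\tilde p=\prod_{v}\ \prod_{l\in[i_v]\setminus s^{v}_{i_v,\,p_{v+1}}}x_v^{(l)},\qquad i_v=d-p_{v+2},$$ and $I_\Delta=(\tilde p\mid p\in M_d)$. Theorem. (1) For every choice of exactly one edge from each down triangle of $\Gamma$, the ideal $I_\Delta$ is a polarization of $m^d$; $\Delta$ can be realized as a polyhedral cell complex; and, for every such realization and every choice of orientations of its cells, $\Delta$ with vertices labeled by the $\tilde p$ supports a minimal cellular resolution of $I_\Delta$, and $\Delta$ with vertices labeled by the $p\in M_d$ supports a minimal cellular resolution of $m^d$. (2) Conversely, let $X$ be a polyhedral cell complex with vertices labeled by monomials of $S$ which (with some choice of orientations) supports a minimal cellular resolution of $m^d$. Then there is a choice of one edge from each down triangle such that $X$ is, as a labeled complex, the corresponding complex $\Delta$. Moreover, replacing each vertex label $p$ of $X$ by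 $\tilde p$ gives (with the same orientations) a minimal cellular resolution of $I_\Delta$, and the substitution $x_v^{(l)}\mapsto x_v$ takes the new label of every face to its old label, so that the given resolution of $m^d$ is the depolarization of that of $I_\Delta$. -/

import Mathlib

open MvPolynomial

/-- A polyhedral cell complex in `ℝ^N`: a finite collection of convex polytopes, closed under
taking faces, such that any two members intersect in a common face. The faces of a polytope
(including the empty face and the polytope itself) are its exposed subsets. -/
structure PolyhedralComplex (N : ℕ) where
  /-- The polytopes of the complex (the empty face included). -/
  faces : Set (Set (EuclideanSpace ℝ (Fin N)))
  finite_faces : faces.Finite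
  isPolytope : ∀ P ∈ faces, ∃ s : Finset (EuclideanSpace ℝ (Fin N)), P = convexHull ℝ (s : Set _)
  face_mem : ∀ P ∈ faces, ∀ F, IsExposed ℝ P F → F ∈ faces
  inter_isFace : ∀ P ∈ faces, ∀ Q ∈ faces, IsExposed ℝ P (P ∩ Q) ∧ IsExposed ℝ Q (P ∩ Q)

namespace PolyhedralComplex

variable {N : ℕ}

/-- The `i`-cells of `X`: the nonempty faces of dimension `i`. -/
def Cell (X : PolyhedralComplex N) (i : ℕ) : Type :=
  {P : Set (EuclideanSpace ℝ (Fin N)) //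
    P ∈ X.faces ∧ P.Nonempty ∧ Module.finrank ℝ (vectorSpan ℝ P) = i}

noncomputable instance (X : PolyhedralComplex N) (i : ℕ) : Fintype (X.Cell i) :=
  haveI : Finite (X.Cell i) := (X.finite_faces.subset fun _ h => h.1 :
    {P | P ∈ X.faces ∧ P.Nonempty ∧ Module.finrank ℝ (vectorSpan ℝ P) = i}.Finite)
  Fintype.ofFinite _

/-- The vertices of `X` that lie in `P`. -/
def verts (X : PolyhedralComplex N) (P : Set (EuclideanSpace ℝ (Fin N))) : Set (X.Cell 0) :=
  {v | v.1 ⊆ P}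

/-- An incidence function, i.e. the signs of a choice of orientations of the cells: `sign G F` is
`1` or `-1` when `G` is a facet of `F` and `0` otherwise, and the boundary of a boundary vanishes.
The incidence of every vertex with the empty face is `1`, which gives the condition on `1`-cells.
(A cell contained in another cell is a face of it.) -/
structure Incidence (X : PolyhedralComplex N) where
  sign : ∀ {i : ℕ}, X.Cell i → X.Cell (i + 1) → ℤ
  sign_facet : ∀ {i : ℕ} (G : X.Cell i) (F : X.Cell (i + 1)), G.1 ⊆ F.1 →
    sign G F = 1 ∨ sign G F = -1
  sign_of_not_facet : ∀ {i : ℕ} (G : X.Cell i) (F : X.Cell (i + 1)), ¬ G.1 ⊆ F.1 → sign G F = 0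
  sum_vertices : ∀ e : X.Cell 1, ∑ v : X.Cell 0, sign v e = 0
  sum_facets : ∀ {i : ℕ} (G : X.Cell i) (F : X.Cell (i + 2)),
    ∑ H : X.Cell (i + 1), sign G H * sign H F = 0

section Labelled

variable {σ : Type*} (X : PolyhedralComplex N) (a : X.Cell 0 → (σ →₀ ℕ))

open Classical in
/-- The label of a face: the exponent of the least common multiple of the labels of its
vertices. -/
noncomputable def label (P : Set (EuclideanSpace ℝ (Fin N))) : σ →₀ ℕ :=
  (Finset.univ.filter fun v => v ∈ X.verts P).sup a

variable (k : Type*) [Field k]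

/-- The differential from the `(i+1)`-cells to the `i`-cells of the cellular free complex. -/
noncomputable def boundary (ε : X.Incidence) (i : ℕ) :
    (X.Cell (i + 1) → MvPolynomial σ k) →ₗ[MvPolynomial σ k] (X.Cell i → MvPolynomial σ k) :=
  Matrix.mulVecLin (Matrix.of fun (G : X.Cell i) (F : X.Cell (i + 1)) =>
    monomial (X.label a F.1 - X.label a G.1) (ε.sign G F : k))

/-- The augmentation, sending the basis element of a vertex to its monomial. -/
noncomputable def augmentation :
    (X.Cell 0 → MvPolynomial σ k) →ₗ[MvPolynomial σ k] MvPolynomial σ k :=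
  Fintype.linearCombination (MvPolynomial σ k) fun v => monomial (a v) (1 : k)

/-- The cellular free complex of the labelled complex `(X, a)`, with signs `ε`, is a minimal free
resolution of the ideal `I`. -/
structure IsMinimalResolution (ε : X.Incidence) (I : Ideal (MvPolynomial σ k)) : Prop where
  range_augmentation : LinearMap.range (X.augmentation a k) = I
  exact_zero : Function.Exact (X.boundary a k ε 0) (X.augmentation a k)
  exact_succ : ∀ i, Function.Exact (X.boundary a k ε (i + 1)) (X.boundary a k ε i)
  minimal : ∀ i w G, X.boundary a k ε i w G ∈ Ideal.span (Set.range (MvPolynomial.X : σ → _))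

end Labelled

end PolyhedralComplex

section Polarization

variable {k : Type*} [Field k] {n : ℕ}

/-- Ideals generated by square-free monomials. -/
def IsSquarefreeMonomialIdeal {σ : Type*} (J : Ideal (MvPolynomial σ k)) : Prop :=
  ∃ A : Set (Finset σ), J = Ideal.span ((fun s => ∏ t ∈ s, X t) '' A)

/-- The sequence `x_i^{(1)} - x_i^{(j)}`, `j = 2, …, r_i`, `i = 1, …, n`. -/
noncomputable def polarizationSequence (k : Type*) [Field k] (r : Fin n → ℕ)
    [∀ i, NeZero (r i)] : List (MvPolynomial ((i : Fin n) × Fin (r i)) k) :=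
  (List.finRange n).flatMap fun i =>
    (List.finRange (r i)).tail.map fun j => X ⟨i, 0⟩ - X ⟨i, j⟩

/-- The homomorphism `x_i^{(j)} ↦ x_i`. -/
noncomputable def depolarize (k : Type*) [Field k] (r : Fin n → ℕ) :
    MvPolynomial ((i : Fin n) × Fin (r i)) k →ₐ[k] MvPolynomial (Fin n) k :=
  rename Sigma.fst

/-- `J` is a polarization of `I`: it is a square-free monomial ideal, the sequence of differences
is regular on the quotient by `J`, and `x_i^{(j)} ↦ x_i` induces an isomorphism from
`J ⊗ S̃/(differences) = J / (differences) J` onto `I` (the last two fields). -/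
structure IsPolarization (r : Fin n → ℕ) [∀ i, NeZero (r i)] (I : Ideal (MvPolynomial (Fin n) k))
    (J : Ideal (MvPolynomial ((i : Fin n) × Fin (r i)) k)) : Prop where
  squarefree : IsSquarefreeMonomialIdeal J
  regular : RingTheory.Sequence.IsRegular (MvPolynomial ((i : Fin n) × Fin (r i)) k ⧸ J)
    (polarizationSequence k r)
  surj : ⇑(depolarize k r) '' (J : Set _) = (I : Set _)
  inj : ∀ f ∈ J, depolarize k r f = 0 → f ∈ Ideal.ofList (polarizationSequence k r) * J

end Polarization

section Triangles

variable {d : ℕ}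

/-- The down triangles of `Γ`, indexed by the (exponents of) monomials of degree `d - 2`. -/
def DownTriangle (d : ℕ) : Type := {n : Fin 3 →₀ ℕ // n.degree + 2 = d}

/-- The vertices `q x`, `q y`, `q z` of the up triangle of a monomial `q` of degree `d - 1`. -/
def upVertices (q : Fin 3 →₀ ℕ) : Set (Fin 3 →₀ ℕ) :=
  {p | ∃ i, p = q + Finsupp.single i 1}

/-- The vertices `n x y`, `n x z`, `n y z` of a down triangle. -/
def downVertices (n : DownTriangle d) : Set (Fin 3 →₀ ℕ) :=
  {p | ∃ i j, i ≠ j ∧ p = n.1 + Finsupp.single i 1 + Finsupp.single j 1}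

/-- A choice of one edge from each down triangle is encoded by `τ : DownTriangle d → Fin 3`. If
`τ n = v`, the edge of `n` that is removed is the one whose endpoints are the two vertices
`n x_v x_j` with `j ≠ v`; one says that `n` is a `v`-triangle. -/
def removedEdge (τ : DownTriangle d → Fin 3) (n : DownTriangle d) : Set (Fin 3 →₀ ℕ) :=
  {p | ∃ j, j ≠ τ n ∧ p = n.1 + Finsupp.single (τ n) 1 + Finsupp.single j 1}

/-- The nonempty cells of the complex `Δ` obtained from `Γ` by removing the chosen edges, given by
their sets of vertices: all monomials of degree `d`; the edges of `Γ` (all of which are edges of up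
triangles) that are not removed; and the regions, each of which is an up triangle together with the
down triangles that have been merged with it by removing the common edge. -/
def deltaCells (τ : DownTriangle d → Fin 3) : Set (Set (Fin 3 →₀ ℕ)) :=
  {c | ∃ p : Fin 3 →₀ ℕ, p.degree = d ∧ c = {p}} ∪
  {c | ∃ q : Fin 3 →₀ ℕ, q.degree + 1 = d ∧
    (∃ i j, i ≠ j ∧ c = {q + Finsupp.single i 1, q + Finsupp.single j 1}) ∧
    ∀ n, c ≠ removedEdge τ n} ∪
  {c | ∃ q : Fin 3 →₀ ℕ, q.degree + 1 = d ∧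
    c = upVertices q ∪ {p | ∃ n, removedEdge τ n ⊆ upVertices q ∧ p ∈ downVertices n}}

/-- The polyhedral cell complex `X` with vertex labels `a` is the complex `Δ`: the labels are
distinct, and the vertex sets of the nonempty faces are the cells of `Δ`. -/
def IsDelta (τ : DownTriangle d → Fin 3) {N : ℕ} (X : PolyhedralComplex N)
    (a : X.Cell 0 → (Fin 3 →₀ ℕ)) : Prop :=
  Function.Injective a ∧ {c | ∃ P ∈ X.faces, P.Nonempty ∧ c = a '' X.verts P} = deltaCells τ

/-- The sequence `s_{i+1,0}, s_{i+1,1}, …` obtained from `s = (s_{i,0}, s_{i,1}, …)`, where `T j`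
says whether the `j`-th down triangle between the two rows has the type under consideration.
Indices of variables start at `0`, so that `s_{i,j} ⊆ {0, …, i-1}`. -/
def nextChain (i : ℕ) (s : ℕ → Finset ℕ) (T : ℕ → Prop) [DecidablePred T] : ℕ → Finset ℕ
  | 0 => ∅
  | j + 1 => if T j then nextChain i s T j ∪ (insert i (s (j + 1)) \ insert i (s j))
      else insert i (s j)

open Classical in
/-- The sets `s_{i,j}` (`0 ≤ j ≤ i ≤ d`) for the variable `x_v`. The `i`-th row consists of the
monomials of degree `d` whose exponent in `x_{v+2}` is `d - i`, ordered by their exponent `j` in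
`x_{v+1}`; indices of variables are read modulo `3`. -/
noncomputable def chain (τ : DownTriangle d → Fin 3) (v : Fin 3) : ℕ → ℕ → Finset ℕ
  | 0 => fun _ => ∅
  | i + 1 => nextChain i (chain τ v i) fun j => j < i ∧ ∃ n : DownTriangle d,
      n.1 = Finsupp.single v (i - 1 - j) + Finsupp.single (v + 1) j +
        Finsupp.single (v + 2) (d - i - 1) ∧ τ n = v

open Classical in
/-- The variables of the polarization of a monomial `p` of degree `d`: the power of `x_v` in `p` is
replaced by the product of the `x_v^{(l)}` with `l ∈ [i]`, `l ∉ s_{i,j}`, where `j` is the exponent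
of `x_{v+1}` in `p` and `d - i` that of `x_{v+2}`. -/
noncomputable def polarizedSupport (τ : DownTriangle d → Fin 3) (p : Fin 3 →₀ ℕ) :
    Finset ((_ : Fin 3) × Fin d) :=
  Finset.univ.filter fun t => (t.2 : ℕ) < d - p (t.1 + 2) ∧
    (t.2 : ℕ) ∉ chain τ t.1 (d - p (t.1 + 2)) (p (t.1 + 1))

/-- The exponent of the polarization of a monomial `p` of degree `d`. -/
noncomputable def polarizedExponent (τ : DownTriangle d → Fin 3) (p : Fin 3 →₀ ℕ) :
    ((_ : Fin 3) × Fin d) →₀ ℕ :=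
  ∑ t ∈ polarizedSupport τ p, Finsupp.single t 1

/-- The ideal generated by the polarizations of all monomials of degree `d`. -/
noncomputable def polarizedIdeal (k : Type*) [Field k] (τ : DownTriangle d → Fin 3) :
    Ideal (MvPolynomial ((_ : Fin 3) × Fin d) k) :=
  Ideal.span {f | ∃ p : Fin 3 →₀ ℕ, p.degree = d ∧ f = monomial (polarizedExponent τ p) 1}

end Triangles

-- Exactness of the cellular complex of Δ is tested one multidegree b at a time, on the subcomplex
-- of cells whose label divides b. This subcomplex is connected: two monomials dividing b are joined
-- by exchanging one variable at a time, and a removed edge of a down triangle n can be replaced by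
-- the other two edges of n, because all three edges have label nxyz
-- (`DeltaSigns.single_sub_single_mem`). It carries no 2-cycles, because every region has an edge
-- that it shares at most with a region of smaller exponent in x_1
-- (`DeltaSigns.eq_zero_of_sum_s2_eq_zero`). If nonempty, it has Euler characteristic 1: this is a
-- count for Γ, and in passing to Δ each down triangle cancels against its chosen edge
-- (`DeltaSigns.card_eq`). A dimension count then forces exactness at the edges. Only the incidence
-- relations are used, so every orientation works.
--
-- The recursion for the sets s is made so that on each cell of Δ, for each variable x_v, the index
-- sets of the polarized vertices have a largest member (`exists_max_polarIndices`). Hence the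
-- polarized label of a cell depolarizes to its old label, and the complex for m^d arises from the
-- polarized one by identifying variables. A graded complex that becomes exact when two variables
-- are identified was already exact (`exists_mulVec_of_rename`), so separating the variables one
-- after another makes all intermediate complexes exact (`IsDelta.cellExact_collapse`). The last of
-- them resolves I_Δ, and the exactness of the others says that each difference of variables is a
-- nonzerodivisor on the quotient before it. Minimality holds because the depolarized label of an
-- i-cell has degree d + i.
--
-- For a realization, p is placed at the class of (p_0², p_1², p_2²) modulo (1,1,1). Linear
-- functionals become weighted sums of squares of the exponents, and suitable weights give lines
-- supporting a region along each of its sides and lines separating any two regions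
-- (`exists_separation`).
--
-- Conversely, in a minimal cellular resolution a cycle whose labels divide the label of a cell F
-- has coefficient 0 at F (`PolyhedralComplex.MinimalExact.eq_zero_of_cycle`). This forces edge
-- labels to have degree d + 1, so that edges are edges of Γ, and it forbids all three edges of a
-- down triangle to be present, while connectedness in degree nxyz requires two of them. So the
-- 1-skeleton is that of some Δ. The edge cycles there are freely generated by the boundaries of the
-- regions; the same principle identifies the 2-cells with the regions, and the freeness excludes
-- 3-cells.

local notation "𝐞" i:max => Finsupp.single (i : Fin 3) (1 : ℕ)

/-! ### Edges, removed edges and regions of the triangulated simplex -/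

section Combinatorics

theorem finsupp_fin_three_ext {p q : Fin 3 →₀ ℕ} :
    p = q ↔ p 0 = q 0 ∧ p 1 = q 1 ∧ p 2 = q 2 := by
  simp [Finsupp.ext_iff, Fin.forall_fin_succ]

theorem finsupp_fin_three_le {p q : Fin 3 →₀ ℕ} :
    p ≤ q ↔ p 0 ≤ q 0 ∧ p 1 ≤ q 1 ∧ p 2 ≤ q 2 := by
  simp [Finsupp.le_def, Fin.forall_fin_succ]

theorem degree_fin_three (p : Fin 3 →₀ ℕ) : p.degree = p 0 + p 1 + p 2 := by
  simp [Finsupp.degree_eq_sum, Fin.sum_univ_three]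

variable {d : ℕ}

/-- The edge of `Γ` opposite to `q x_w` in the up triangle of `q`. -/
def edgeSet (q : Fin 3 →₀ ℕ) (w : Fin 3) : Set (Fin 3 →₀ ℕ) := {q + 𝐞 (w + 1), q + 𝐞 (w + 2)}

/-- The edge of `Γ` opposite to `q x_w` in the up triangle of `q` is removed. -/
def IsRemoved (τ : DownTriangle d → Fin 3) (q : Fin 3 →₀ ℕ) (w : Fin 3) : Prop :=
  ∃ n : DownTriangle d, n.1 + 𝐞 w = q ∧ τ n = w

/-- The vertices of the region containing the up triangle of `q`. -/
def regionSet (τ : DownTriangle d → Fin 3) (q : Fin 3 →₀ ℕ) : Set (Fin 3 →₀ ℕ) :=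
  upVertices q ∪ {p | ∃ n : DownTriangle d, removedEdge τ n ⊆ upVertices q ∧ p ∈ downVertices n}

/-- With v the type of n, the vertices n x_v x_j, j ≠ v, are the corners other than n x_v² of the up
triangle of n x_v. So n is merged with that up triangle, across its edge opposite to x_v. -/
theorem removedEdge_eq (τ : DownTriangle d → Fin 3) (n : DownTriangle d) :
    removedEdge τ n = edgeSet (n.1 + 𝐞 (τ n)) (τ n) := by
  ext p
  simp only [removedEdge, edgeSet, Set.mem_ofPred_eq, Set.mem_insert_iff, Set.mem_singleton_iff]
  generalize τ n = v
  fin_cases v <;> simp [Fin.exists_fin_succ] <;> tauto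

theorem edgeSet_injective {q q' : Fin 3 →₀ ℕ} {w w' : Fin 3} (h : edgeSet q w = edgeSet q' w') :
    q = q' ∧ w = w' := by
  have h1 : q + 𝐞 (w + 1) ∈ edgeSet q' w' := h ▸ Set.mem_insert _ _
  have h2 : q + 𝐞 (w + 2) ∈ edgeSet q' w' := h ▸ Set.mem_insert_of_mem _ rfl
  simp only [edgeSet, Set.mem_insert_iff, Set.mem_singleton_iff, finsupp_fin_three_ext,
    Finsupp.add_apply, Finsupp.single_apply] at h1 h2 ⊢
  fin_cases w <;> fin_cases w' <;> simp at h1 h2 ⊢ <;> omega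

theorem edgeSet_subset_upVertices (q : Fin 3 →₀ ℕ) (w : Fin 3) : edgeSet q w ⊆ upVertices q := by
  rintro p (rfl | rfl)
  exacts [⟨_, rfl⟩, ⟨_, rfl⟩]

theorem edgeSet_subset_upVertices_iff {q q' : Fin 3 →₀ ℕ} {w : Fin 3} :
    edgeSet q' w ⊆ upVertices q ↔ q = q' := by
  constructor
  · intro h
    obtain ⟨i, h1⟩ := h (Set.mem_insert _ _)
    obtain ⟨j, h2⟩ := h (Set.mem_insert_of_mem _ rfl)
    simp only [finsupp_fin_three_ext, Finsupp.add_apply, Finsupp.single_apply] at h1 h2 ⊢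
    fin_cases w <;> fin_cases i <;> fin_cases j <;> simp at h1 h2 ⊢ <;> omega
  · rintro rfl
    exact edgeSet_subset_upVertices _ _

theorem mem_downVertices_iff {n : DownTriangle d} (v : Fin 3) {p : Fin 3 →₀ ℕ} :
    p ∈ downVertices n ↔ p ∈ edgeSet (n.1 + 𝐞 v) v ∨ p = n.1 + 𝐞 (v + 1) + 𝐞 (v + 2) := by
  simp only [downVertices, edgeSet, Set.mem_ofPred_eq, Set.mem_insert_iff, Set.mem_singleton_iff,
    finsupp_fin_three_ext, Finsupp.add_apply, Finsupp.single_apply]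
  fin_cases v <;> simp [Fin.exists_fin_succ] <;> omega

/-- A merged down triangle shares an edge with the up triangle and so contributes a single new
vertex. -/
theorem mem_regionSet {τ : DownTriangle d → Fin 3} {q p : Fin 3 →₀ ℕ} :
    p ∈ regionSet τ q ↔ (∃ i, p = q + 𝐞 i) ∨
      ∃ n : DownTriangle d, n.1 + 𝐞 (τ n) = q ∧ p = n.1 + 𝐞 (τ n + 1) + 𝐞 (τ n + 2) := by
  simp only [regionSet, Set.mem_union, Set.mem_ofPred_eq, removedEdge_eq,
    edgeSet_subset_upVertices_iff]
  constructor
  · rintro (h | ⟨n, rfl, h⟩)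
    · exact Or.inl h
    · rcases (mem_downVertices_iff (τ n)).1 h with h | h
      · exact Or.inl (edgeSet_subset_upVertices _ _ h)
      · exact Or.inr ⟨n, rfl, h⟩
  · rintro (h | ⟨n, h1, h2⟩)
    · exact Or.inl h
    · exact Or.inr ⟨n, h1.symm, (mem_downVertices_iff (τ n)).2 (Or.inr h2)⟩

theorem isRemoved_iff {τ : DownTriangle d → Fin 3} {q : Fin 3 →₀ ℕ} {w : Fin 3} :
    IsRemoved τ q w ↔ ∃ n, edgeSet q w = removedEdge τ n := by
  constructor
  · rintro ⟨n, rfl, rfl⟩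
    exact ⟨n, (removedEdge_eq τ n).symm⟩
  · rintro ⟨n, h⟩
    rw [removedEdge_eq] at h
    obtain ⟨rfl, rfl⟩ := edgeSet_injective h
    exact ⟨n, rfl, rfl⟩

theorem mem_deltaCells {τ : DownTriangle d → Fin 3} {c : Set (Fin 3 →₀ ℕ)} :
    c ∈ deltaCells τ ↔ (∃ p : Fin 3 →₀ ℕ, p.degree = d ∧ c = {p}) ∨
      (∃ (q : Fin 3 →₀ ℕ) (w : Fin 3), q.degree + 1 = d ∧ ¬ IsRemoved τ q w ∧ c = edgeSet q w) ∨
      ∃ q : Fin 3 →₀ ℕ, q.degree + 1 = d ∧ c = regionSet τ q := by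
  have key : ∀ q : Fin 3 →₀ ℕ, (∃ i j : Fin 3, i ≠ j ∧ c = {q + 𝐞 i, q + 𝐞 j}) ↔
      ∃ w, c = edgeSet q w := by
    intro q
    constructor
    · rintro ⟨i, j, hij, h⟩
      -- The three indices sum to 0 modulo 3, so -(i + j) is the third one.
      refine ⟨-(i + j), ?_⟩
      rw [h, edgeSet]
      fin_cases i <;> fin_cases j <;> first | exact absurd rfl hij | rfl | exact Set.pair_comm _ _
    · rintro ⟨w, h⟩
      exact ⟨w + 1, w + 2, (by decide : ∀ w : Fin 3, w + 1 ≠ w + 2) w, h⟩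
  simp only [deltaCells, Set.mem_union, Set.mem_ofPred_eq, key, or_assoc, isRemoved_iff]
  refine or_congr_right (or_congr ?_ Iff.rfl)
  constructor
  · rintro ⟨q, hq, ⟨w, rfl⟩, h⟩
    exact ⟨q, w, hq, fun ⟨n, hn⟩ => h n hn, rfl⟩
  · rintro ⟨q, w, hq, h, rfl⟩
    exact ⟨q, hq, ⟨w, rfl⟩, fun n hn => h ⟨n, hn⟩⟩

theorem le_of_mem_regionSet {τ : DownTriangle d → Fin 3} {q p : Fin 3 →₀ ℕ}
    (h : p ∈ regionSet τ q) : p ≤ q + 𝐞 0 + 𝐞 1 + 𝐞 2 := by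
  rcases mem_regionSet.1 h with ⟨i, rfl⟩ | ⟨n, rfl, rfl⟩
  · simp only [finsupp_fin_three_le, Finsupp.add_apply, Finsupp.single_apply]
    fin_cases i <;> simp
  · simp only [finsupp_fin_three_le, Finsupp.add_apply, Finsupp.single_apply]
    generalize τ n = v
    fin_cases v <;> simp <;> omega

theorem degree_of_mem_regionSet {τ : DownTriangle d → Fin 3} {q p : Fin 3 →₀ ℕ}
    (hq : q.degree + 1 = d) (h : p ∈ regionSet τ q) : p.degree = d := by
  rcases mem_regionSet.1 h with ⟨i, rfl⟩ | ⟨n, rfl, rfl⟩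
  · simp [hq]
  · simp only [map_add, Finsupp.degree_single] at hq ⊢
    omega

/-- Each q x_i divides q'xyz, which gives q ≤ q' coordinatewise; the degrees agree. -/
theorem eq_of_upVertices_subset_regionSet {τ : DownTriangle d → Fin 3} {q q' : Fin 3 →₀ ℕ}
    (hq : q.degree + 1 = d) (hq' : q'.degree + 1 = d) (h : upVertices q ⊆ regionSet τ q') :
    q = q' := by
  have h0 := le_of_mem_regionSet (h ⟨0, rfl⟩)
  have h1 := le_of_mem_regionSet (h ⟨1, rfl⟩)
  have h2 := le_of_mem_regionSet (h ⟨2, rfl⟩)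
  simp only [finsupp_fin_three_le, finsupp_fin_three_ext, degree_fin_three, Finsupp.add_apply,
    Finsupp.single_apply] at *
  simp at h0 h1 h2
  omega

/-- An edge of Γ lies in exactly one up triangle and in at most one down triangle n. It is therefore
contained in the region of that up triangle and in the region into which n is merged, and in no
other. -/
theorem edgeSet_subset_regionSet_iff {τ : DownTriangle d → Fin 3} {q q' : Fin 3 →₀ ℕ} {w : Fin 3}
    (hq : q.degree + 1 = d) (hq' : q'.degree + 1 = d) : edgeSet q' w ⊆ regionSet τ q ↔
      q' = q ∨ ∃ n : DownTriangle d, n.1 + 𝐞 w = q' ∧ n.1 + 𝐞 (τ n) = q := by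
  constructor
  · intro h
    have h1 : q' + 𝐞 (w + 1) ∈ regionSet τ q := h (Set.mem_insert _ _)
    have h2 : q' + 𝐞 (w + 2) ∈ regionSet τ q := h (Set.mem_insert_of_mem _ rfl)
    rcases mem_regionSet.1 h1 with ⟨i, h1⟩ | ⟨n, h3, h1⟩
    · rcases mem_regionSet.1 h2 with ⟨j, h2⟩ | ⟨n, h3, h2⟩
      · left
        simp only [finsupp_fin_three_ext, Finsupp.add_apply, Finsupp.single_apply] at h1 h2 ⊢
        fin_cases w <;> fin_cases i <;> fin_cases j <;> simp at h1 h2 ⊢ <;> omega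
      · by_cases hw : n.1 + 𝐞 w = q'
        · exact Or.inr ⟨n, hw, h3⟩
        · left
          simp only [finsupp_fin_three_ext, Finsupp.add_apply, Finsupp.single_apply]
            at h1 h2 h3 hw ⊢
          generalize τ n = v at *
          fin_cases w <;> fin_cases i <;> fin_cases v <;> simp at h1 h2 h3 hw ⊢ <;> omega
    · by_cases hw : n.1 + 𝐞 w = q'
      · exact Or.inr ⟨n, hw, h3⟩
      · left
        have h4 := le_of_mem_regionSet h2
        simp only [finsupp_fin_three_ext, finsupp_fin_three_le, degree_fin_three,
          Finsupp.add_apply, Finsupp.single_apply] at hq hq' h1 h4 h3 hw ⊢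
        generalize τ n = v at *
        fin_cases w <;> fin_cases v <;> simp at h1 h4 h3 hw ⊢ <;> omega
  · rintro (rfl | ⟨n, rfl, h⟩) p hp
    · exact Or.inl (edgeSet_subset_upVertices _ _ hp)
    · refine Or.inr ⟨n, ?_, (mem_downVertices_iff w).2 (Or.inl hp)⟩
      rw [removedEdge_eq, h]
      exact edgeSet_subset_upVertices _ _

/-- If a side of the up triangle at the given corner is removed, the merged down triangle has a kept
edge at the same corner. A vertex added by a merged triangle lies on its two kept edges. -/
theorem exists_edgeSet_of_mem_regionSet {τ : DownTriangle d → Fin 3} {q p : Fin 3 →₀ ℕ}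
    (hq : q.degree + 1 = d) (hp : p ∈ regionSet τ q) : ∃ (q' : Fin 3 →₀ ℕ) (w : Fin 3),
      q'.degree + 1 = d ∧ ¬ IsRemoved τ q' w ∧ edgeSet q' w ⊆ regionSet τ q ∧ p ∈ edgeSet q' w := by
  have key : ∀ (n : DownTriangle d) (w : Fin 3), w ≠ τ n → n.1 + 𝐞 (τ n) = q →
      (n.1 + 𝐞 w).degree + 1 = d ∧ ¬ IsRemoved τ (n.1 + 𝐞 w) w ∧
        edgeSet (n.1 + 𝐞 w) w ⊆ regionSet τ q := by
    intro n w hw h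
    have h1 : (n.1 + 𝐞 w).degree + 1 = d := by
      rw [map_add, Finsupp.degree_single, add_assoc, n.2]
    refine ⟨h1, ?_, (edgeSet_subset_regionSet_iff hq h1).2 (Or.inr ⟨n, rfl, h⟩)⟩
    rintro ⟨n', h2, h3⟩
    have := Subtype.ext (add_right_cancel h2)
    exact hw (this ▸ h3.symm)
  rcases mem_regionSet.1 hp with ⟨i, rfl⟩ | ⟨n, h, rfl⟩
  · by_cases hr : IsRemoved τ q (i + 1)
    · obtain ⟨n, h1, h2⟩ := hr
      obtain ⟨h3, h4, h5⟩ := key n i (by rw [h2]; exact (by decide : ∀ i : Fin 3, i ≠ i + 1) i) (by rw [h2, h1])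
      refine ⟨_, _, h3, h4, h5, ?_⟩
      rw [← h1, edgeSet]
      clear h2 h3 h4 h5
      simp only [Set.mem_insert_iff, Set.mem_singleton_iff, finsupp_fin_three_ext,
        Finsupp.add_apply, Finsupp.single_apply]
      fin_cases i <;> simp
    · refine ⟨q, i + 1, hq, hr, (edgeSet_subset_regionSet_iff hq hq).2 (Or.inl rfl), ?_⟩
      refine Set.mem_insert_of_mem _ ?_
      rw [Set.mem_singleton_iff, (by decide : ∀ i : Fin 3, i + 1 + 2 = i) i]
  · obtain ⟨h3, h4, h5⟩ := key n (τ n + 1) ((by decide : ∀ v : Fin 3, v + 1 ≠ v) _) h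
    refine ⟨_, _, h3, h4, h5, ?_⟩
    refine Set.mem_insert_iff.2 (Or.inl ?_)
    rw [add_assoc (τ n)]
    rfl

end Combinatorics

/-! ### The sets s_{i,j} and the index sets of the polarized monomials -/

section Chains

/-- Induction along the new row t. The invariant t_j ⊆ s'_j carries it: for a v-triangle the single
element of s'_{j+1} \ s'_j is new to t_j, and otherwise t_{j+1} = s'_j contains t_j and is contained
in s'_{j+1}. -/
theorem nextChain_spec {i : ℕ} {s : ℕ → Finset ℕ} {T : ℕ → Prop} [DecidablePred T]
    (hs : ∀ j ≤ i, (s j).card = j ∧ s j ⊆ Finset.range i) (hm : ∀ j < i, s j ⊆ s (j + 1))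
    (hT : ∀ j, T j → j < i) (j : ℕ) (hj : j ≤ i + 1) :
    (nextChain i s T j).card = j ∧ nextChain i s T j ⊆ Finset.range (i + 1) ∧
      (j ≤ i → nextChain i s T j ⊆ insert i (s j)) ∧
      (∀ l, j = l + 1 → nextChain i s T l ⊆ nextChain i s T j) := by
  have hi : ∀ j ≤ i, i ∉ s j := fun j hj h => by simpa using (hs j hj).2 h
  have hins : ∀ j ≤ i, insert i (s j) ⊆ Finset.range (i + 1) := by
    intro j hj x hx
    rcases Finset.mem_insert.1 hx with rfl | hx
    · simp
    · have := (hs j hj).2 hx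
      simp at this ⊢
      omega
  induction j with
  | zero => simp [nextChain]
  | succ j ih =>
    have hj' : j ≤ i := by omega
    obtain ⟨h1, h2, h3, h4⟩ := ih (by omega)
    have h3 := h3 hj'
    by_cases hTj : T j
    · have hji := hT j hTj
      have hsub : insert i (s j) ⊆ insert i (s (j + 1)) := Finset.insert_subset_insert _ (hm j hji)
      have heq : nextChain i s T (j + 1) =
          nextChain i s T j ∪ (insert i (s (j + 1)) \ insert i (s j)) := by
        rw [nextChain, if_pos hTj]
      have hle : nextChain i s T (j + 1) ⊆ insert i (s (j + 1)) := by
        rw [heq]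
        exact Finset.union_subset (h3.trans hsub) Finset.sdiff_subset
      refine ⟨?_, hle.trans (hins _ hji), fun _ => hle, ?_⟩
      · rw [heq, Finset.card_union_of_disjoint, h1, Finset.card_sdiff_of_subset hsub,
          Finset.card_insert_of_notMem (hi _ hji), Finset.card_insert_of_notMem (hi _ hj'),
          (hs _ hji).1, (hs _ hj').1]
        · omega
        · exact Finset.disjoint_of_subset_left h3 Finset.disjoint_sdiff
      · rintro l hl
        obtain rfl : j = l := by omega
        rw [heq]
        exact Finset.subset_union_left
    · have heq : nextChain i s T (j + 1) = insert i (s j) := by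
        rw [nextChain, if_neg hTj]
      refine ⟨?_, ?_, ?_, ?_⟩
      · rw [heq, Finset.card_insert_of_notMem (hi _ hj'), (hs _ hj').1]
      · rw [heq]
        exact hins _ hj'
      · intro h
        rw [heq]
        exact Finset.insert_subset_insert _ (hm j h)
      · rintro l hl
        obtain rfl : j = l := by omega
        rw [heq]
        exact h3

variable {d : ℕ}

open Classical in
theorem chain_spec (τ : DownTriangle d → Fin 3) (v : Fin 3) (i : ℕ) :
    (∀ j ≤ i, (chain τ v i j).card = j ∧ chain τ v i j ⊆ Finset.range i) ∧
      ∀ j < i, chain τ v i j ⊆ chain τ v i (j + 1) := by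
  induction i with
  | zero => simp [chain]
  | succ i ih =>
    constructor
    · intro j hj
      obtain ⟨h1, h2, -, -⟩ := nextChain_spec ih.1 ih.2 (T := fun j => j < i ∧
        ∃ n : DownTriangle d, n.1 = Finsupp.single v (i - 1 - j) + Finsupp.single (v + 1) j +
          Finsupp.single (v + 2) (d - i - 1) ∧ τ n = v) (fun _ h => h.1) j hj
      exact ⟨h1, h2⟩
    · intro j hj
      exact (nextChain_spec ih.1 ih.2 (T := fun j => j < i ∧
        ∃ n : DownTriangle d, n.1 = Finsupp.single v (i - 1 - j) + Finsupp.single (v + 1) j +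
          Finsupp.single (v + 2) (d - i - 1) ∧ τ n = v) (fun _ h => h.1) (j + 1) hj).2.2.2 j rfl

open Classical in
theorem chain_succ_subset (τ : DownTriangle d → Fin 3) (v : Fin 3) {i j : ℕ} (hj : j ≤ i) :
    chain τ v (i + 1) j ⊆ insert i (chain τ v i j) :=
  (nextChain_spec (chain_spec τ v i).1 (chain_spec τ v i).2 (T := fun j => j < i ∧
    ∃ n : DownTriangle d, n.1 = Finsupp.single v (i - 1 - j) + Finsupp.single (v + 1) j +
      Finsupp.single (v + 2) (d - i - 1) ∧ τ n = v) (fun _ h => h.1) j (by omega)).2.2.1 hj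

theorem chain_succ_succ (τ : DownTriangle d → Fin 3) (v : Fin 3) {i j : ℕ}
    (h : ¬ (j < i ∧ ∃ n : DownTriangle d, n.1 = Finsupp.single v (i - 1 - j) +
      Finsupp.single (v + 1) j + Finsupp.single (v + 2) (d - i - 1) ∧ τ n = v)) :
    chain τ v (i + 1) (j + 1) = insert i (chain τ v i j) := by
  rw [chain, nextChain, if_neg h]

/-- The indices of the variables `x_v^{(l)}` dividing the polarization of `p`. -/
noncomputable def polarIndices (τ : DownTriangle d → Fin 3) (v : Fin 3) (p : Fin 3 →₀ ℕ) :
    Finset ℕ :=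
  Finset.range (d - p (v + 2)) \ chain τ v (d - p (v + 2)) (p (v + 1))

theorem degree_fin_three' (p : Fin 3 →₀ ℕ) (v : Fin 3) :
    p.degree = p v + p (v + 1) + p (v + 2) := by
  rw [degree_fin_three]
  fin_cases v <;> simp <;> omega

theorem card_polarIndices (τ : DownTriangle d → Fin 3) (v : Fin 3) {p : Fin 3 →₀ ℕ}
    (hp : p.degree = d) : (polarIndices τ v p).card = p v := by
  rw [degree_fin_three' p v] at hp
  obtain ⟨h1, h2⟩ := (chain_spec τ v (d - p (v + 2))).1 (p (v + 1)) (by omega)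
  rw [polarIndices, Finset.card_sdiff_of_subset h2, h1, Finset.card_range]
  omega

theorem polarIndices_subset_range (τ : DownTriangle d → Fin 3) (v : Fin 3) (p : Fin 3 →₀ ℕ) :
    polarIndices τ v p ⊆ Finset.range d :=
  Finset.sdiff_subset.trans (Finset.range_mono (Nat.sub_le _ _))

/-- The monomials q x_v and q x_{v+1} are neighbours in one row, where s_{i,j} ⊆ s_{i,j+1}; q
x_{v+2} lies in the preceding row, where s_{i+1,j} ⊆ s'_{i,j}. Complements reverse these inclusions.
-/
theorem polarIndices_subset (τ : DownTriangle d → Fin 3) (v j : Fin 3) {q : Fin 3 →₀ ℕ}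
    (hq : q.degree + 1 = d) : polarIndices τ v (q + 𝐞 j) ⊆ polarIndices τ v (q + 𝐞 v) := by
  rw [degree_fin_three' q v] at hq
  have n1 : ∀ v : Fin 3, v ≠ v + 1 := by decide
  have n2 : ∀ v : Fin 3, v ≠ v + 2 := by decide
  have n3 : ∀ v : Fin 3, v + 1 ≠ v + 2 := by decide
  obtain rfl | rfl | rfl := (by decide : ∀ v j : Fin 3, j = v ∨ j = v + 1 ∨ j = v + 2) v j
  · exact subset_rfl
  · simp only [polarIndices, Finsupp.add_apply, Finsupp.single_apply, n1, n2, n3,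
      if_true, if_false, add_zero]
    exact Finset.sdiff_subset_sdiff subset_rfl ((chain_spec τ v _).2 _ (by omega))
  · simp only [polarIndices, Finsupp.add_apply, Finsupp.single_apply, n1, n2, n3 v |>.symm,
      if_true, if_false, add_zero]
    obtain ⟨i, hi⟩ : ∃ i, d - q (v + 2) = i + 1 := ⟨d - q (v + 2) - 1, by omega⟩
    have hi' : d - (q (v + 2) + 1) = i := by omega
    rw [hi, hi']
    intro x hx
    rw [Finset.mem_sdiff, Finset.mem_range] at hx ⊢
    refine ⟨by omega, fun h => hx.2 ?_⟩
    rcases Finset.mem_insert.1 (chain_succ_subset τ v (by omega) h) with h | h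
    · omega
    · exact h

/-- Along a kept edge opposite to x_v the recursion is in its second case, s_{i+1,j+1} = s_{i,j} ∪
{i+1}, and the complements in [i+1] and [i] coincide. -/
theorem polarIndices_eq_of_not_isRemoved (τ : DownTriangle d → Fin 3) (v : Fin 3)
    {q : Fin 3 →₀ ℕ} (hq : q.degree + 1 = d) (h : ¬ IsRemoved τ q v) :
    polarIndices τ v (q + 𝐞 (v + 1)) = polarIndices τ v (q + 𝐞 (v + 2)) := by
  rw [degree_fin_three' q v] at hq
  have n1 : ∀ v : Fin 3, v ≠ v + 1 := by decide
  have n2 : ∀ v : Fin 3, v ≠ v + 2 := by decide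
  have n3 : ∀ v : Fin 3, v + 1 ≠ v + 2 := by decide
  simp only [polarIndices, Finsupp.add_apply, Finsupp.single_apply, n3, n3 v |>.symm,
    if_true, if_false, add_zero]
  obtain ⟨i, hi⟩ : ∃ i, d - q (v + 2) = i + 1 := ⟨d - q (v + 2) - 1, by omega⟩
  have hi' : d - (q (v + 2) + 1) = i := by omega
  rw [hi, hi', chain_succ_succ]
  · ext x
    have : x ∈ chain τ v i (q (v + 1)) → x < i := fun hx => by
      simpa using ((chain_spec τ v i).1 _ (by omega)).2 hx
    simp only [Finset.mem_sdiff, Finset.mem_range, Finset.mem_insert]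
    constructor
    · rintro ⟨h1, h2⟩
      exact ⟨by omega, fun h => h2 (Or.inr h)⟩
    · rintro ⟨h1, h2⟩
      exact ⟨by omega, by rintro (h | h); exacts [by omega, h2 h]⟩
  -- In the other case of the recursion the v-triangle would be q/x_v, whose chosen edge is the
  -- present one.
  · rintro ⟨h1, n, hn, hτ⟩
    refine h ⟨n, ?_, hτ⟩
    rw [hn, Finsupp.ext_iff]
    intro j
    rcases (by decide : ∀ v j : Fin 3, j = v ∨ j = v + 1 ∨ j = v + 2) v j with h | h | h <;>
    simp only [h, Finsupp.add_apply, Finsupp.single_apply, n1, n2, n3, n3 v |>.symm, (n1 v).symm,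
      (n2 v).symm, if_true, if_false, add_zero, zero_add] <;> omega

theorem polarizedExponent_apply (τ : DownTriangle d → Fin 3) (p : Fin 3 →₀ ℕ)
    (t : (_ : Fin 3) × Fin d) :
    polarizedExponent τ p t = if (t.2 : ℕ) ∈ polarIndices τ t.1 p then 1 else 0 := by
  classical
  rw [polarizedExponent, Finsupp.finsetSum_apply]
  simp only [Finsupp.single_apply, Finset.sum_ite_eq', polarizedSupport, Finset.mem_filter,
    Finset.mem_univ, true_and, polarIndices, Finset.mem_sdiff, Finset.mem_range]

open Classical in
/-- The depolarization of a least common multiple of polarizations. -/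
theorem mapDomain_fst_sup_polarizedExponent (τ : DownTriangle d → Fin 3) {ι : Type*}
    (s : Finset ι) (a : ι → Fin 3 →₀ ℕ) (ha : ∀ i ∈ s, (a i).degree = d)
    (h : ∀ v : Fin 3, s = ∅ ∨
      ∃ m ∈ s, ∀ i ∈ s, polarIndices τ v (a i) ⊆ polarIndices τ v (a m)) :
    (s.sup fun i => polarizedExponent τ (a i)).mapDomain Sigma.fst = s.sup a := by
  ext v
  rcases h v with rfl | ⟨m, hm, hmax⟩
  · simp [bot_eq_zero]
  have h1 : (s.sup a) v = a m v := by
    refine le_antisymm ?_ (Finset.le_sup (f := a) hm v)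
    -- One coordinate of a supremum is bounded by comparing the supremum with itself after
    -- overwriting that coordinate.
    suffices h : s.sup a ≤ (s.sup a).update v (a m v) by simpa using h v
    refine Finset.sup_le fun i hi u => ?_
    by_cases hu : u = v
    · subst hu
      rw [Finsupp.coe_update, Function.update_self, ← card_polarIndices τ u (ha i hi),
        ← card_polarIndices τ u (ha m hm)]
      exact Finset.card_le_card (hmax i hi)
    · rw [Finsupp.coe_update, Function.update_of_ne hu]
      exact Finset.le_sup (f := a) hi u
  have h2 : ∀ l : Fin d, (s.sup fun i => polarizedExponent τ (a i)) ⟨v, l⟩ =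
      polarizedExponent τ (a m) ⟨v, l⟩ := by
    intro l
    refine le_antisymm ?_ (Finset.le_sup (f := fun i => polarizedExponent τ (a i)) hm _)
    suffices h : (s.sup fun i => polarizedExponent τ (a i)) ≤
        (s.sup fun i => polarizedExponent τ (a i)).update ⟨v, l⟩
          (polarizedExponent τ (a m) ⟨v, l⟩) by
      simpa using h ⟨v, l⟩
    refine Finset.sup_le fun i hi u => ?_
    by_cases hu : u = ⟨v, l⟩
    · subst hu
      rw [Finsupp.coe_update, Function.update_self, polarizedExponent_apply,
        polarizedExponent_apply]
      by_cases hl : (l : ℕ) ∈ polarIndices τ v (a i)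
      · simp [hl, hmax i hi hl]
      · simp [hl]
    · rw [Finsupp.coe_update, Function.update_of_ne hu]
      exact Finset.le_sup (f := fun i => polarizedExponent τ (a i)) hi u
  rw [h1, Finsupp.mapDomain, Finsupp.sum_fintype _ _ (by simp), Finsupp.finsetSum_apply,
    Fintype.sum_sigma]
  simp only [Finsupp.single_apply]
  rw [Finset.sum_eq_single v (fun b _ hb => by simp [hb]) (by simp)]
  simp only [if_true, h2, polarizedExponent_apply]
  rw [← card_polarIndices τ v (ha m hm), Fin.sum_univ_eq_sum_range
    (fun l => if l ∈ polarIndices τ v (a m) then 1 else 0) d, Finset.sum_ite_mem,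
    Finset.inter_eq_right.2 (polarIndices_subset_range τ v _)]
  simp

/-- On every cell of `Δ` and for every variable, some vertex attains the largest index set. -/
theorem exists_max_polarIndices (τ : DownTriangle d → Fin 3) (v : Fin 3) {c : Set (Fin 3 →₀ ℕ)}
    (hc : c ∈ deltaCells τ) :
    ∃ m ∈ c, ∀ p ∈ c, polarIndices τ v p ⊆ polarIndices τ v m := by
  rcases mem_deltaCells.1 hc with ⟨p, -, rfl⟩ | ⟨q, w, hq, hr, rfl⟩ | ⟨q, hq, rfl⟩
  · exact ⟨p, rfl, by rintro _ rfl; rfl⟩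
  · by_cases hvw : v = w
    · subst hvw
      refine ⟨_, Set.mem_insert _ _, ?_⟩
      rintro p (rfl | rfl)
      · rfl
      · rw [polarIndices_eq_of_not_isRemoved τ v hq hr]
    · refine ⟨q + 𝐞 v, ?_, ?_⟩
      · obtain rfl | rfl := (by decide : ∀ v w : Fin 3, v ≠ w → v = w + 1 ∨ v = w + 2) v w hvw
        · exact Set.mem_insert _ _
        · exact Set.mem_insert_of_mem _ rfl
      · rintro p (rfl | rfl) <;> exact polarIndices_subset τ v _ hq
  · refine ⟨q + 𝐞 v, Or.inl ⟨v, rfl⟩, fun p hp => ?_⟩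
    rcases mem_regionSet.1 hp with ⟨i, rfl⟩ | ⟨n, rfl, rfl⟩
    · exact polarIndices_subset τ v _ hq
    · set u := τ n with hu
      have hdeg : ∀ i, (n.1 + 𝐞 i).degree + 1 = d := fun i => by
        rw [map_add, Finsupp.degree_single, add_assoc, n.2]
      have hnr : ∀ i, i ≠ u → ¬ IsRemoved τ (n.1 + 𝐞 i) i := by
        rintro i hi ⟨n', h1, h2⟩
        have := Subtype.ext (add_right_cancel h1)
        exact hi (by rw [← h2, this])
      -- The new vertex n x_{u+1} x_{u+2} of a merged u-triangle: for v = u it is compared with a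
      -- corner of the region inside the up triangle of n x_{u+1}; for the other two v, a kept edge
      -- of n gives equality with the corner n x_u x_v.
      obtain rfl | rfl | rfl := (by decide : ∀ u v : Fin 3, v = u ∨ v = u + 1 ∨ v = u + 2) u v
      · have h1 := polarIndices_subset τ u (u + 2) (hdeg (u + 1))
        refine h1.trans ?_
        rw [add_right_comm]
        exact polarIndices_subset τ u (u + 1) hq
      · have h1 := polarIndices_eq_of_not_isRemoved τ _ (hdeg (u + 1))
          (hnr _ ((by decide : ∀ u : Fin 3, u + 1 ≠ u) u))
        rw [(by decide : ∀ u : Fin 3, u + 1 + 1 = u + 2) u,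
          (by decide : ∀ u : Fin 3, u + 1 + 2 = u) u] at h1
        rw [h1, add_right_comm]
      · have h1 := polarIndices_eq_of_not_isRemoved τ _ (hdeg (u + 2))
          (hnr _ ((by decide : ∀ u : Fin 3, u + 2 ≠ u) u))
        rw [(by decide : ∀ u : Fin 3, u + 2 + 1 = u) u,
          (by decide : ∀ u : Fin 3, u + 2 + 2 = u + 1) u] at h1
        rw [add_right_comm n.1 (𝐞 (u + 1)), ← h1, add_right_comm]

end Chains

/-! ### Exposed points, dimension of faces, and existence of facets -/

section Polytopes

variable {E : Type*} [NormedAddCommGroup E] [NormedSpace ℝ E]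

/-- A functional separating x strictly from the hull of the other generators attains its maximum
over the polytope only at x. -/
theorem isExposed_singleton_of_notMem_convexHull [DecidableEq E] {s : Finset E} {x : E}
    (hx : x ∈ s) (h : x ∉ convexHull ℝ (s.erase x : Set E)) :
    IsExposed ℝ (convexHull ℝ (s : Set E)) {x} := by
  obtain ⟨f, u, h1, h2⟩ := geometric_hahn_banach_closed_point (convex_convexHull ℝ _)
    ((s.erase x).finite_toSet.isCompact_convexHull ℝ).isClosed h
  have h3 : ∀ y ∈ convexHull ℝ (s : Set E), f y ≤ f x := by
    intro y hy
    refine convexHull_min (t := {y | f y ≤ f x}) ?_ (convex_halfSpace_le f.isLinear _) hy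
    intro z hz
    by_cases hzx : z = x
    · change f z ≤ f x
      rw [hzx]
    · exact ((h1 z (subset_convexHull ℝ _ (by simpa [hzx] using hz))).trans h2).le
  refine fun _ => ⟨f, Set.eq_of_subset_of_subset ?_ ?_⟩
  · rintro _ rfl
    exact ⟨subset_convexHull ℝ _ hx, h3⟩
  · rintro y ⟨hy, hy'⟩
    have hxy := hy' x (subset_convexHull ℝ _ hx)
    by_contra hne
    have hs : (s : Set E) = insert x (s.erase x : Set E) := by
      rw [← Finset.coe_insert, Finset.insert_erase hx]
    rcases Set.eq_empty_or_nonempty (s.erase x : Set E) with he | hne'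
    · rw [hs, he] at hy
      simp at hy
      exact hne hy
    rw [hs, convexHull_insert hne', convexJoin_singleton_left] at hy
    obtain ⟨z, hz, hyz⟩ := Set.mem_iUnion₂.1 hy
    obtain ⟨a, b, ha, hb, hab, rfl⟩ := hyz
    have hfz := h1 z hz
    rw [map_add, map_smul, map_smul, smul_eq_mul, smul_eq_mul] at hxy
    have hb0 : b = 0 := by
      by_contra hb0
      have hbpos : 0 < b := lt_of_le_of_ne hb (Ne.symm hb0)
      obtain rfl : a = 1 - b := by linarith
      nlinarith [mul_lt_mul_of_pos_left (hfz.trans h2) hbpos]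
    subst hb0
    refine hne ?_
    rw [add_zero] at hab
    simp [hab]

/-- A generating subset of least cardinality contains no redundant point, so each of its points is
exposed. -/
theorem exists_subset_convexHull_eq (s : Finset E) : ∃ t ⊆ s,
    convexHull ℝ (t : Set E) = convexHull ℝ (s : Set E) ∧
    ∀ x ∈ t, IsExposed ℝ (convexHull ℝ (s : Set E)) {x} := by
  classical
  obtain ⟨t, ht, hmin⟩ := Finset.exists_min_image
    (s.powerset.filter fun t : Finset E => convexHull ℝ (t : Set E) = convexHull ℝ (s : Set E))
    Finset.card ⟨s, by simp⟩
  rw [Finset.mem_filter, Finset.mem_powerset] at ht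
  refine ⟨t, ht.1, ht.2, fun x hx => ?_⟩
  rw [← ht.2]
  refine isExposed_singleton_of_notMem_convexHull hx fun h => ?_
  have := hmin (t.erase x) (by
    rw [Finset.mem_filter, Finset.mem_powerset]
    refine ⟨(Finset.erase_subset _ _).trans ht.1, ?_⟩
    rw [← ht.2]
    refine (convexHull_mono (by simp)).antisymm (convexHull_min ?_ (convex_convexHull ℝ _))
    intro y hy
    by_cases hyx : y = x
    · rw [hyx]
      exact h
    · exact subset_convexHull ℝ _ (by simpa [hyx] using hy))
  rw [Finset.card_erase_of_mem hx] at this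
  have := Finset.card_pos.2 ⟨x, hx⟩
  omega

theorem not_isExposed_of_wbtw {P : Set E} {x y z : E} (hx : x ∈ P) (hz : z ∈ P)
    (h : Wbtw ℝ x y z) (hxy : x ≠ y) (hyz : y ≠ z) : ¬ IsExposed ℝ P {y} := by
  intro hy
  obtain ⟨l, hl⟩ := hy ⟨y, rfl⟩
  have key : ∀ w ∈ P, l w ≤ l y ∧ (l w = l y → w = y) := by
    have hy' : y ∈ {x ∈ P | ∀ y ∈ P, l y ≤ l x} := hl ▸ Set.mem_singleton y
    refine fun w hw => ⟨hy'.2 w hw, fun h => ?_⟩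
    have : w ∈ {x ∈ P | ∀ y ∈ P, l y ≤ l x} := ⟨hw, fun u hu => by rw [h]; exact hy'.2 u hu⟩
    rw [← hl] at this
    exact this
  obtain ⟨t, ⟨h0, h1⟩, rfl⟩ := h
  have hlx := key x hx
  have hlz := key z hz
  have hlx' := lt_of_le_of_ne hlx.1 fun h => hxy (hlx.2 h)
  have hlz' := lt_of_le_of_ne hlz.1 fun h => hyz (hlz.2 h).symm
  have h2 : l (AffineMap.lineMap x z t) = l x + t * (l z - l x) := by
    simp [AffineMap.lineMap_apply]
    ring
  rw [h2] at hlx' hlz'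
  rcases le_total (l z) (l x) with h | h <;> nlinarith

variable [FiniteDimensional ℝ E]

/-- If the direction spaces agreed, the functional exposing F would be constant on all of P. -/
theorem IsExposed.finrank_vectorSpan_lt {P F : Set E} (h : IsExposed ℝ P F) (hF : F.Nonempty)
    (hne : F ≠ P) :
    Module.finrank ℝ (vectorSpan ℝ F) < Module.finrank ℝ (vectorSpan ℝ P) := by
  refine Submodule.finrank_lt_finrank_of_lt
    (lt_of_le_of_ne (vectorSpan_mono ℝ h.subset) fun heq => hne ?_)
  obtain ⟨l, rfl⟩ := h hF
  obtain ⟨x, hx⟩ := hF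
  refine Set.Subset.antisymm (fun y hy => hy.1) fun y hy => ⟨hy, fun z hz => ?_⟩
  suffices h : y -ᵥ x ∈ LinearMap.ker (l : E →ₗ[ℝ] ℝ) by
    have h2 : l y = l x := by simpa [sub_eq_zero] using h
    rw [h2]
    exact hx.2 z hz
  have h1 : y -ᵥ x ∈ vectorSpan ℝ P := vsub_mem_vectorSpan ℝ hy hx.1
  rw [← heq] at h1
  refine (Submodule.span_le.2 ?_ : vectorSpan ℝ _ ≤ _) h1
  rintro _ ⟨a, ha, b, hb, rfl⟩
  simp only [vsub_eq_sub, SetLike.mem_coe, LinearMap.mem_ker, map_sub, sub_eq_zero]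
  exact le_antisymm (hb.2 a ha.1) (ha.2 b hb.1)

/-- Every proper nonempty face of a polytope is contained in a facet. -/
theorem exists_facet {s : Finset E} {F : Set E} (hF : IsExposed ℝ (convexHull ℝ (s : Set E)) F)
    (hne : F.Nonempty) (hproper : F ≠ convexHull ℝ (s : Set E)) :
    ∃ F', IsExposed ℝ (convexHull ℝ (s : Set E)) F' ∧ F ⊆ F' ∧ F' ≠ convexHull ℝ (s : Set E) ∧
      Module.finrank ℝ (vectorSpan ℝ F') + 1 =
        Module.finrank ℝ (vectorSpan ℝ (convexHull ℝ (s : Set E))) := by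
  classical
  set P := convexHull ℝ (s : Set E) with hP
  obtain ⟨F', ⟨h1, h2, h3⟩, hmax⟩ : ∃ F', (IsExposed ℝ P F' ∧ F ⊆ F' ∧ F' ≠ P) ∧
      ∀ F'', IsExposed ℝ P F'' ∧ F ⊆ F'' ∧ F'' ≠ P →
      Module.finrank ℝ (vectorSpan ℝ F'') ≤ Module.finrank ℝ (vectorSpan ℝ F') := by
    have hbdd : BddAbove ((fun F' => Module.finrank ℝ (vectorSpan ℝ F')) ''
        {F' | IsExposed ℝ P F' ∧ F ⊆ F' ∧ F' ≠ P}) :=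
      ⟨Module.finrank ℝ E, by rintro _ ⟨F', -, rfl⟩; exact Submodule.finrank_le _⟩
    have hnon : {F' | IsExposed ℝ P F' ∧ F ⊆ F' ∧ F' ≠ P}.Nonempty := ⟨F, hF, subset_rfl, hproper⟩
    obtain ⟨F', h1, h2⟩ := Nat.sSup_mem (hnon.image _) hbdd
    refine ⟨F', h1, fun F'' h => ?_⟩
    have h3 := le_csSup hbdd (Set.mem_image_of_mem _ h)
    rwa [← h2] at h3
  refine ⟨F', h1, h2, h3, ?_⟩
  have hne' := hne.mono h2
  have hlt := h1.finrank_vectorSpan_lt hne' h3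
  by_contra hcon
  obtain ⟨l, hl⟩ := h1 hne'
  obtain ⟨x, hx⟩ := hne'
  have hx' := hx
  rw [hl] at hx'
  have hlF : ∀ y ∈ F', l y = l x := fun y hy => by
    rw [hl] at hy
    exact le_antisymm (hx'.2 y hy.1) (hy.2 x hx'.1)
  -- The face F' has maximal dimension among proper faces containing F. If its codimension were at
  -- least 2, the kernel of l would contain a direction of P outside the span of F'.
  obtain ⟨v, hvD, hvl, hvF⟩ : ∃ v ∈ vectorSpan ℝ P, l v = 0 ∧ v ∉ vectorSpan ℝ F' := by
    by_contra! hall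
    by_cases hw : ∃ w ∈ vectorSpan ℝ P, l w ≠ 0
    · obtain ⟨w, hwD, hlw⟩ := hw
      have hle : vectorSpan ℝ P ≤ vectorSpan ℝ F' ⊔ Submodule.span ℝ {w} := by
        intro y hy
        refine Submodule.mem_sup.2 ⟨y - (l y / l w) • w, ?_, (l y / l w) • w,
          Submodule.smul_mem _ _ (Submodule.mem_span_singleton_self w), by simp⟩
        refine hall _ (Submodule.sub_mem _ hy (Submodule.smul_mem _ _ hwD)) ?_
        simp [hlw]
      have h4 := Submodule.finrank_mono hle
      have h5 := Submodule.finrank_add_le_finrank_add_finrank (vectorSpan ℝ F')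
        (Submodule.span ℝ {w})
      have h6 := finrank_span_le_card (R := ℝ) ({w} : Set E)
      simp at h6
      omega
    · push Not at hw
      have h4 := Submodule.finrank_mono (fun y hy => hall y hy (hw y hy) :
        vectorSpan ℝ P ≤ vectorSpan ℝ F')
      omega
  obtain ⟨g, hgv, hgF⟩ := Submodule.exists_le_ker_of_notMem hvF
  have hgF' : ∀ y ∈ F', g y = g x := fun y hy => by
    have := hgF (vsub_mem_vectorSpan ℝ hy hx)
    simpa [sub_eq_zero] using this
  have hspan : ∀ m : E →ₗ[ℝ] ℝ, (∀ y ∈ s, m y = m x) → m v = 0 := by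
    intro m hm
    have hm' : ∀ y ∈ P, m y = m x := by
      intro y hy
      refine le_antisymm ?_ ?_
      · exact convexHull_min (t := {y | m y ≤ m x}) (fun z hz => (hm z hz).le)
          (convex_halfSpace_le m.isLinear _) hy
      · exact convexHull_min (t := {y | m x ≤ m y}) (fun z hz => (hm z hz).ge)
          (convex_halfSpace_ge m.isLinear _) hy
    have h4 : vectorSpan ℝ P ≤ LinearMap.ker m := by
      refine Submodule.span_le.2 ?_
      rintro _ ⟨a, ha, b, hb, rfl⟩
      simp [hm' a ha, hm' b hb]
    exact h4 hvD
  -- As g v ≠ 0, g is not constantly g x on the generators; up to sign it exceeds g x at one of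
  -- them.
  obtain ⟨g, hgv, hgF, s1, hs1, hgs1⟩ : ∃ g : E →ₗ[ℝ] ℝ, g v ≠ 0 ∧ (∀ y ∈ F', g y = g x) ∧
      ∃ s1 ∈ s, g x < g s1 := by
    by_cases hpos : ∃ s1 ∈ s, g x < g s1
    · exact ⟨g, hgv, hgF', hpos⟩
    · refine ⟨-g, by simpa using hgv, fun y hy => by simp [hgF' y hy], ?_⟩
      by_contra! hneg
      push Not at hpos
      refine hgv (hspan g fun y hy => le_antisymm (hpos y hy) ?_)
      have := hneg y hy
      simpa using this
  have hlt' : ∀ y ∈ s, g x < g y → l y < l x := by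
    intro y hy hgy
    have hyP : y ∈ P := subset_convexHull ℝ _ hy
    refine lt_of_le_of_ne (hx'.2 y hyP) fun h => ?_
    have : y ∈ F' := by
      rw [hl]
      exact ⟨hyP, fun z hz => by rw [h]; exact hx'.2 z hz⟩
    rw [hgF y this] at hgy
    exact lt_irrefl _ hgy
  -- The functional l is tilted to l + t g, with t the least value at which a generator outside F'
  -- becomes maximal. The face it exposes contains F' and s0.
  obtain ⟨s0, hs0, hmin⟩ := Finset.exists_min_image (s.filter fun y => g x < g y)
    (fun y => (l x - l y) / (g y - g x)) ⟨s1, by simp [hs1, hgs1]⟩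
  rw [Finset.mem_filter] at hs0
  set t := (l x - l s0) / (g s0 - g x) with ht
  have htpos : 0 < t := div_pos (sub_pos.2 (hlt' _ hs0.1 hs0.2)) (sub_pos.2 hs0.2)
  let m : StrongDual ℝ E := l + t • g.toContinuousLinearMap
  have hm : ∀ y, m y = l y + t * g y := fun y => by simp [m]
  have hmle : ∀ y ∈ P, m y ≤ m x := by
    intro y hy
    refine convexHull_min (t := {y | m y ≤ m x}) ?_ (convex_halfSpace_le m.isLinear _) hy
    intro z hz
    simp only [Set.mem_ofPred_eq, hm]
    by_cases hgz : g x < g z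
    · have := hmin z (by simp [hgz]; exact hz)
      rw [le_div_iff₀ (sub_pos.2 hgz)] at this
      linarith
    · have := hx'.2 z (subset_convexHull ℝ _ hz)
      nlinarith
  have hms0 : m s0 = m x := by
    rw [hm, hm]
    have : t * (g s0 - g x) = l x - l s0 := div_mul_cancel₀ _ (sub_pos.2 hs0.2).ne'
    linarith
  have hs0P : s0 ∈ P := subset_convexHull ℝ _ hs0.1
  have hsub : F' ⊆ m.toExposed P := by
    intro y hy
    refine ⟨h1.subset hy, fun z hz => ?_⟩
    rw [hm y, hlF y hy, hgF y hy, ← hm]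
    exact hmle z hz
  have hs0m : s0 ∈ m.toExposed P := ⟨hs0P, fun z hz => by rw [hms0]; exact hmle z hz⟩
  -- The tilted functional takes the value t g v ≠ 0 on v, so it is not constant on P and its face
  -- is proper.
  have hnP : m.toExposed P ≠ P := by
    intro h
    have h5 := hspan (m : E →ₗ[ℝ] ℝ) (fun y hy => by
      have hyP : y ∈ m.toExposed P := by
        rw [h]
        exact subset_convexHull ℝ _ hy
      exact le_antisymm (hmle y hyP.1) (hyP.2 x hx'.1))
    have h6 : m v = 0 := h5
    rw [hm, hvl, zero_add] at h6
    exact hgv ((mul_eq_zero.1 h6).resolve_left htpos.ne')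
  have h7 := hmax _ ⟨ContinuousLinearMap.toExposed.isExposed, h2.trans hsub, hnP⟩
  have h8 : vectorSpan ℝ F' < vectorSpan ℝ (m.toExposed P) := by
    refine lt_of_le_of_ne (vectorSpan_mono ℝ hsub) fun h => ?_
    have h9 : s0 -ᵥ x ∈ vectorSpan ℝ F' := by
      rw [h]
      exact vsub_mem_vectorSpan ℝ hs0m (hsub hx)
    have h10 : vectorSpan ℝ F' ≤ LinearMap.ker g := by
      refine Submodule.span_le.2 ?_
      rintro _ ⟨a, ha, b, hb, rfl⟩
      simp [hgF a ha, hgF b hb]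
    have := h10 h9
    simp only [vsub_eq_sub, LinearMap.mem_ker, map_sub] at this
    linarith [hs0.2]
  exact absurd (Submodule.finrank_lt_finrank_of_lt h8) (not_lt.2 h7)

end Polytopes

/-! ### Vertices, facets and edges in a polyhedral complex -/

namespace PolyhedralComplex

variable {N : ℕ} (X : PolyhedralComplex N)

theorem isExposed_of_subset {P Q : Set (EuclideanSpace ℝ (Fin N))} (hP : P ∈ X.faces)
    (hQ : Q ∈ X.faces) (h : P ⊆ Q) : IsExposed ℝ Q P := by
  have := (X.inter_isFace P hP Q hQ).2
  rwa [Set.inter_eq_left.2 h] at this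

theorem exists_facet_of_subset {P Q : Set (EuclideanSpace ℝ (Fin N))} (hP : P ∈ X.faces)
    (hQ : Q ∈ X.faces) (h : P ⊆ Q) (hne : P.Nonempty) (hPQ : P ≠ Q) :
    ∃ P' ∈ X.faces, P ⊆ P' ∧ P' ⊆ Q ∧ P' ≠ Q ∧
      Module.finrank ℝ (vectorSpan ℝ P') + 1 = Module.finrank ℝ (vectorSpan ℝ Q) := by
  obtain ⟨s, rfl⟩ := X.isPolytope Q hQ
  obtain ⟨F, h1, h2, h3, h4⟩ := exists_facet (X.isExposed_of_subset hP hQ h) hne hPQ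
  exact ⟨F, X.face_mem _ hQ _ h1, h2, h1.subset, h3, h4⟩

variable {X}

theorem exists_eq_singleton (v : X.Cell 0) : ∃ x, v.1 = {x} := by
  obtain ⟨x, hx⟩ := v.2.2.1
  have h : (v.1).Subsingleton := by
    rw [← vectorSpan_eq_bot_iff_subsingleton (k := ℝ), ← Submodule.finrank_eq_zero (R := ℝ)]
    exact v.2.2.2
  exact ⟨x, h.eq_singleton_of_mem hx⟩

theorem exists_cell_zero {x : EuclideanSpace ℝ (Fin N)} (h : {x} ∈ X.faces) :
    ∃ v : X.Cell 0, v.1 = {x} :=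
  ⟨⟨{x}, h, Set.singleton_nonempty x, by rw [vectorSpan_singleton, finrank_bot]⟩, rfl⟩

/-- The exposed points that generate a polytope of the complex are themselves faces, hence 0-cells.
Consequently a cell is determined by its set of vertices. -/
theorem eq_convexHull_verts {P : Set (EuclideanSpace ℝ (Fin N))} (hP : P ∈ X.faces) :
    P = convexHull ℝ (⋃ v ∈ X.verts P, v.1) := by
  obtain ⟨s, rfl⟩ := X.isPolytope P hP
  obtain ⟨t, -, h2, h3⟩ := exists_subset_convexHull_eq s
  refine Set.Subset.antisymm ?_ (convexHull_min ?_ (convex_convexHull ℝ _))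
  · conv_lhs => rw [← h2]
    refine convexHull_mono fun x hx => ?_
    obtain ⟨v, hv⟩ := exists_cell_zero (X.face_mem _ hP _ (h3 x hx))
    refine Set.mem_iUnion₂.2 ⟨v, ?_, by rw [hv]; rfl⟩
    change v.1 ⊆ _
    rw [hv]
    exact (h3 x hx).subset
  · exact Set.iUnion₂_subset fun v hv => hv

theorem subset_of_verts_subset {P Q : Set (EuclideanSpace ℝ (Fin N))} (hP : P ∈ X.faces)
    (hQ : Q ∈ X.faces) (h : X.verts P ⊆ X.verts Q) : P ⊆ Q := by
  rw [eq_convexHull_verts hP, eq_convexHull_verts hQ]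
  exact convexHull_mono (Set.biUnion_mono h fun _ _ => subset_rfl)

theorem verts_mono {P Q : Set (EuclideanSpace ℝ (Fin N))} (h : P ⊆ Q) : X.verts P ⊆ X.verts Q :=
  fun _ hv => Set.Subset.trans hv h

theorem eq_of_verts_eq {P Q : Set (EuclideanSpace ℝ (Fin N))} (hP : P ∈ X.faces)
    (hQ : Q ∈ X.faces) (h : X.verts P = X.verts Q) : P = Q :=
  (subset_of_verts_subset hP hQ h.subset).antisymm (subset_of_verts_subset hQ hP h.symm.subset)

theorem verts_nonempty {P : Set (EuclideanSpace ℝ (Fin N))} (hP : P ∈ X.faces)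
    (hne : P.Nonempty) : (X.verts P).Nonempty := by
  rw [Set.nonempty_iff_ne_empty]
  intro h
  rw [eq_convexHull_verts hP, h] at hne
  simp at hne

theorem verts_cell_zero (v : X.Cell 0) : X.verts v.1 = {v} := by
  ext u
  simp only [verts, Set.mem_ofPred_eq, Set.mem_singleton_iff]
  constructor
  · intro h
    obtain ⟨x, hx⟩ := exists_eq_singleton v
    refine Subtype.ext ?_
    rw [hx] at h ⊢
    exact (Set.subset_singleton_iff_eq.1 h).resolve_left u.2.2.1.ne_empty
  · rintro rfl
    exact subset_rfl

/-- An edge has exactly two vertices. -/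
theorem exists_verts_eq_pair (e : X.Cell 1) : ∃ u v, u ≠ v ∧ X.verts e.1 = {u, v} := by
  obtain ⟨u, hu⟩ := verts_nonempty e.2.1 e.2.2.1
  have hue : u.1 ≠ e.1 := by
    intro h
    have h1 := u.2.2.2
    rw [h, e.2.2.2] at h1
    exact one_ne_zero h1
  obtain ⟨v, hv, huv⟩ : ∃ v ∈ X.verts e.1, v ≠ u := by
    by_contra! h
    refine hue (eq_of_verts_eq u.2.1 e.2.1 ?_)
    rw [verts_cell_zero]
    exact (Set.eq_singleton_iff_unique_mem.2 ⟨hu, h⟩).symm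
  refine ⟨u, v, huv.symm, Set.Subset.antisymm ?_ ?_⟩
  · intro w hw
    by_contra hne
    simp only [Set.mem_insert_iff, Set.mem_singleton_iff, not_or] at hne
    obtain ⟨x, hx⟩ := exists_eq_singleton u
    obtain ⟨y, hy⟩ := exists_eq_singleton v
    obtain ⟨z, hz⟩ := exists_eq_singleton w
    have hex := X.isExposed_of_subset u.2.1 e.2.1 hu
    have hey := X.isExposed_of_subset v.2.1 e.2.1 hv
    have hez := X.isExposed_of_subset w.2.1 e.2.1 hw
    have hxy : x ≠ y := fun h => huv (Subtype.ext (by rw [hx, hy, h]))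
    have hzx : z ≠ x := fun h => hne.1 (Subtype.ext (by rw [hx, hz, h]))
    have hzy : z ≠ y := fun h => hne.2 (Subtype.ext (by rw [hy, hz, h]))
    rw [hx] at hex
    rw [hy] at hey
    rw [hz] at hez
    have hxe := hex.subset rfl
    have hye := hey.subset rfl
    have hze := hez.subset rfl
    -- Three vertices of a 1-dimensional cell are collinear; the one between the other two cannot be
    -- exposed.
    have hcol : Collinear ℝ ({x, y, z} : Set (EuclideanSpace ℝ (Fin N))) := by
      rw [collinear_iff_finrank_le_one, ← e.2.2.2]
      refine Submodule.finrank_mono (vectorSpan_mono ℝ ?_)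
      rintro _ (rfl | rfl | rfl) <;> assumption
    rcases hcol.wbtw_or_wbtw_or_wbtw with h | h | h
    · exact not_isExposed_of_wbtw hxe hze h hxy hzy.symm hey
    · exact not_isExposed_of_wbtw hye hxe h hzy.symm hzx hez
    · exact not_isExposed_of_wbtw hze hye h hzx hxy hex
  · rintro _ (rfl | rfl) <;> assumption

end PolyhedralComplex

/-! ### Exactness of monomial matrices, by multidegree and under identification of variables -/

section MonomialMatrices

variable {σ : Type*} {k : Type*} [Field k] {A B C : Type*} [Fintype A] [Fintype B]

/-- The matrix of a homogeneous map between multigraded free modules with generators in degrees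
`α` and `β` and with scalar coefficients `M`. -/
noncomputable def monoMatrix (α : A → σ →₀ ℕ) (β : B → σ →₀ ℕ) (M : B → A → k) :
    Matrix B A (MvPolynomial σ k) :=
  Matrix.of fun b a => monomial (α a - β b) (M b a)

open Classical in
/-- Exactness of scalar matrices in each multidegree gives exactness of monomial matrices. -/
theorem exists_mulVec_monoMatrix_of_graded (α : A → σ →₀ ℕ) (β : B → σ →₀ ℕ) (γ : C → σ →₀ ℕ)
    (M : B → A → k) (N : C → B → k) (hM : ∀ b a, M b a ≠ 0 → β b ≤ α a)
    (hN : ∀ c b, N c b ≠ 0 → γ c ≤ β b)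
    (H : ∀ (m : σ →₀ ℕ) (z : B → k), (∀ b, z b ≠ 0 → β b ≤ m) → (∀ c, ∑ b, N c b * z b = 0) →
      ∃ u : A → k, (∀ a, u a ≠ 0 → α a ≤ m) ∧ ∀ b, z b = ∑ a, M b a * u a)
    (w : B → MvPolynomial σ k) (hw : (monoMatrix β γ N).mulVec w = 0) :
    ∃ u, (monoMatrix α β M).mulVec u = w := by
  -- The scalar hypothesis is applied to the component of w in multidegree m.
  have H' : ∀ m : σ →₀ ℕ, ∃ u : A → k, (∀ a, u a ≠ 0 → α a ≤ m) ∧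
      ∀ b, (if β b ≤ m then coeff (m - β b) (w b) else 0) = ∑ a, M b a * u a := by
    intro m
    refine H m _ (fun b hb => by by_contra h; simp [h] at hb) fun c => ?_
    by_cases hc : γ c ≤ m
    · have := congrArg (coeff (m - γ c)) (congrFun hw c)
      simp only [Matrix.mulVec, dotProduct, monoMatrix, Matrix.of_apply, Pi.zero_apply,
        coeff_zero, coeff_sum, coeff_monomial_mul'] at this
      refine Eq.trans (Finset.sum_congr rfl fun b _ => ?_) this
      by_cases hb : N c b = 0
      · simp [hb]
      have hle := hN c b hb
      by_cases hbm : β b ≤ m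
      · rw [if_pos hbm, if_pos (tsub_le_tsub_right hbm _), tsub_tsub_tsub_cancel_right hle]
      · rw [if_neg hbm, if_neg, mul_zero]
        intro h
        exact hbm ((tsub_le_tsub_iff_right hc).1 h)
    · refine Finset.sum_eq_zero fun b _ => ?_
      by_cases hb : N c b = 0
      · simp [hb]
      · rw [if_neg (fun h => hc ((hN c b hb).trans h)), mul_zero]
  choose U hU hU' using H'
  -- The finitely many multidegrees in which w has a nonzero component.
  let S : Finset (σ →₀ ℕ) := Finset.univ.biUnion fun b => (w b).support.image (· + β b)
  refine ⟨fun a => ∑ m ∈ S, monomial (m - α a) (U m a), funext fun b => ?_⟩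
  have key : ∀ m, ∑ a, monomial (α a - β b) (M b a) * monomial (m - α a) (U m a) =
      if β b ≤ m then monomial (m - β b) (coeff (m - β b) (w b)) else 0 := by
    intro m
    have h1 : ∀ a, monomial (α a - β b) (M b a) * monomial (m - α a) (U m a) =
        monomial (m - β b) (M b a * U m a) := by
      intro a
      rw [monomial_mul]
      by_cases h0 : M b a = 0
      · simp [h0]
      by_cases h1 : U m a = 0
      · simp [h1]
      rw [add_comm, tsub_add_tsub_cancel (hU m a h1) (hM b a h0)]
    simp only [h1]
    rw [← map_sum, ← hU' m b]
    split_ifs <;> simp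
  simp only [Matrix.mulVec, dotProduct, monoMatrix, Matrix.of_apply, Finset.mul_sum]
  rw [Finset.sum_comm]
  simp only [key]
  rw [← Finset.sum_filter]
  conv_rhs => rw [(w b).as_sum]
  symm
  refine Finset.sum_bij_ne_zero (fun t _ _ => t + β b) ?_ ?_ ?_ ?_
  · intro t ht _
    simp only [S, Finset.mem_filter, Finset.mem_biUnion, Finset.mem_univ, true_and]
    exact ⟨⟨b, Finset.mem_image_of_mem _ ht⟩, le_add_self⟩
  · intro t _ _ t' _ _ h
    exact add_right_cancel h
  · intro m hm hm0
    have hle := (Finset.mem_filter.1 hm).2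
    refine ⟨m - β b, ?_, hm0, tsub_add_cancel_of_le hle⟩
    rw [mem_support_iff]
    intro h
    simp [h] at hm0
  · intro t _ _
    simp

open Classical in
/-- Exactness of monomial matrices gives exactness of scalar matrices in each multidegree. -/
theorem exists_graded_of_mulVec_monoMatrix (α : A → σ →₀ ℕ) (β : B → σ →₀ ℕ) (γ : C → σ →₀ ℕ)
    (M : B → A → k) (N : C → B → k) (hM : ∀ b a, M b a ≠ 0 → β b ≤ α a)
    (hN : ∀ c b, N c b ≠ 0 → γ c ≤ β b)
    (H : ∀ w : B → MvPolynomial σ k, (monoMatrix β γ N).mulVec w = 0 →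
      ∃ u, (monoMatrix α β M).mulVec u = w)
    (m : σ →₀ ℕ) (z : B → k) (hz : ∀ b, z b ≠ 0 → β b ≤ m)
    (hz' : ∀ c, ∑ b, N c b * z b = 0) :
    ∃ u : A → k, (∀ a, u a ≠ 0 → α a ≤ m) ∧ ∀ b, z b = ∑ a, M b a * u a := by
  -- The scalars z define a homogeneous vector of multidegree m; the component of multidegree m of a
  -- preimage gives the scalar preimage.
  obtain ⟨u, hu⟩ := H (fun b => monomial (m - β b) (z b)) (funext fun c => by
    simp only [Matrix.mulVec, dotProduct, monoMatrix, Matrix.of_apply, Pi.zero_apply]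
    have h1 : ∀ b, monomial (β b - γ c) (N c b) * monomial (m - β b) (z b) =
        monomial (m - γ c) (N c b * z b) := by
      intro b
      rw [monomial_mul]
      by_cases h0 : N c b = 0
      · simp [h0]
      by_cases h1 : z b = 0
      · simp [h1]
      rw [add_comm, tsub_add_tsub_cancel (hz b h1) (hN c b h0)]
    simp only [h1]
    rw [← map_sum, hz' c, map_zero])
  refine ⟨fun a => if α a ≤ m then coeff (m - α a) (u a) else 0,
    fun a ha => by by_contra h; simp [h] at ha, fun b => ?_⟩
  by_cases hb : β b ≤ m
  · have := congrArg (coeff (m - β b)) (congrFun hu b)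
    simp only [Matrix.mulVec, dotProduct, monoMatrix, Matrix.of_apply, coeff_sum,
      coeff_monomial_mul', coeff_monomial, if_true] at this
    rw [← this]
    refine Finset.sum_congr rfl fun a _ => ?_
    beta_reduce
    by_cases ha : M b a = 0
    · simp [ha]
    have hle := hM b a ha
    by_cases ham : α a ≤ m
    · rw [if_pos ham, if_pos (tsub_le_tsub_right ham _), tsub_tsub_tsub_cancel_right hle]
    · rw [if_neg ham, if_neg, mul_zero]
      intro h
      exact ham ((tsub_le_tsub_iff_right hb).1 h)
  · rw [by_contra fun h => hb (hz b h)]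
    symm
    refine Finset.sum_eq_zero fun a _ => ?_
    beta_reduce
    by_cases ha : M b a = 0
    · simp [ha]
    · rw [if_neg (fun h => hb ((hM b a ha).trans h)), mul_zero]

/-- The part of a polynomial of total degree less than `n`. -/
noncomputable def truncDegree (n : ℕ) : MvPolynomial σ k →ₗ[k] MvPolynomial σ k :=
  ∑ i ∈ Finset.range n, homogeneousComponent i

theorem coeff_truncDegree (n : ℕ) (f : MvPolynomial σ k) (t : σ →₀ ℕ) :
    coeff t (truncDegree n f) = if t.degree < n then coeff t f else 0 := by
  simp only [truncDegree, LinearMap.sum_apply, coeff_sum, coeff_homogeneousComponent]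
  simp

theorem truncDegree_monomial_mul (n : ℕ) (μ : σ →₀ ℕ) (c : k) (f : MvPolynomial σ k) :
    truncDegree n (monomial μ c * f) = monomial μ c * truncDegree (n - μ.degree) f := by
  ext t
  rw [coeff_truncDegree, coeff_monomial_mul', coeff_monomial_mul']
  by_cases h : μ ≤ t
  · obtain ⟨s, rfl⟩ := exists_add_of_le h
    rw [if_pos h, if_pos h, add_tsub_cancel_left, coeff_truncDegree, map_add]
    by_cases h2 : μ.degree + s.degree < n
    · rw [if_pos h2, if_pos (by omega)]
    · rw [if_neg h2, if_neg (by omega), mul_zero]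
  · simp [h]

theorem truncDegree_of_totalDegree_lt {n : ℕ} {f : MvPolynomial σ k} (h : f.totalDegree < n) :
    truncDegree n f = f := by
  ext t
  rw [coeff_truncDegree]
  split_ifs with ht
  · rfl
  · symm
    by_contra h0
    have := le_totalDegree (mem_support_iff.2 h0)
    rw [Finsupp.sum, ← Finsupp.degree_apply] at this
    omega

theorem truncDegree_homogeneous_mul {n m : ℕ} {y : MvPolynomial σ k} (hy : y.IsHomogeneous m)
    (hnm : n ≤ m) (f : MvPolynomial σ k) : truncDegree n (y * f) = 0 := by
  classical
  ext t
  rw [coeff_truncDegree, coeff_zero]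
  split_ifs with ht
  · rw [coeff_mul]
    refine Finset.sum_eq_zero fun x hx => ?_
    have hx' := Finset.HasAntidiagonal.mem_antidiagonal.1 hx
    rw [hy.coeff_eq_zero, zero_mul]
    have : x.1.degree + x.2.degree = t.degree := by rw [← map_add, hx']
    omega
  · rfl

/-- Modulo X s - X s' the substitution ρ is the identity, so a polynomial that it kills vanishes in
the quotient. -/
theorem exists_eq_mul_of_rename_eq_zero [DecidableEq σ] {s s' : σ} {ρ : σ → σ}
    (hρ : ∀ t, ρ t = if t = s then s' else t) {f : MvPolynomial σ k} (hf : rename ρ f = 0) :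
    ∃ h, f = (X s - X s') * h := by
  have h1 : (Ideal.Quotient.mkₐ k (Ideal.span {X s - X s'})).comp (rename ρ) =
      Ideal.Quotient.mkₐ k (Ideal.span {(X s - X s' : MvPolynomial σ k)}) := by
    refine MvPolynomial.algHom_ext fun t => ?_
    simp only [AlgHom.comp_apply, rename_X, hρ]
    split_ifs with h
    · subst h
      symm
      exact Ideal.Quotient.eq.2 (Ideal.mem_span_singleton_self _)
    · rfl
  have h2 := DFunLike.congr_fun h1 f
  rw [AlgHom.comp_apply, hf, map_zero] at h2
  exact Ideal.mem_span_singleton.1 (Ideal.Quotient.eq_zero_iff_mem.1 h2.symm)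

open Classical in
/-- If a complex of graded free modules becomes exact after the variable `s` is replaced by the
variable `s'`, then it is exact. -/
theorem exists_mulVec_of_rename {s s' : σ} (ρ : σ → σ)
    (hρ : ∀ t, ρ t = if t = s then s' else t)
    (μ : B → A → σ →₀ ℕ) (c : B → A → k) (dA : A → ℕ) (dB : B → ℕ)
    (hd : ∀ b a, c b a ≠ 0 → dB b + (μ b a).degree = dA a)
    (f f' : Matrix B A (MvPolynomial σ k)) (g g' : Matrix C B (MvPolynomial σ k))
    (hf : ∀ b a, f b a = monomial (μ b a) (c b a))
    (hf' : f' = f.map (rename ρ)) (hg' : g' = g.map (rename ρ)) (hss : s ≠ s')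
    (hgf : g * f = 0)
    (H : ∀ w, g'.mulVec w = 0 → ∃ u, f'.mulVec u = w) (w : B → MvPolynomial σ k)
    (hw : g.mulVec w = 0) : ∃ u, f.mulVec u = w := by
  have hρρ : ρ ∘ ρ = ρ := by
    funext t
    simp only [Function.comp, hρ]
    split_ifs with h1 h2 <;> simp_all
  have hy : (X s - X s' : MvPolynomial σ k) ≠ 0 := sub_ne_zero.2 fun h => hss (X_injective h)
  -- After the identification a cycle w is a boundary, so w is a boundary plus a multiple of X s - X
  -- s'. The cofactor z is again a cycle because X s - X s' is a nonzerodivisor, and the argument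
  -- can be repeated on z.
  have step : ∀ w : B → MvPolynomial σ k, g.mulVec w = 0 →
      ∃ (u : A → MvPolynomial σ k) (z : B → MvPolynomial σ k),
        w = f.mulVec u + (X s - X s' : MvPolynomial σ k) • z ∧ g.mulVec z = 0 := by
    intro w hw
    have h1 : g'.mulVec (rename ρ ∘ w) = 0 := by
      funext c
      have := RingHom.map_mulVec (rename ρ : MvPolynomial σ k →ₐ[k] _).toRingHom g w c
      rw [hw] at this
      rw [hg']
      exact this.symm.trans (map_zero _)
    obtain ⟨u, hu⟩ := H _ h1
    have h2 : ∀ b, rename ρ (w b - f.mulVec u b) = 0 := by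
      intro b
      have h3 := RingHom.map_mulVec (rename ρ : MvPolynomial σ k →ₐ[k] _).toRingHom f u b
      have h4 := RingHom.map_mulVec (rename ρ : MvPolynomial σ k →ₐ[k] _).toRingHom f' u b
      have h5 : f'.map (rename ρ) = f' := by
        rw [hf']
        ext1 b a
        simp [rename_rename, hρρ]
      have h6 := congrFun hu b
      rw [h6] at h4
      have h7 : rename ρ ((rename ρ ∘ w) b) = rename ρ (w b) := by
        simp [rename_rename, hρρ]
      rw [map_sub, sub_eq_zero, ← h7]
      refine h4.trans (Eq.trans ?_ h3.symm)
      congr 1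
      exact h5.trans hf'
    choose z hz using fun b => exists_eq_mul_of_rename_eq_zero hρ (h2 b)
    have hwz : w = f.mulVec u + (X s - X s' : MvPolynomial σ k) • z := by
      funext b
      simp only [Pi.add_apply, Pi.smul_apply, smul_eq_mul, ← hz b]
      ring
    refine ⟨u, z, hwz, ?_⟩
    rw [hwz, Matrix.mulVec_add, Matrix.mulVec_mulVec, hgf, Matrix.zero_mulVec, zero_add,
      Matrix.mulVec_smul] at hw
    exact (smul_eq_zero.1 hw).resolve_left hy
  have iter : ∀ n : ℕ, ∃ (u : A → MvPolynomial σ k) (z : B → MvPolynomial σ k),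
      w = f.mulVec u + (X s - X s' : MvPolynomial σ k) ^ n • z ∧ g.mulVec z = 0 := by
    intro n
    induction n with
    | zero => exact ⟨0, w, by simp, hw⟩
    | succ n ih =>
      obtain ⟨u, z, h1, h2⟩ := ih
      obtain ⟨u', z', h3, h4⟩ := step z h2
      refine ⟨u + ((X s - X s') ^ n : MvPolynomial σ k) • u', z', ?_, h4⟩
      rw [h1, h3, Matrix.mulVec_add, Matrix.mulVec_smul, smul_add, smul_smul, pow_succ, add_assoc]
  -- L is chosen above the total degree of w shifted by the degrees of the generators. Cutting off
  -- in degree L commutes with f and leaves w unchanged, while it kills the remainder, which is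
  -- divisible by the L-th power of a linear form.
  let L : ℕ := (∑ b, ((w b).totalDegree + dB b)) + 1
  obtain ⟨u, z, h1, -⟩ := iter L
  refine ⟨fun a => truncDegree (L - dA a) (u a), funext fun b => ?_⟩
  have h2 : truncDegree (L - dB b) (w b) = w b := by
    refine truncDegree_of_totalDegree_lt ?_
    have := Finset.single_le_sum (f := fun b => (w b).totalDegree + dB b)
      (fun _ _ => Nat.zero_le _) (Finset.mem_univ b)
    simp only [L]
    omega
  have h3 := congrArg (truncDegree (L - dB b)) (congrFun h1 b)
  rw [h2] at h3
  rw [h3]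
  have hhom : ((X s - X s' : MvPolynomial σ k) ^ L).IsHomogeneous L := by
    simpa using ((isHomogeneous_X k s).sub (isHomogeneous_X k s')).pow L
  simp only [Pi.add_apply, Pi.smul_apply, smul_eq_mul, map_add,
    truncDegree_homogeneous_mul hhom (Nat.sub_le _ _), add_zero, Matrix.mulVec, dotProduct, map_sum]
  refine Finset.sum_congr rfl fun a _ => ?_
  rw [hf]
  by_cases hc : c b a = 0
  · simp [hc]
  · rw [truncDegree_monomial_mul, Nat.sub_sub, hd b a hc]

end MonomialMatrices

/-! ### Counting the cells of the triangulation whose labels divide b -/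

section Counting

theorem finite_degree_le (d : ℕ) : {p : Fin 3 →₀ ℕ | p.degree ≤ d}.Finite := by
  refine (Set.finite_Iic (Finsupp.equivFunOnFinite.symm fun _ => d)).subset fun p hp => ?_
  have hp : p.degree ≤ d := hp
  rw [degree_fin_three] at hp
  rw [Set.mem_Iic, finsupp_fin_three_le]
  simp only [Finsupp.equivFunOnFinite_symm_apply_apply]
  omega

instance (d : ℕ) : Finite (DownTriangle d) :=
  ((finite_degree_le d).subset fun n (hn : n.degree + 2 = d) => by
    change n.degree ≤ d
    omega : {n : Fin 3 →₀ ℕ | n.degree + 2 = d}.Finite)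

/-- The exponents of degree `e` such that `p + m ≤ b`. -/
noncomputable def boxFinset (m b : Fin 3 →₀ ℕ) (e : ℕ) : Finset (Fin 3 →₀ ℕ) :=
  ((finite_degree_le e).subset fun p (hp : p + m ≤ b ∧ p.degree = e) => hp.2.le :
    {p | p + m ≤ b ∧ p.degree = e}.Finite).toFinset

theorem mem_boxFinset {m b p : Fin 3 →₀ ℕ} {e : ℕ} :
    p ∈ boxFinset m b e ↔ p + m ≤ b ∧ p.degree = e := by
  simp [boxFinset]

open Finset in
-- The three excluded conditions describe trading y for x, z for x, or z for y inside the box. The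
-- only monomial admitting no such trade is the lexicographically largest one: first x, then y, as
-- large as possible.
theorem card_boxFinset_lexMax (b : Fin 3 →₀ ℕ) (d : ℕ) (hne : (boxFinset 0 b (d + 1)).Nonempty) : #((boxFinset 0 b (d + 1)).filter fun p => ¬ (1 ≤ p 1 ∧ p 0 < b 0) ∧
    ¬ (p 1 = 0 ∧ 1 ≤ p 2 ∧ p 0 < b 0) ∧ ¬ (p 0 = b 0 ∧ 1 ≤ p 2 ∧ p 1 < b 1)) = 1 := by
  obtain ⟨p, hp⟩ := hne
  rw [card_eq_one]
  let x := min (b 0) (d + 1)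
  let y := min (b 1) (d + 1 - x)
  refine ⟨Finsupp.equivFunOnFinite.symm ![x, y, d + 1 - x - y], ?_⟩
  ext p'
  simp only [mem_boxFinset, finsupp_fin_three_le, degree_fin_three, mem_filter, mem_singleton,
    finsupp_fin_three_ext, Finsupp.equivFunOnFinite_symm_apply_apply, add_zero] at hp ⊢
  simp only [Matrix.cons_val_zero, Matrix.cons_val_one, Matrix.cons_val, x, y]
  omega

open Finset in
-- This counts a spanning tree rooted at the lexicographically largest monomial: every other
-- monomial is joined to its parent by the edge of the trade it admits, with the trades ordered so
-- as to be exclusive.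
theorem card_boxFinset_zero (b : Fin 3 →₀ ℕ) (d : ℕ) (hne : (boxFinset 0 b (d + 1)).Nonempty) : #(boxFinset 0 b (d + 1)) = 1 + #(boxFinset (𝐞 0 + 𝐞 1) b d) +
    #((boxFinset (𝐞 2 + 𝐞 0) b d).filter fun q => q 1 = 0) +
    #((boxFinset (𝐞 1 + 𝐞 2) b d).filter fun q => q 0 = b 0) := by
  classical
  have h2 : #(boxFinset (𝐞 0 + 𝐞 1) b d) =
      #((boxFinset 0 b (d + 1)).filter fun p => 1 ≤ p 1 ∧ p 0 < b 0) := by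
    refine card_bij (fun n _ => n + 𝐞 1) ?_ (fun _ _ _ _ h => add_right_cancel h) ?_
    · intro n hn
      simp only [mem_filter, mem_boxFinset, finsupp_fin_three_le, degree_fin_three,
        Finsupp.add_apply, Finsupp.single_apply] at hn ⊢
      simp at hn ⊢
      omega
    · intro q hq
      refine ⟨q - 𝐞 1, ?_, ?_⟩ <;>
      simp only [mem_filter, mem_boxFinset, finsupp_fin_three_le, degree_fin_three,
        finsupp_fin_three_ext, Finsupp.add_apply, Finsupp.single_apply,
        Finsupp.tsub_apply] at hq ⊢ <;>
      simp at hq ⊢ <;> omega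
  have h1 : #((boxFinset (𝐞 2 + 𝐞 0) b d).filter fun q => q 1 = 0) =
      #((boxFinset 0 b (d + 1)).filter fun p => p 1 = 0 ∧ 1 ≤ p 2 ∧ p 0 < b 0) := by
    refine card_bij (fun n _ => n + 𝐞 2) ?_ (fun _ _ _ _ h => add_right_cancel h) ?_
    · intro n hn
      simp only [mem_filter, mem_boxFinset, finsupp_fin_three_le, degree_fin_three,
        Finsupp.add_apply, Finsupp.single_apply] at hn ⊢
      simp at hn ⊢
      omega
    · intro q hq
      refine ⟨q - 𝐞 2, ?_, ?_⟩ <;>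
      simp only [mem_filter, mem_boxFinset, finsupp_fin_three_le, degree_fin_three,
        finsupp_fin_three_ext, Finsupp.add_apply, Finsupp.single_apply,
        Finsupp.tsub_apply] at hq ⊢ <;>
      simp at hq ⊢ <;> omega
  have h0 : #((boxFinset (𝐞 1 + 𝐞 2) b d).filter fun q => q 0 = b 0) =
      #((boxFinset 0 b (d + 1)).filter fun p => p 0 = b 0 ∧ 1 ≤ p 2 ∧ p 1 < b 1) := by
    refine card_bij (fun n _ => n + 𝐞 2) ?_ (fun _ _ _ _ h => add_right_cancel h) ?_
    · intro n hn
      simp only [mem_filter, mem_boxFinset, finsupp_fin_three_le, degree_fin_three,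
        Finsupp.add_apply, Finsupp.single_apply] at hn ⊢
      simp at hn ⊢
      omega
    · intro q hq
      refine ⟨q - 𝐞 2, ?_, ?_⟩ <;>
      simp only [mem_filter, mem_boxFinset, finsupp_fin_three_le, degree_fin_three,
        finsupp_fin_three_ext, Finsupp.add_apply, Finsupp.single_apply,
        Finsupp.tsub_apply] at hq ⊢ <;>
      simp at hq ⊢ <;> omega
  obtain ⟨p, hp⟩ := hne
  have h3 := card_boxFinset_lexMax b d ⟨p, hp⟩
  rw [h2, h1, h0]
  conv_rhs => enter [1, 1, 1]; rw [← h3]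
  rw [← card_union_of_disjoint, ← card_union_of_disjoint,
    ← card_union_of_disjoint]
  · congr 1
    ext p
    simp only [mem_union, mem_filter]
    tauto
  · rw [disjoint_left]
    intro p
    simp only [mem_union, mem_filter]
    rintro h4 ⟨-, h5⟩
    omega
  · rw [disjoint_left]
    intro p
    simp only [mem_union, mem_filter]
    rintro h4 ⟨-, h5⟩
    omega
  · rw [disjoint_left]
    intro p
    simp only [mem_filter]
    rintro h4 ⟨-, h5⟩
    omega

open Finset in
-- The part of Γ below b has Euler characteristic 1. The edges outside the spanning tree correspond
-- to the triangles: those opposite to x_0 with q_0 < b_0 to the up triangles, those opposite to x_1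
-- with q_1 > 0 to the down triangles.
theorem card_boxFinset_aux (b : Fin 3 →₀ ℕ) (d : ℕ) (hne : (boxFinset 0 b (d + 1)).Nonempty)
    (D : Finset (Fin 3 →₀ ℕ)) (hD : ∀ n, n ∈ D ↔ n + 𝐞 0 + 𝐞 1 + 𝐞 2 ≤ b ∧ n.degree + 1 = d) :
    #(boxFinset 0 b (d + 1)) + #(boxFinset (𝐞 0 + 𝐞 1 + 𝐞 2) b d) + #D =
      1 + ∑ w : Fin 3, #(boxFinset (𝐞 (w + 1) + 𝐞 (w + 2)) b d) := by
  classical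
  have hE0 : #(boxFinset (𝐞 0 + 𝐞 1 + 𝐞 2) b d) +
      #((boxFinset (𝐞 1 + 𝐞 2) b d).filter fun q => q 0 = b 0) = #(boxFinset (𝐞 1 + 𝐞 2) b d) := by
    rw [← card_filter_add_card_filter_not (s := boxFinset (𝐞 1 + 𝐞 2) b d) (fun q => q 0 = b 0),
      add_comm]
    congr 2
    ext q
    simp only [mem_filter, mem_boxFinset, finsupp_fin_three_le, Finsupp.add_apply,
      Finsupp.single_apply]
    simp
    omega
  have hE1 : #D + #((boxFinset (𝐞 2 + 𝐞 0) b d).filter fun q => q 1 = 0) =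
      #(boxFinset (𝐞 2 + 𝐞 0) b d) := by
    rw [← card_filter_add_card_filter_not (s := boxFinset (𝐞 2 + 𝐞 0) b d) (fun q => q 1 = 0),
      add_comm]
    congr 1
    refine card_bij (fun n _ => n + 𝐞 1) ?_ (fun _ _ _ _ h => add_right_cancel h) ?_
    · intro n hn
      rw [hD] at hn
      simp only [mem_filter, mem_boxFinset, finsupp_fin_three_le, degree_fin_three,
        Finsupp.add_apply, Finsupp.single_apply] at hn ⊢
      simp at hn ⊢
      omega
    · intro q hq
      refine ⟨q - 𝐞 1, ?_, ?_⟩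
      · rw [hD]
        simp only [mem_filter, mem_boxFinset, finsupp_fin_three_le, degree_fin_three,
          Finsupp.add_apply, Finsupp.single_apply, Finsupp.tsub_apply] at hq ⊢
        simp at hq ⊢
        omega
      · simp only [mem_filter, mem_boxFinset, finsupp_fin_three_ext,
          Finsupp.add_apply, Finsupp.single_apply, Finsupp.tsub_apply] at hq ⊢
        simp at hq ⊢
        omega
  have hV := card_boxFinset_zero b d hne
  rw [Fin.sum_univ_three]
  change _ = 1 + (#(boxFinset (𝐞 1 + 𝐞 2) b d) + #(boxFinset (𝐞 2 + 𝐞 0) b d) +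
    #(boxFinset (𝐞 0 + 𝐞 1) b d))
  omega

end Counting

/-! ### Exactness for Δ with arbitrary signs: connectedness and absence of 2-cycles -/

section SignedComplex

variable {d : ℕ} {C0 C1 C2 : Type*} [Fintype C0] [Fintype C1]

/-- The cells `p`, `E`, `R` are the vertices, edges and regions of `Δ`, and `s1`, `s2` are the signs
of a choice of orientations. -/
structure DeltaSigns (τ : DownTriangle d → Fin 3) (p : C0 → Fin 3 →₀ ℕ)
    (E : C1 → (Fin 3 →₀ ℕ) × Fin 3) (R : C2 → Fin 3 →₀ ℕ) (s1 : C0 → C1 → ℤ)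
    (s2 : C1 → C2 → ℤ) : Prop where
  p_inj : Function.Injective p
  p_range : ∀ x, (∃ v, p v = x) ↔ x.degree = d
  E_inj : Function.Injective E
  E_range : ∀ q w, (∃ e, E e = (q, w)) ↔ q.degree + 1 = d ∧ ¬ IsRemoved τ q w
  R_inj : Function.Injective R
  R_range : ∀ q, (∃ f, R f = q) ↔ q.degree + 1 = d
  s1_unit : ∀ v e, p v ∈ edgeSet (E e).1 (E e).2 → s1 v e = 1 ∨ s1 v e = -1
  s1_zero : ∀ v e, p v ∉ edgeSet (E e).1 (E e).2 → s1 v e = 0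
  s2_unit : ∀ e f, edgeSet (E e).1 (E e).2 ⊆ regionSet τ (R f) → s2 e f = 1 ∨ s2 e f = -1
  s2_zero : ∀ e f, ¬ edgeSet (E e).1 (E e).2 ⊆ regionSet τ (R f) → s2 e f = 0
  sum1 : ∀ e, ∑ v, s1 v e = 0
  sum2 : ∀ v f, ∑ e, s1 v e * s2 e f = 0

/-- The label of an edge. -/
noncomputable def edgeLabel (x : (Fin 3 →₀ ℕ) × Fin 3) : Fin 3 →₀ ℕ :=
  x.1 + 𝐞 (x.2 + 1) + 𝐞 (x.2 + 2)

/-- The label of a region. -/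
noncomputable def regionLabel (q : Fin 3 →₀ ℕ) : Fin 3 →₀ ℕ := q + 𝐞 0 + 𝐞 1 + 𝐞 2

theorem regionLabel_eq (q : Fin 3 →₀ ℕ) (w : Fin 3) :
    regionLabel q = q + 𝐞 w + 𝐞 (w + 1) + 𝐞 (w + 2) := by
  simp only [regionLabel, finsupp_fin_three_ext, Finsupp.add_apply, Finsupp.single_apply]
  fin_cases w <;> simp

theorem DownTriangle.degree_add_single (n : DownTriangle d) (w : Fin 3) :
    (n.1 + 𝐞 w).degree + 1 = d := by
  rw [map_add, Finsupp.degree_single, add_assoc, n.2]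

theorem DownTriangle.eq_of_add_single {n n' : DownTriangle d} {w : Fin 3}
    (h : n.1 + 𝐞 w = n'.1 + 𝐞 w) : n = n' :=
  Subtype.ext (add_right_cancel h)

theorem not_isRemoved_of_ne {τ : DownTriangle d → Fin 3} {n : DownTriangle d} {w : Fin 3}
    (h : w ≠ τ n) : ¬ IsRemoved τ (n.1 + 𝐞 w) w := by
  rintro ⟨n', h1, h2⟩
  exact h (by rw [← h2, DownTriangle.eq_of_add_single h1])

theorem edgeLabel_add_single (n : Fin 3 →₀ ℕ) (w : Fin 3) :
    edgeLabel (n + 𝐞 w, w) = regionLabel n := (regionLabel_eq n w).symm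

/-- The vectors supported on the indices with label at most `b`. -/
def supportedLE (k : Type*) [Field k] {C : Type*} (ℓ : C → Fin 3 →₀ ℕ) (b : Fin 3 →₀ ℕ) :
    Submodule k (C → k) where
  carrier := {z | ∀ c, z c ≠ 0 → ℓ c ≤ b}
  add_mem' {x y} hx hy c hc := by
    by_cases h : x c = 0
    · exact hy c fun h' => hc (by simp [h, h'])
    · exact hx c h
  zero_mem' c hc := absurd rfl hc
  smul_mem' a x hx c hc := hx c fun h => hc (by simp [h])

variable {k : Type*} [Field k]

open Classical in
theorem finrank_supportedLE {C : Type*} [Fintype C] (ℓ : C → Fin 3 →₀ ℕ) (b : Fin 3 →₀ ℕ) :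
    Module.finrank k (supportedLE k ℓ b) = (Finset.univ.filter fun c => ℓ c ≤ b).card := by
  let e : supportedLE k ℓ b ≃ₗ[k] ({c // ℓ c ≤ b} → k) :=
    { toFun := fun z c => z.1 c
      invFun := fun f => ⟨fun c => if h : ℓ c ≤ b then f ⟨c, h⟩ else 0, fun c hc => by
        by_contra h
        simp [h] at hc⟩
      left_inv := fun z => by
        ext c
        simp only
        split_ifs with h
        · rfl
        · by_contra h'
          exact h (z.2 c (Ne.symm h'))
      right_inv := fun f => by
        ext c
        simp [c.2]
      map_add' := fun _ _ => rfl
      map_smul' := fun _ _ => rfl }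
  rw [e.finrank_eq, Module.finrank_fintype_fun_eq_card, Fintype.card_subtype]

theorem finrank_map_add_finrank_inf_ker {V W : Type*} [AddCommGroup V] [Module k V]
    [AddCommGroup W] [Module k W] [FiniteDimensional k V] (f : V →ₗ[k] W) (S : Submodule k V) :
    Module.finrank k (S.map f) + Module.finrank k (S ⊓ LinearMap.ker f : Submodule k V) =
      Module.finrank k S := by
  rw [← LinearMap.finrank_range_add_finrank_ker (f.domRestrict S), LinearMap.range_domRestrict,
    LinearMap.ker_domRestrict]
  congr 1
  rw [← Submodule.map_comap_subtype]
  exact (Submodule.equivMapOfInjective _ S.injective_subtype _).symm.finrank_eq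

namespace DeltaSigns

variable {τ : DownTriangle d → Fin 3} {p : C0 → Fin 3 →₀ ℕ}
  {E : C1 → (Fin 3 →₀ ℕ) × Fin 3} {R : C2 → Fin 3 →₀ ℕ} {s1 : C0 → C1 → ℤ}
  {s2 : C1 → C2 → ℤ} (D : DeltaSigns τ p E R s1 s2)
include D

theorem degree_E (e : C1) : (E e).1.degree + 1 = d := ((D.E_range _ _).1 ⟨e, rfl⟩).1

theorem degree_R (f : C2) : (R f).degree + 1 = d := (D.R_range _).1 ⟨f, rfl⟩

theorem s1_ne_zero_iff {v : C0} {e : C1} :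
    (s1 v e : k) ≠ 0 ↔ p v ∈ edgeSet (E e).1 (E e).2 := by
  constructor
  · intro h
    by_contra h'
    simp [D.s1_zero v e h'] at h
  · intro h
    rcases D.s1_unit v e h with h | h <;> simp [h]

theorem s2_ne_zero_iff {e : C1} {f : C2} :
    (s2 e f : k) ≠ 0 ↔ edgeSet (E e).1 (E e).2 ⊆ regionSet τ (R f) := by
  constructor
  · intro h
    by_contra h'
    simp [D.s2_zero e f h'] at h
  · intro h
    rcases D.s2_unit e f h with h | h <;> simp [h]

/-- If the edge of the up triangle opposite to x_1 is kept, it serves. If it was removed with a down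
triangle n, the edge of n opposite to x_0 in the up triangle of n x_0 serves. The region across that
edge has exponent of x_1 smaller by one. -/
theorem exists_edge_subset_regionSet (f : C2) : ∃ e, edgeSet (E e).1 (E e).2 ⊆ regionSet τ (R f) ∧
    ∀ f', edgeSet (E e).1 (E e).2 ⊆ regionSet τ (R f') → f' = f ∨ R f' 1 < R f 1 := by
  have hf := D.degree_R f
  by_cases hr : IsRemoved τ (R f) 1
  · obtain ⟨n, h1, h2⟩ := hr
    obtain ⟨e, he⟩ := (D.E_range _ _).2 ⟨n.degree_add_single 0, not_isRemoved_of_ne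
      (show (0 : Fin 3) ≠ τ n by rw [h2]; decide)⟩
    refine ⟨e, ?_, fun f' => ?_⟩
    · rw [he, edgeSet_subset_regionSet_iff hf (n.degree_add_single 0)]
      exact Or.inr ⟨n, rfl, by rw [h2, h1]⟩
    · rw [he, edgeSet_subset_regionSet_iff (D.degree_R f') (n.degree_add_single 0)]
      rintro (h | ⟨n', h3, h4⟩)
      · right
        rw [← h, ← h1]
        simp
      · left
        obtain rfl := DownTriangle.eq_of_add_single h3
        exact D.R_inj (by rw [← h4, ← h1, h2])
  · obtain ⟨e, he⟩ := (D.E_range _ _).2 ⟨hf, hr⟩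
    refine ⟨e, ?_, fun f' => ?_⟩
    · rw [he, edgeSet_subset_regionSet_iff hf hf]
      exact Or.inl rfl
    · rw [he, edgeSet_subset_regionSet_iff (D.degree_R f') hf]
      rintro (h | ⟨n', h3, h4⟩)
      · exact Or.inl (D.R_inj h.symm)
      · right
        rw [← h4, ← h3]
        have : τ n' ≠ 1 := fun h => hr ⟨n', h3, h⟩
        simp [this]

/-- In the support of u take a region with least exponent of x_1. The edge given by
`exists_edge_subset_regionSet` lies on no other region of the support, so the relation at this edge
has a single nonzero term. -/
theorem eq_zero_of_sum_s2_eq_zero [Fintype C2] (u : C2 → k) (hu : ∀ e, ∑ f, (s2 e f : k) * u f = 0) :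
    u = 0 := by
  classical
  by_contra hne
  obtain ⟨f0, hf0⟩ := Function.ne_iff.1 hne
  obtain ⟨f, hf, hmin⟩ := Finset.exists_min_image (Finset.univ.filter fun f => u f ≠ 0)
    (fun f => R f 1) ⟨f0, by simpa using hf0⟩
  have hf : u f ≠ 0 := by simpa using hf
  obtain ⟨e, he, huniq⟩ := D.exists_edge_subset_regionSet f
  have h := hu e
  rw [Finset.sum_eq_single f] at h
  · exact (mul_ne_zero (D.s2_ne_zero_iff.2 he) hf) h
  · intro f' _ hne
    by_cases h0 : u f' = 0
    · simp [h0]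
    · have h1 := hmin f' (by simpa using h0)
      by_contra h2
      rcases huniq f' (D.s2_ne_zero_iff.1 (left_ne_zero_of_mul h2)) with h3 | h3
      · exact hne h3
      · omega
  · simp

/-- The image of the boundary map from the edges with label at most `b`. -/
theorem single_sub_single_mem [DecidableEq C0] {b : Fin 3 →₀ ℕ} {u v : C0} (hu : p u ≤ b)
    (hv : p v ≤ b) : (Pi.single u 1 - Pi.single v 1 : C0 → k) ∈
      (supportedLE k (fun e => edgeLabel (E e)) b).map
        (Matrix.mulVecLin (Matrix.of fun v e => (s1 v e : k))) := by
  classical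
  set W := (supportedLE k (fun e => edgeLabel (E e)) b).map
        (Matrix.mulVecLin (Matrix.of fun v e => (s1 v e : k))) with hW
  -- kept edges
  have kept : ∀ (e : C1), edgeLabel (E e) ≤ b → ∀ u v : C0, p u = (E e).1 + 𝐞 ((E e).2 + 1) →
      p v = (E e).1 + 𝐞 ((E e).2 + 2) → (Pi.single u 1 - Pi.single v 1 : C0 → k) ∈ W := by
    intro e he u v hu hv
    have huv : u ≠ v := by
      rintro rfl
      rw [hu] at hv
      have := add_left_cancel hv
      rw [Finsupp.single_left_inj one_ne_zero] at this
      exact (by decide : ∀ w : Fin 3, w + 1 ≠ w + 2) _ this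
    have hz : ∀ x, x ≠ u ∧ x ≠ v → s1 x e = 0 := by
      rintro x ⟨hxu, hxv⟩
      refine D.s1_zero x e ?_
      rintro (h | h)
      · exact hxu (D.p_inj (h.trans hu.symm))
      · exact hxv (D.p_inj (h.trans hv.symm))
    have hsum := D.sum1 e
    rw [Fintype.sum_eq_add u v huv hz] at hsum
    have hsu := D.s1_unit u e (by rw [hu]; exact Set.mem_insert _ _)
    refine ⟨Pi.single e (s1 u e : k), ?_, ?_⟩
    · intro e' he'
      by_cases h : e' = e
      · rw [h]
        exact he
      · simp [h] at he'
    · funext x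
      rw [Matrix.mulVecLin_apply, Matrix.mulVec_single]
      simp only [Matrix.of_apply, MulOpposite.op_intCast, Pi.smul_apply, Matrix.col_apply,
        Pi.sub_apply, Pi.single_apply]
      have hsv : s1 v e = - s1 u e := by omega
      by_cases hxu : x = u
      · subst hxu
        rcases hsu with h | h <;> simp [h, huv]
      · by_cases hxv : x = v
        · subst hxv
          rcases hsu with h | h <;> simp [hsv, h, huv.symm]
        · simp [hxu, hxv, hz x ⟨hxu, hxv⟩]
  have trans : ∀ u v w : C0, (Pi.single u 1 - Pi.single v 1 : C0 → k) ∈ W →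
      (Pi.single v 1 - Pi.single w 1 : C0 → k) ∈ W →
      (Pi.single u 1 - Pi.single w 1 : C0 → k) ∈ W := by
    intro u v w h1 h2
    have := W.add_mem h1 h2
    rwa [sub_add_sub_cancel] at this
  have symm' : ∀ u v : C0, (Pi.single u 1 - Pi.single v 1 : C0 → k) ∈ W →
      (Pi.single v 1 - Pi.single u 1 : C0 → k) ∈ W := by
    intro u v h1
    have := W.neg_mem h1
    rwa [neg_sub] at this
  -- all edges of `Γ`
  have all : ∀ (q : Fin 3 →₀ ℕ) (w : Fin 3), q.degree + 1 = d → edgeLabel (q, w) ≤ b →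
      ∀ u v : C0, p u = q + 𝐞 (w + 1) → p v = q + 𝐞 (w + 2) →
      (Pi.single u 1 - Pi.single v 1 : C0 → k) ∈ W := by
    intro q w hq hle u v hu hv
    -- A removed edge is bypassed along the other two edges of its down triangle n, which are kept
    -- and have the same label nxyz.
    by_cases hr : IsRemoved τ q w
    · obtain ⟨n, rfl, h2⟩ := hr
      obtain ⟨x, hx⟩ := (D.p_range (n.1 + 𝐞 (w + 1) + 𝐞 (w + 2))).2 (by
        rw [map_add, Finsupp.degree_single, n.degree_add_single])
      rw [edgeLabel_add_single] at hle
      obtain ⟨e, he⟩ := (D.E_range _ _).2 ⟨n.degree_add_single (w + 1), not_isRemoved_of_ne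
        (show w + 1 ≠ τ n by rw [h2]; exact (by decide : ∀ w : Fin 3, w + 1 ≠ w) w)⟩
      obtain ⟨e', he'⟩ := (D.E_range _ _).2 ⟨n.degree_add_single (w + 2), not_isRemoved_of_ne
        (show w + 2 ≠ τ n by rw [h2]; exact (by decide : ∀ w : Fin 3, w + 2 ≠ w) w)⟩
      have e1 : w + 1 + 1 = w + 2 := by rw [add_assoc]; rfl
      have e2 : w + 1 + 2 = w := (by decide : ∀ w : Fin 3, w + 1 + 2 = w) w
      have e3 : w + 2 + 1 = w := (by decide : ∀ w : Fin 3, w + 2 + 1 = w) w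
      have e4 : w + 2 + 2 = w + 1 := (by decide : ∀ w : Fin 3, w + 2 + 2 = w + 1) w
      refine trans u x v (symm' _ _ (kept e ?_ x u ?_ ?_)) (symm' _ _ (kept e' ?_ v x ?_ ?_))
      · rw [he, edgeLabel_add_single]
        exact hle
      · rw [he, hx, e1]
      · rw [he, hu, e2, add_right_comm]
      · rw [he', edgeLabel_add_single]
        exact hle
      · rw [he', hv, e3, add_right_comm]
      · rw [he', hx, e4, add_right_comm]
    · obtain ⟨e, he⟩ := (D.E_range _ _).2 ⟨hq, hr⟩
      exact kept e (by rw [he]; exact hle) u v (by rw [he]; exact hu) (by rw [he]; exact hv)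
  -- all pairs of vertices
  have main : ∀ (m : ℕ) (u v : C0), p u ≤ b → p v ≤ b →
      (p u 0 - p v 0) + (p u 1 - p v 1) + (p u 2 - p v 2) ≤ m →
      (Pi.single u 1 - Pi.single v 1 : C0 → k) ∈ W := by
    intro m
    induction m with
    | zero =>
      intro u v hu hv h
      have hu' := (D.p_range _).1 ⟨u, rfl⟩
      have hv' := (D.p_range _).1 ⟨v, rfl⟩
      have : p u = p v := by
        rw [degree_fin_three] at hu' hv'
        rw [finsupp_fin_three_ext]
        omega
      rw [D.p_inj this, sub_self]
      exact W.zero_mem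
    | succ m ih =>
      intro u v hu hv h
      by_cases huv : p u = p v
      · rw [D.p_inj huv, sub_self]
        exact W.zero_mem
      have hu' := (D.p_range _).1 ⟨u, rfl⟩
      have hv' := (D.p_range _).1 ⟨v, rfl⟩
      obtain ⟨i, hi⟩ : ∃ i, p v i < p u i := by
        by_contra! hcon
        refine huv ?_
        have h0 := hcon 0
        have h1 := hcon 1
        have h2 := hcon 2
        rw [degree_fin_three] at hu' hv'
        rw [finsupp_fin_three_ext]
        omega
      obtain ⟨j, hj⟩ : ∃ j, p u j < p v j := by
        by_contra! hcon
        refine huv ?_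
        have h0 := hcon 0
        have h1 := hcon 1
        have h2 := hcon 2
        rw [degree_fin_three] at hu' hv'
        rw [finsupp_fin_three_ext]
        omega
      have hij : i ≠ j := fun h => by subst h; omega
      -- A factor x_i in excess is exchanged for a missing x_j. The edge traversed still has label
      -- at most b, since the exponent of x_j stays bounded by that of p v.
      obtain ⟨q, hq⟩ : ∃ q, p u = q + 𝐞 i := ⟨p u - 𝐞 i, (tsub_add_cancel_of_le (by
        rw [Finsupp.single_le_iff]; omega)).symm⟩
      have hqd : q.degree + 1 = d := by
        rw [hq, map_add, Finsupp.degree_single] at hu'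
        exact hu'
      obtain ⟨x, hx⟩ := (D.p_range (q + 𝐞 j)).2 (by rw [map_add, Finsupp.degree_single, hqd])
      have hlab : q + 𝐞 i + 𝐞 j ≤ b := by
        intro l
        have h1 := hu l
        have h2 := hv l
        rw [hq] at h1
        rw [Finsupp.add_apply]
        by_cases hl : j = l
        · subst hl
          rw [Finsupp.single_eq_same, ← hq]
          omega
        · rw [Finsupp.single_eq_of_ne' hl]
          exact h1
      have hx' : p x ≤ b := by
        rw [hx]
        refine le_trans ?_ hlab
        rw [add_right_comm]
        exact le_self_add
      refine trans u x v ?_ (ih x v hx' hv ?_)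
      · rcases (by decide : ∀ i j : Fin 3, i ≠ j →
          (∃ w, i = w + 1 ∧ j = w + 2) ∨ (∃ w, j = w + 1 ∧ i = w + 2)) i j hij with
          ⟨w, rfl, rfl⟩ | ⟨w, rfl, rfl⟩
        · exact all q w hqd hlab u x hq hx
        · refine symm' _ _ (all q w hqd ?_ x u hx hq)
          rw [edgeLabel, add_right_comm]
          exact hlab
      · clear ih hlab hx' all kept trans symm'
        rw [hx]
        rw [hq] at h hi hj
        simp only [Finsupp.add_apply, Finsupp.single_apply] at h hi hj ⊢
        fin_cases i <;> fin_cases j <;> simp at h hi hj hij ⊢ <;> omega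
  exact main _ u v hu hv le_rfl

end DeltaSigns

end SignedComplex

/-! ### Euler characteristic of Δ below b and exactness at the edges -/

section SignedComplex

variable {d : ℕ} {C0 C1 C2 : Type*} [Fintype C0] [Fintype C1]

noncomputable instance (d : ℕ) : Fintype (DownTriangle d) := Fintype.ofFinite _

theorem le_edgeLabel_of_mem {x : (Fin 3 →₀ ℕ) × Fin 3} {m : Fin 3 →₀ ℕ}
    (h : m ∈ edgeSet x.1 x.2) : m ≤ edgeLabel x := by
  rcases h with h | h
  · rw [h]
    exact le_self_add
  · rw [Set.mem_singleton_iff.1 h, edgeLabel, add_right_comm]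
    exact le_self_add

theorem edgeLabel_le_of_subset {x : (Fin 3 →₀ ℕ) × Fin 3} {m : Fin 3 →₀ ℕ}
    (h : ∀ y ∈ edgeSet x.1 x.2, y ≤ m) : edgeLabel x ≤ m := by
  have h1 := h _ (Set.mem_insert _ _)
  have h2 := h _ (Set.mem_insert_of_mem _ rfl)
  intro j
  have h1 := h1 j
  have h2 := h2 j
  simp only [edgeLabel, Finsupp.add_apply] at h1 h2 ⊢
  generalize x.2 = w at *
  rcases (by decide : ∀ w j : Fin 3, j ≠ w + 1 ∨ j ≠ w + 2) w j with h | h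
  · rw [Finsupp.single_eq_of_ne h] at *
    omega
  · rw [Finsupp.single_eq_of_ne h] at *
    omega

theorem edgeLabel_le_regionLabel {τ : DownTriangle d → Fin 3} {x : (Fin 3 →₀ ℕ) × Fin 3}
    {q : Fin 3 →₀ ℕ} (h : edgeSet x.1 x.2 ⊆ regionSet τ q) : edgeLabel x ≤ regionLabel q :=
  edgeLabel_le_of_subset fun _ hy => le_of_mem_regionSet (h hy)

namespace DeltaSigns

variable {k : Type*} [Field k] {τ : DownTriangle d → Fin 3} {p : C0 → Fin 3 →₀ ℕ}
  {E : C1 → (Fin 3 →₀ ℕ) × Fin 3} {R : C2 → Fin 3 →₀ ℕ} {s1 : C0 → C1 → ℤ}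
  {s2 : C1 → C2 → ℤ} (D : DeltaSigns τ p E R s1 s2)
include D

/-- Vectors with coordinate sum zero are combinations of differences of basis vectors, here taken
against one fixed vertex of the support. -/
theorem exact_vertices (b : Fin 3 →₀ ℕ) (z : C0 → k) (hz : ∀ v, z v ≠ 0 → p v ≤ b)
    (hsum : ∑ v, z v = 0) :
    ∃ u : C1 → k, (∀ e, u e ≠ 0 → edgeLabel (E e) ≤ b) ∧
      ∀ v, z v = ∑ e, (s1 v e : k) * u e := by
  classical
  suffices h : z ∈ (supportedLE k (fun e => edgeLabel (E e)) b).map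
      (Matrix.mulVecLin (Matrix.of fun v e => (s1 v e : k))) by
    obtain ⟨u, hu, rfl⟩ := h
    exact ⟨u, hu, fun v => rfl⟩
  by_cases h0 : z = 0
  · rw [h0]
    exact Submodule.zero_mem _
  obtain ⟨v0, hv0⟩ := Function.ne_iff.1 h0
  have h1 : z = ∑ v, z v • (Pi.single v 1 - Pi.single v0 1 : C0 → k) := by
    simp only [smul_sub, Finset.sum_sub_distrib, ← Finset.sum_smul, hsum, zero_smul, sub_zero]
    conv_lhs => rw [pi_eq_sum_univ' z]
  rw [h1]
  refine Submodule.sum_mem _ fun v _ => ?_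
  by_cases hv : z v = 0
  · rw [hv, zero_smul]
    exact Submodule.zero_mem _
  · exact Submodule.smul_mem _ _ (D.single_sub_single_mem (hz v hv) (hz v0 hv0))

open Classical Finset in
-- The edge removed from a down triangle n has label nxyz. So below b the removed edges are exactly
-- as many as the down triangles, and both drop out of the Euler relation for Γ.
theorem card_eq [Fintype C2] [NeZero d] (b : Fin 3 →₀ ℕ) (hne : ∃ v, p v ≤ b) :
    #(univ.filter fun v => p v ≤ b) + #(univ.filter fun f => regionLabel (R f) ≤ b) =
      #(univ.filter fun e => edgeLabel (E e) ≤ b) + 1 := by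
  obtain ⟨d', hd⟩ : ∃ d', d = d' + 1 := ⟨d - 1, (Nat.succ_pred_eq_of_pos (NeZero.pos d)).symm⟩
  have hV : #(univ.filter fun v => p v ≤ b) = #(boxFinset 0 b (d' + 1)) := by
    rw [← card_image_of_injective _ D.p_inj]
    congr 1
    ext x
    simp only [mem_image, mem_filter, mem_univ, true_and, mem_boxFinset, add_zero]
    rw [← hd, ← D.p_range]
    constructor
    · rintro ⟨v, h1, rfl⟩
      exact ⟨h1, v, rfl⟩
    · rintro ⟨h1, v, rfl⟩
      exact ⟨v, h1, rfl⟩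
  have hF : #(univ.filter fun f => regionLabel (R f) ≤ b) =
      #(boxFinset (𝐞 0 + 𝐞 1 + 𝐞 2) b d') := by
    rw [← card_image_of_injective _ D.R_inj]
    congr 1
    ext x
    simp only [mem_image, mem_filter, mem_univ, true_and, mem_boxFinset, ← add_assoc]
    rw [show x.degree = d' ↔ x.degree + 1 = d by omega, ← D.R_range]
    constructor
    · rintro ⟨v, h1, rfl⟩
      exact ⟨h1, v, rfl⟩
    · rintro ⟨h1, v, rfl⟩
      exact ⟨v, h1, rfl⟩
  let T : Finset ((_ : Fin 3) × (Fin 3 →₀ ℕ)) :=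
    univ.sigma fun w => boxFinset (𝐞 (w + 1) + 𝐞 (w + 2)) b d'
  have hT : ∀ x, x ∈ T ↔ edgeLabel (x.2, x.1) ≤ b ∧ x.2.degree + 1 = d := by
    intro x
    simp only [T, mem_sigma, mem_univ, true_and, mem_boxFinset, edgeLabel, ← add_assoc]
    rw [show x.2.degree = d' ↔ x.2.degree + 1 = d by omega]
  have hE : #(univ.filter fun e => edgeLabel (E e) ≤ b) =
      #(T.filter fun x => ¬ IsRemoved τ x.2 x.1) := by
    refine card_bij (fun e _ => ⟨(E e).2, (E e).1⟩) ?_ ?_ ?_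
    · intro e he
      rw [mem_filter, hT]
      exact ⟨⟨(mem_filter.1 he).2, D.degree_E e⟩, ((D.E_range _ _).1 ⟨e, rfl⟩).2⟩
    · intro e _ e' _ h
      rw [Sigma.mk.injEq] at h
      exact D.E_inj (Prod.ext (eq_of_heq h.2) h.1)
    · intro x hx
      rw [mem_filter, hT] at hx
      obtain ⟨e, he⟩ := (D.E_range _ _).2 ⟨hx.1.2, hx.2⟩
      refine ⟨e, ?_, by rw [he]⟩
      rw [mem_filter, he]
      exact ⟨mem_univ _, hx.1.1⟩
  let DF : Finset (Fin 3 →₀ ℕ) :=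
    (univ.filter fun n : DownTriangle d => regionLabel n.1 ≤ b).image fun n => n.1
  have hDF : ∀ n, n ∈ DF ↔ n + 𝐞 0 + 𝐞 1 + 𝐞 2 ≤ b ∧ n.degree + 1 = d' := by
    intro n
    simp only [DF, mem_image, mem_filter, mem_univ, true_and]
    constructor
    · rintro ⟨n, h, rfl⟩
      have := n.2
      exact ⟨h, by omega⟩
    · rintro ⟨h1, h2⟩
      exact ⟨⟨n, by omega⟩, h1, rfl⟩
  have hR : #DF = #(T.filter fun x => IsRemoved τ x.2 x.1) := by
    rw [show #DF = _ from card_image_of_injective _ fun _ _ h => Subtype.ext h]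
    refine card_bij (fun n _ => ⟨τ n, n.1 + 𝐞 (τ n)⟩) ?_ ?_ ?_
    · intro n hn
      rw [mem_filter, hT]
      refine ⟨⟨?_, n.degree_add_single _⟩, n, rfl, rfl⟩
      rw [edgeLabel_add_single]
      exact (mem_filter.1 hn).2
    · intro n _ n' _ h
      rw [Sigma.mk.injEq] at h
      have h2 := eq_of_heq h.2
      rw [h.1] at h2
      exact DownTriangle.eq_of_add_single h2
    · rintro ⟨w, q⟩ hx
      rw [mem_filter, hT] at hx
      obtain ⟨⟨h1, h2⟩, n, h3, h4⟩ := hx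
      simp only at h3 h4
      subst h4
      subst h3
      rw [edgeLabel_add_single] at h1
      exact ⟨n, mem_filter.2 ⟨mem_univ _, h1⟩, rfl⟩
  have hTc : #T = ∑ w : Fin 3, #(boxFinset (𝐞 (w + 1) + 𝐞 (w + 2)) b d') := card_sigma _ _
  have hsplit := card_filter_add_card_filter_not (s := T) fun x => IsRemoved τ x.2 x.1
  obtain ⟨v, hv⟩ := hne
  have hmain := card_boxFinset_aux b d' ⟨p v, by
    rw [mem_boxFinset, add_zero, ← hd, ← D.p_range]
    exact ⟨hv, v, rfl⟩⟩ DF hDF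
  omega

/-- Boundaries are contained in cycles, and the dimensions agree: with V vertices, E edges and F
regions below b, the cycles have dimension E - (V - 1) by `exact_vertices`, the boundaries have
dimension F by injectivity, and V - E + F = 1. -/
theorem exact_edges [Fintype C2] [NeZero d] (b : Fin 3 →₀ ℕ) (z : C1 → k)
    (hz : ∀ e, z e ≠ 0 → edgeLabel (E e) ≤ b) (hsum : ∀ v, ∑ e, (s1 v e : k) * z e = 0) :
    ∃ u : C2 → k, (∀ f, u f ≠ 0 → regionLabel (R f) ≤ b) ∧
      ∀ e, z e = ∑ f, (s2 e f : k) * u f := by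
  classical
  -- The Euler relation needs a vertex below b. Without one there is no edge below b either, and z =
  -- 0.
  by_cases hne : ∃ v, p v ≤ b
  swap
  · refine ⟨0, by simp, fun e => ?_⟩
    by_contra h
    have h1 : z e ≠ 0 := by simpa using h
    obtain ⟨v, hv⟩ := (D.p_range ((E e).1 + 𝐞 ((E e).2 + 1))).2 (by
      rw [map_add, Finsupp.degree_single, D.degree_E])
    refine hne ⟨v, (le_edgeLabel_of_mem (x := E e) ?_).trans (hz e h1)⟩
    rw [hv]
    exact Set.mem_insert _ _
  set S0 := supportedLE k p b with hS0
  set S1 := supportedLE k (fun e => edgeLabel (E e)) b with hS1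
  set S2 := supportedLE k (fun f => regionLabel (R f)) b with hS2
  set D1 : (C1 → k) →ₗ[k] (C0 → k) := Matrix.mulVecLin (Matrix.of fun v e => (s1 v e : k)) with hD1
  set D2 : (C2 → k) →ₗ[k] (C1 → k) := Matrix.mulVecLin (Matrix.of fun e f => (s2 e f : k)) with hD2
  let A : (C0 → k) →ₗ[k] k := ∑ v, LinearMap.proj v
  have hA : ∀ z, A z = ∑ v, z v := fun z => by simp [A]
  have hD1a : ∀ z v, D1 z v = ∑ e, (s1 v e : k) * z e := fun _ _ => rfl
  have hD2a : ∀ z v, D2 z v = ∑ e, (s2 v e : k) * z e := fun _ _ => rfl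
  have h0 : S1.map D1 = S0 ⊓ LinearMap.ker A := by
    refine le_antisymm ?_ ?_
    · rintro _ ⟨u, hu, rfl⟩
      refine ⟨fun v hv => ?_, ?_⟩
      · rw [hD1a] at hv
        obtain ⟨e, -, he⟩ := Finset.exists_ne_zero_of_sum_ne_zero hv
        exact (le_edgeLabel_of_mem (D.s1_ne_zero_iff.1 (left_ne_zero_of_mul he))).trans
          (hu e (right_ne_zero_of_mul he))
      · rw [SetLike.mem_coe, LinearMap.mem_ker, hA]
        simp only [hD1a]
        rw [Finset.sum_comm]
        refine Finset.sum_eq_zero fun e _ => ?_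
        rw [← Finset.sum_mul, ← Int.cast_sum, D.sum1, Int.cast_zero, zero_mul]
    · rintro z ⟨hz, hz'⟩
      obtain ⟨u, hu, hu'⟩ := D.exact_vertices b z hz (by
        rw [← hA]
        exact hz')
      exact ⟨u, hu, funext fun v => (hu' v).symm⟩
  have h1 : S2.map D2 ≤ S1 ⊓ LinearMap.ker D1 := by
    rintro _ ⟨u, hu, rfl⟩
    refine ⟨fun v hv => ?_, ?_⟩
    · rw [hD2a] at hv
      obtain ⟨e, -, he⟩ := Finset.exists_ne_zero_of_sum_ne_zero hv
      exact (edgeLabel_le_regionLabel (D.s2_ne_zero_iff.1 (left_ne_zero_of_mul he))).trans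
        (hu e (right_ne_zero_of_mul he))
    · rw [SetLike.mem_coe, LinearMap.mem_ker]
      funext v
      rw [hD1a]
      simp only [hD2a, Finset.mul_sum]
      rw [Finset.sum_comm]
      refine Finset.sum_eq_zero fun f _ => ?_
      have := congrArg (Int.cast : ℤ → k) (D.sum2 v f)
      push_cast at this
      simp only [← mul_assoc]
      rw [← Finset.sum_mul, this, zero_mul]
  have h2 : S2 ⊓ LinearMap.ker D2 = ⊥ := by
    rw [eq_bot_iff]
    rintro u ⟨-, hu⟩
    exact D.eq_zero_of_sum_s2_eq_zero u fun e => congrFun hu e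
  have hmapA : S0.map A = ⊤ := by
    obtain ⟨v, hv⟩ := hne
    rw [eq_top_iff]
    rintro c -
    refine ⟨Pi.single v c, fun x hx => ?_, ?_⟩
    · by_cases hxv : x = v
      · rw [hxv]
        exact hv
      · simp [hxv] at hx
    · rw [hA]
      simp
  have e1 := finrank_map_add_finrank_inf_ker D1 S1
  have e2 := finrank_map_add_finrank_inf_ker D2 S2
  have e3 := finrank_map_add_finrank_inf_ker A S0
  rw [h2, finrank_bot, finrank_supportedLE] at e2
  rw [h0, finrank_supportedLE] at e1
  rw [hmapA, finrank_top, Module.finrank_self, finrank_supportedLE] at e3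
  have hc := D.card_eq b hne
  have heq := Submodule.eq_of_le_of_finrank_eq h1 (by omega)
  have hzm : z ∈ S1 ⊓ LinearMap.ker D1 := ⟨hz, funext fun v => hsum v⟩
  rw [← heq] at hzm
  obtain ⟨u, hu, rfl⟩ := hzm
  exact ⟨u, hu, fun e => rfl⟩

end DeltaSigns

end SignedComplex

/-! ### An explicit orientation of Δ -/

section StandardSigns

variable {d : ℕ} {C0 C1 C2 : Type*} [Fintype C0] [Fintype C1]

/-- The edge opposite to `q x_w` in the up triangle of `q` is oriented from `q x_{w+1}` to
`q x_{w+2}`. -/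
noncomputable def stdSign1 (m : Fin 3 →₀ ℕ) (x : (Fin 3 →₀ ℕ) × Fin 3) : ℤ :=
  (if m = x.1 + 𝐞 (x.2 + 2) then 1 else 0) - if m = x.1 + 𝐞 (x.2 + 1) then 1 else 0

/-- The signs of the edges of a region, for the orientation given by its up triangle. -/
noncomputable def stdSign2 (τ : DownTriangle d → Fin 3) (x : (Fin 3 →₀ ℕ) × Fin 3)
    (q : Fin 3 →₀ ℕ) : ℤ :=
  (if x.1 = q then 1 else 0) -
    ∑ n : DownTriangle d, if n.1 + 𝐞 x.2 = x.1 ∧ n.1 + 𝐞 (τ n) = q then 1 else 0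

/-- A removed edge is traversed once by the up triangle and once by the merged down triangle, with
cancelling contributions. -/
theorem stdSign2_of_isRemoved {τ : DownTriangle d → Fin 3} {x : (Fin 3 →₀ ℕ) × Fin 3}
    (h : IsRemoved τ x.1 x.2) (q : Fin 3 →₀ ℕ) : stdSign2 τ x q = 0 := by
  obtain ⟨n, h1, h2⟩ := h
  rw [stdSign2, Finset.sum_eq_single n, h1, h2, h1]
  · simp
  · intro n' _ hn
    rw [if_neg]
    rintro ⟨h3, -⟩
    exact hn (DownTriangle.eq_of_add_single (h3.trans h1.symm))
  · simp

theorem stdSign2_eq {τ : DownTriangle d → Fin 3} {x : (Fin 3 →₀ ℕ) × Fin 3}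
    (h : ¬ IsRemoved τ x.1 x.2) {q : Fin 3 →₀ ℕ} (hq : q.degree + 1 = d)
    (hx : x.1.degree + 1 = d) :
    (edgeSet x.1 x.2 ⊆ regionSet τ q → stdSign2 τ x q = 1 ∨ stdSign2 τ x q = -1) ∧
      (¬ edgeSet x.1 x.2 ⊆ regionSet τ q → stdSign2 τ x q = 0) := by
  rw [edgeSet_subset_regionSet_iff hq hx]
  constructor
  · rintro (h1 | ⟨n, h1, h2⟩)
    · left
      rw [stdSign2, if_pos h1, Finset.sum_eq_zero, sub_zero]
      intro n _
      rw [if_neg]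
      rintro ⟨h2, h3⟩
      rw [← h1, ← h2] at h3
      exact h ⟨n, h2, (Finsupp.single_left_inj one_ne_zero).1 (add_left_cancel h3)⟩
    · right
      rw [stdSign2, if_neg, Finset.sum_eq_single n, if_pos ⟨h1, h2⟩, zero_sub]
      · intro n' _ hn
        rw [if_neg]
        rintro ⟨h3, -⟩
        exact hn (DownTriangle.eq_of_add_single (h3.trans h1.symm))
      · simp
      · intro h3
        rw [← h2, ← h1] at h3
        exact h ⟨n, h1, ((Finsupp.single_left_inj one_ne_zero).1 (add_left_cancel h3)).symm⟩
  · intro hcon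
    rw [stdSign2, if_neg fun h => hcon (Or.inl h), Finset.sum_eq_zero, sub_zero]
    intro n _
    exact if_neg fun h => hcon (Or.inr ⟨n, h⟩)

theorem sum_stdSign1_up (m q : Fin 3 →₀ ℕ) : ∑ w, stdSign1 m (q, w) = 0 := by
  simp only [stdSign1, Finset.sum_sub_distrib, Fin.sum_univ_three]
  change _ + (if m = q + 𝐞 0 then (1 : ℤ) else 0) + (if m = q + 𝐞 1 then 1 else 0) -
    (_ + _ + if m = q + 𝐞 0 then 1 else 0) = 0
  simp only [zero_add]
  change _ - (_ + (if m = q + 𝐞 2 then (1 : ℤ) else 0) + _) = 0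
  ring

/-- The orientation convention runs cyclically around down triangles as well as up triangles, so
each vertex is entered as often as it is left. -/
theorem sum_stdSign1_down (m n : Fin 3 →₀ ℕ) : ∑ w, stdSign1 m (n + 𝐞 w, w) = 0 := by
  have h : ∀ w : Fin 3, n + 𝐞 (w + 1) + 𝐞 (w + 1 + 2) = n + 𝐞 w + 𝐞 (w + 1) := fun w => by
    rw [(by decide : ∀ w : Fin 3, w + 1 + 2 = w) w, add_right_comm]
  simp only [stdSign1, Finset.sum_sub_distrib]
  rw [← Equiv.sum_comp (Equiv.addRight (1 : Fin 3))
    (fun w => if m = n + 𝐞 w + 𝐞 (w + 2) then (1 : ℤ) else 0)]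
  simp only [Equiv.coe_addRight, h, sub_self]

/-- The boundary of a region is the cycle of its up triangle minus the cycles of the merged down
triangles. These signs supply an incidence function on every Δ, and in the converse they describe
the edge cycles before the 2-cells are known. -/
theorem deltaSigns_std (τ : DownTriangle d → Fin 3) {p : C0 → Fin 3 →₀ ℕ}
    {E : C1 → (Fin 3 →₀ ℕ) × Fin 3} {R : C2 → Fin 3 →₀ ℕ} (p_inj : Function.Injective p)
    (p_range : ∀ x, (∃ v, p v = x) ↔ x.degree = d) (E_inj : Function.Injective E)
    (E_range : ∀ q w, (∃ e, E e = (q, w)) ↔ q.degree + 1 = d ∧ ¬ IsRemoved τ q w)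
    (R_inj : Function.Injective R) (R_range : ∀ q, (∃ f, R f = q) ↔ q.degree + 1 = d) :
    DeltaSigns τ p E R (fun v e => stdSign1 (p v) (E e)) (fun e f => stdSign2 τ (E e) (R f)) where
  p_inj := p_inj
  p_range := p_range
  E_inj := E_inj
  E_range := E_range
  R_inj := R_inj
  R_range := R_range
  s1_unit v e h := by
    have hne : (E e).1 + 𝐞 ((E e).2 + 1) ≠ (E e).1 + 𝐞 ((E e).2 + 2) := fun h => by
      have := (Finsupp.single_left_inj one_ne_zero).1 (add_left_cancel h)
      exact (by decide : ∀ w : Fin 3, w + 1 ≠ w + 2) _ this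
    rcases h with h | h
    · right
      rw [stdSign1, if_pos h, if_neg (by rw [h]; exact hne), zero_sub]
    · left
      have h : p v = _ := h
      rw [stdSign1, if_pos h, if_neg (by rw [h]; exact hne.symm), sub_zero]
  s1_zero v e h := by
    simp only [edgeSet, Set.mem_insert_iff, Set.mem_singleton_iff, not_or] at h
    rw [stdSign1, if_neg h.1, if_neg h.2, sub_zero]
  s2_unit e f := (stdSign2_eq ((E_range _ _).1 ⟨e, rfl⟩).2 ((R_range _).1 ⟨f, rfl⟩)
    ((E_range _ _).1 ⟨e, rfl⟩).1).1
  s2_zero e f := (stdSign2_eq ((E_range _ _).1 ⟨e, rfl⟩).2 ((R_range _).1 ⟨f, rfl⟩)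
    ((E_range _ _).1 ⟨e, rfl⟩).1).2
  sum1 e := by
    have he := ((E_range _ _).1 ⟨e, rfl⟩).1
    have key : ∀ w, ∑ v, (if p v = (E e).1 + 𝐞 w then (1 : ℤ) else 0) = 1 := by
      intro w
      obtain ⟨v, hv⟩ := (p_range ((E e).1 + 𝐞 w)).2 (by
        rw [map_add, Finsupp.degree_single, he])
      rw [Finset.sum_eq_single v, if_pos hv]
      · intro v' _ hne
        exact if_neg fun h => hne (p_inj (h.trans hv.symm))
      · simp
    simp only [stdSign1, Finset.sum_sub_distrib, key, sub_self]
  sum2 v f := by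
    classical
    have hf := (R_range _).1 ⟨f, rfl⟩
    have hfin : {q : Fin 3 →₀ ℕ | q.degree + 1 = d}.Finite :=
      (finite_degree_le d).subset fun q (hq : q.degree + 1 = d) => by
        change q.degree ≤ d
        omega
    have hQ : ∀ q, q ∈ hfin.toFinset ↔ q.degree + 1 = d := fun q => by simp
    generalize hfin.toFinset = Q at hQ
    -- The sum is extended over all edges of Γ, which is harmless as removed edges have sign 0; it
    -- then splits into sums around triangles.
    have h1 : ∑ e, stdSign1 (p v) (E e) * stdSign2 τ (E e) (R f) =
        ∑ x ∈ Q ×ˢ Finset.univ, stdSign1 (p v) x * stdSign2 τ x (R f) := by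
      rw [← Finset.sum_image (s := Finset.univ) (g := E)
        (f := fun x => stdSign1 (p v) x * stdSign2 τ x (R f)) E_inj.injOn]
      refine Finset.sum_subset ?_ ?_
      · intro x hx
        obtain ⟨e, -, rfl⟩ := Finset.mem_image.1 hx
        rw [Finset.mem_product, hQ]
        exact ⟨((E_range _ _).1 ⟨e, rfl⟩).1, Finset.mem_univ _⟩
      · rintro ⟨q, w⟩ hx hx'
        rw [Finset.mem_product, hQ] at hx
        rw [stdSign2_of_isRemoved, mul_zero]
        by_contra hr
        obtain ⟨e, he⟩ := (E_range _ _).2 ⟨hx.1, hr⟩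
        exact hx' (Finset.mem_image.2 ⟨e, Finset.mem_univ _, he⟩)
    rw [h1]
    simp only [stdSign2, mul_sub, Finset.sum_sub_distrib]
    rw [Finset.sum_product, Finset.sum_product_right]
    have h2 : ∑ q ∈ Q, ∑ w, stdSign1 (p v) (q, w) * (if q = R f then (1 : ℤ) else 0) = 0 :=
      Finset.sum_eq_zero fun q _ => by rw [← Finset.sum_mul, sum_stdSign1_up, zero_mul]
    have h3 : ∑ w, ∑ q ∈ Q, stdSign1 (p v) (q, w) * (∑ n : DownTriangle d,
        if n.1 + 𝐞 w = q ∧ n.1 + 𝐞 (τ n) = R f then (1 : ℤ) else 0) = 0 := by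
      simp only [Finset.mul_sum]
      have h4 : ∀ w, ∑ q ∈ Q, ∑ n : DownTriangle d, stdSign1 (p v) (q, w) *
          (if n.1 + 𝐞 w = q ∧ n.1 + 𝐞 (τ n) = R f then (1 : ℤ) else 0) =
          ∑ n : DownTriangle d, stdSign1 (p v) (n.1 + 𝐞 w, w) *
            (if n.1 + 𝐞 (τ n) = R f then (1 : ℤ) else 0) := by
        intro w
        rw [Finset.sum_comm]
        refine Finset.sum_congr rfl fun n _ => ?_
        rw [Finset.sum_eq_single (n.1 + 𝐞 w)]
        · simp
        · intro q _ hq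
          rw [if_neg fun h => hq h.1.symm, mul_zero]
        · intro h
          exact absurd ((hQ _).2 (n.degree_add_single w)) h
      simp only [h4]
      rw [Finset.sum_comm]
      exact Finset.sum_eq_zero fun n _ => by rw [← Finset.sum_mul, sum_stdSign1_down, zero_mul]
    exact (congrArg₂ _ h2 h3).trans (sub_zero 0)

end StandardSigns

/-! ### Products and renaming of monomial matrices -/

section MonomialMatrices

variable {σ σ' : Type*} {k : Type*} [Field k] {A B C : Type*}

theorem monoMatrix_mul_eq_zero [Fintype B] (α : A → σ →₀ ℕ) (β : B → σ →₀ ℕ) (γ : C → σ →₀ ℕ)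
    (M : B → A → k) (N : C → B → k) (hM : ∀ b a, M b a ≠ 0 → β b ≤ α a)
    (hN : ∀ c b, N c b ≠ 0 → γ c ≤ β b) (h : ∀ c a, ∑ b, N c b * M b a = 0) :
    monoMatrix β γ N * monoMatrix α β M = 0 := by
  ext1 c a
  simp only [Matrix.mul_apply, monoMatrix, Matrix.of_apply, Matrix.zero_apply]
  have h1 : ∀ b, monomial (β b - γ c) (N c b) * monomial (α a - β b) (M b a) =
      monomial (α a - γ c) (N c b * M b a) := by
    intro b
    rw [monomial_mul]
    by_cases h0 : N c b = 0
    · simp [h0]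
    by_cases h1 : M b a = 0
    · simp [h1]
    rw [add_comm, tsub_add_tsub_cancel (hM b a h1) (hN c b h0)]
  simp only [h1]
  rw [← map_sum, h, map_zero]

theorem monoMatrix_map_rename (ρ : σ → σ') (α : A → σ →₀ ℕ) (β : B → σ →₀ ℕ)
    (M : B → A → k) (hM : ∀ b a, M b a ≠ 0 → β b ≤ α a) :
    monoMatrix (fun a => (α a).mapDomain ρ) (fun b => (β b).mapDomain ρ) M =
      (monoMatrix α β M).map (rename ρ) := by
  ext1 b a
  simp only [Matrix.map_apply, monoMatrix, Matrix.of_apply, rename_monomial]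
  by_cases h : M b a = 0
  · simp [h]
  obtain ⟨δ, hδ⟩ := exists_add_of_le (hM b a h)
  rw [hδ, Finsupp.mapDomain_add, add_tsub_cancel_left, add_tsub_cancel_left]

end MonomialMatrices

/-! ### The augmented cellular complex with general labels -/

namespace PolyhedralComplex

variable {N : ℕ} (X : PolyhedralComplex N) {σ σ' : Type*} (k : Type*) [Field k]

/-- The labels `ℓ` grow along the face relation. -/
def LabelMono (ℓ : ∀ i, X.Cell i → σ →₀ ℕ) : Prop :=
  ∀ i (G : X.Cell i) (F : X.Cell (i + 1)), G.1 ⊆ F.1 → ℓ i G ≤ ℓ (i + 1) F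

/-- The augmented cellular complex with labels `ℓ` is exact. -/
structure CellExact (ε : X.Incidence) (ℓ : ∀ i, X.Cell i → σ →₀ ℕ) : Prop where
  zero : ∀ w : X.Cell 0 → MvPolynomial σ k,
    (monoMatrix (ℓ 0) (fun _ : Unit => 0) fun _ _ => (1 : k)).mulVec w = 0 →
      ∃ u, (monoMatrix (ℓ 1) (ℓ 0) fun G F => (ε.sign G F : k)).mulVec u = w
  succ : ∀ i, ∀ w : X.Cell (i + 1) → MvPolynomial σ k,
    (monoMatrix (ℓ (i + 1)) (ℓ i) fun G F => (ε.sign G F : k)).mulVec w = 0 →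
      ∃ u, (monoMatrix (ℓ (i + 2)) (ℓ (i + 1)) fun G F => (ε.sign G F : k)).mulVec u = w

variable {X k}

theorem subset_of_sign_ne_zero (ε : X.Incidence) {i : ℕ} {G : X.Cell i} {F : X.Cell (i + 1)}
    (h : (ε.sign G F : k) ≠ 0) : G.1 ⊆ F.1 := by
  by_contra hcon
  rw [ε.sign_of_not_facet G F hcon] at h
  simp at h

theorem sign_ne_zero_of_subset (ε : X.Incidence) {i : ℕ} {G : X.Cell i} {F : X.Cell (i + 1)}
    (h : G.1 ⊆ F.1) : (ε.sign G F : k) ≠ 0 := by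
  rcases ε.sign_facet G F h with h | h <;> simp [h]

theorem sum_sign_vertices (ε : X.Incidence) (e : X.Cell 1) :
    ∑ v : X.Cell 0, (ε.sign v e : k) = 0 := by
  rw [← Int.cast_sum, ε.sum_vertices, Int.cast_zero]

theorem sum_sign_facets (ε : X.Incidence) {i : ℕ} (G : X.Cell i) (F : X.Cell (i + 2)) :
    ∑ H : X.Cell (i + 1), (ε.sign G H : k) * ε.sign H F = 0 := by
  have := congrArg (Int.cast : ℤ → k) (ε.sum_facets G F)
  push_cast at this
  exact this

theorem LabelMono.le_of_sign_ne_zero {ℓ : ∀ i, X.Cell i → σ →₀ ℕ} (hℓ : X.LabelMono ℓ)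
    (ε : X.Incidence) {i : ℕ} (G : X.Cell i) (F : X.Cell (i + 1))
    (h : (ε.sign G F : k) ≠ 0) : ℓ i G ≤ ℓ (i + 1) F :=
  hℓ i G F (subset_of_sign_ne_zero ε h)

theorem LabelMono.mapDomain {ℓ : ∀ i, X.Cell i → σ →₀ ℕ} (hℓ : X.LabelMono ℓ) (ρ : σ → σ') :
    X.LabelMono fun i F => (ℓ i F).mapDomain ρ := fun i G F h => by
  obtain ⟨δ, hδ⟩ := exists_add_of_le (hℓ i G F h)
  simp only
  rw [hδ, Finsupp.mapDomain_add]
  exact le_self_add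

theorem CellExact.of_graded {ℓ : ∀ i, X.Cell i → σ →₀ ℕ} (hℓ : X.LabelMono ℓ) (ε : X.Incidence)
    (h0 : ∀ (m : σ →₀ ℕ) (z : X.Cell 0 → k), (∀ v, z v ≠ 0 → ℓ 0 v ≤ m) → ∑ v, z v = 0 →
      ∃ u : X.Cell 1 → k, (∀ e, u e ≠ 0 → ℓ 1 e ≤ m) ∧ ∀ v, z v = ∑ e, (ε.sign v e : k) * u e)
    (h1 : ∀ (i : ℕ) (m : σ →₀ ℕ) (z : X.Cell (i + 1) → k), (∀ v, z v ≠ 0 → ℓ (i + 1) v ≤ m) →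
      (∀ v : X.Cell i, ∑ e, (ε.sign v e : k) * z e = 0) →
      ∃ u : X.Cell (i + 2) → k, (∀ e, u e ≠ 0 → ℓ (i + 2) e ≤ m) ∧
        ∀ v, z v = ∑ e, (ε.sign v e : k) * u e) : X.CellExact k ε ℓ where
  zero := exists_mulVec_monoMatrix_of_graded _ _ _ _ _ (hℓ.le_of_sign_ne_zero ε)
    (fun _ _ _ => zero_le) fun m z hz hz' => h0 m z hz (by simpa using hz' ())
  succ i := exists_mulVec_monoMatrix_of_graded _ _ _ _ _ (hℓ.le_of_sign_ne_zero ε)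
    (hℓ.le_of_sign_ne_zero ε) (h1 i)

theorem CellExact.graded_zero {ℓ : ∀ i, X.Cell i → σ →₀ ℕ} (hℓ : X.LabelMono ℓ)
    {ε : X.Incidence} (h : X.CellExact k ε ℓ) (m : σ →₀ ℕ) (z : X.Cell 0 → k)
    (hz : ∀ v, z v ≠ 0 → ℓ 0 v ≤ m) (hz' : ∑ v, z v = 0) :
    ∃ u : X.Cell 1 → k, (∀ e, u e ≠ 0 → ℓ 1 e ≤ m) ∧ ∀ v, z v = ∑ e, (ε.sign v e : k) * u e :=
  exists_graded_of_mulVec_monoMatrix _ _ _ _ _ (hℓ.le_of_sign_ne_zero ε)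
    (fun _ _ _ => zero_le) h.zero m z hz fun _ => by simpa using hz'

theorem CellExact.graded_succ {ℓ : ∀ i, X.Cell i → σ →₀ ℕ} (hℓ : X.LabelMono ℓ)
    {ε : X.Incidence} (h : X.CellExact k ε ℓ) {i : ℕ} (m : σ →₀ ℕ) (z : X.Cell (i + 1) → k)
    (hz : ∀ v, z v ≠ 0 → ℓ (i + 1) v ≤ m)
    (hz' : ∀ v : X.Cell i, ∑ e, (ε.sign v e : k) * z e = 0) :
    ∃ u : X.Cell (i + 2) → k, (∀ e, u e ≠ 0 → ℓ (i + 2) e ≤ m) ∧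
      ∀ v, z v = ∑ e, (ε.sign v e : k) * u e :=
  exists_graded_of_mulVec_monoMatrix _ _ _ _ _ (hℓ.le_of_sign_ne_zero ε)
    (hℓ.le_of_sign_ne_zero ε) (h.succ i) m z hz hz'

theorem augmentation_mul_boundary {ℓ : ∀ i, X.Cell i → σ →₀ ℕ} (hℓ : X.LabelMono ℓ)
    (ε : X.Incidence) :
    monoMatrix (ℓ 0) (fun _ : Unit => 0) (fun _ _ => (1 : k)) *
      monoMatrix (ℓ 1) (ℓ 0) (fun G F => (ε.sign G F : k)) = 0 :=
  monoMatrix_mul_eq_zero _ _ _ _ _ (hℓ.le_of_sign_ne_zero ε) (fun _ _ _ => zero_le)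
    fun _ F => by simpa using sum_sign_vertices ε F

theorem boundary_mul_boundary {ℓ : ∀ i, X.Cell i → σ →₀ ℕ} (hℓ : X.LabelMono ℓ)
    (ε : X.Incidence) (i : ℕ) :
    monoMatrix (ℓ (i + 1)) (ℓ i) (fun G F => (ε.sign G F : k)) *
      monoMatrix (ℓ (i + 2)) (ℓ (i + 1)) (fun G F => (ε.sign G F : k)) = 0 :=
  monoMatrix_mul_eq_zero _ _ _ _ _ (hℓ.le_of_sign_ne_zero ε) (hℓ.le_of_sign_ne_zero ε)
    (sum_sign_facets ε)

open Classical in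
/-- Exactness of the complex obtained by replacing the variable `s` by `s'` implies exactness. -/
theorem CellExact.of_rename {ℓ : ∀ i, X.Cell i → σ →₀ ℕ} (hℓ : X.LabelMono ℓ) {ε : X.Incidence}
    {s s' : σ} (hss : s ≠ s') {ρ : σ → σ} (hρ : ∀ t, ρ t = if t = s then s' else t)
    (h : X.CellExact k ε fun i F => (ℓ i F).mapDomain ρ) : X.CellExact k ε ℓ := by
  have hd : ∀ (i : ℕ) (G : X.Cell i) (F : X.Cell (i + 1)), (ε.sign G F : k) ≠ 0 →
      (ℓ i G).degree + (ℓ (i + 1) F - ℓ i G).degree = (ℓ (i + 1) F).degree := by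
    intro i G F h
    rw [← map_add, add_tsub_cancel_of_le (hℓ.le_of_sign_ne_zero ε G F h)]
  constructor
  · intro w hw
    refine exists_mulVec_of_rename ρ hρ _ _ (fun F => (ℓ 1 F).degree) (fun F => (ℓ 0 F).degree)
      (hd 0) (monoMatrix _ _ _) _ (monoMatrix _ _ _) _ (fun _ _ => rfl)
      (monoMatrix_map_rename ρ _ _ _ (hℓ.le_of_sign_ne_zero ε))
      (monoMatrix_map_rename ρ _ _ _ (fun _ _ _ => zero_le)) hss (augmentation_mul_boundary hℓ ε)
      (fun w hw => h.zero w ?_) w hw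
    simpa only [Finsupp.mapDomain_zero] using hw
  · intro i w hw
    exact exists_mulVec_of_rename ρ hρ _ _ (fun F => (ℓ (i + 2) F).degree)
      (fun F => (ℓ (i + 1) F).degree) (hd (i + 1)) (monoMatrix _ _ _) _ (monoMatrix _ _ _) _
      (fun _ _ => rfl) (monoMatrix_map_rename ρ _ _ _ (hℓ.le_of_sign_ne_zero ε))
      (monoMatrix_map_rename ρ _ _ _ (hℓ.le_of_sign_ne_zero ε)) hss
      (boundary_mul_boundary hℓ ε i) (h.succ i) w hw

theorem label_mono {a : X.Cell 0 → σ →₀ ℕ} : X.LabelMono fun _ F => X.label a F.1 :=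
  fun _ _ _ h => by
    classical
    refine Finset.sup_mono fun _ hv => ?_
    rw [Finset.mem_filter] at hv ⊢
    exact ⟨hv.1, verts_mono h hv.2⟩

theorem label_cell_zero (a : X.Cell 0 → σ →₀ ℕ) (v : X.Cell 0) : X.label a v.1 = a v := by
  rw [label, verts_cell_zero, ← Finset.sup_singleton (f := a) (b := v)]
  congr 1
  ext x
  simp

theorem augmentation_eq (a : X.Cell 0 → σ →₀ ℕ) (w : X.Cell 0 → MvPolynomial σ k) :
    X.augmentation a k w = (monoMatrix (fun v : X.Cell 0 => X.label a v.1) (fun _ : Unit => 0)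
      fun _ _ => (1 : k)).mulVec w () := by
  simp only [augmentation, Fintype.linearCombination_apply, Matrix.mulVec, dotProduct, monoMatrix,
    Matrix.of_apply, label_cell_zero, tsub_zero, smul_eq_mul]
  exact Finset.sum_congr rfl fun v _ => mul_comm _ _

/-- `CellExact` records only that cycles are boundaries; the reverse inclusion follows from the
relations of the incidence function. -/
theorem cellExact_iff {a : X.Cell 0 → σ →₀ ℕ} {ε : X.Incidence} :
    X.CellExact k ε (fun _ F => X.label a F.1) ↔
      Function.Exact (X.boundary a k ε 0) (X.augmentation a k) ∧
      ∀ i, Function.Exact (X.boundary a k ε (i + 1)) (X.boundary a k ε i) := by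
  have key : ∀ w, X.augmentation a k w = 0 ↔ (monoMatrix (fun v : X.Cell 0 => X.label a v.1)
      (fun _ : Unit => 0) fun _ _ => (1 : k)).mulVec w = 0 := by
    intro w
    rw [augmentation_eq]
    exact ⟨fun h => funext fun _ => h, fun h => congrFun h ()⟩
  constructor
  · intro h
    refine ⟨fun w => ⟨fun hw => h.zero w ((key w).1 hw), ?_⟩, fun i w => ⟨fun hw => h.succ i w hw, ?_⟩⟩
    · rintro ⟨u, rfl⟩
      rw [key]
      change Matrix.mulVec _ (Matrix.mulVec (monoMatrix _ _ _) u) = 0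
      rw [Matrix.mulVec_mulVec]
      have := augmentation_mul_boundary (k := k) (label_mono (a := a)) ε
      exact (congrArg (fun m => Matrix.mulVec m u) this).trans (Matrix.zero_mulVec u)
    · rintro ⟨u, rfl⟩
      change Matrix.mulVec (monoMatrix _ _ _) (Matrix.mulVec (monoMatrix _ _ _) u) = 0
      rw [Matrix.mulVec_mulVec]
      have := boundary_mul_boundary (k := k) (label_mono (a := a)) ε i
      exact (congrArg (fun m => Matrix.mulVec m u) this).trans (Matrix.zero_mulVec u)
  · rintro ⟨h1, h2⟩
    exact ⟨fun w hw => (h1 w).1 ((key w).2 hw), fun i w hw => (h2 i w).1 hw⟩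

theorem range_augmentation_eq (a : X.Cell 0 → σ →₀ ℕ) :
    LinearMap.range (X.augmentation a k) =
      Ideal.span (Set.range fun v => monomial (a v) (1 : k)) :=
  Fintype.range_linearCombination _ _

theorem boundary_mem_span_X {a : X.Cell 0 → σ →₀ ℕ} {ε : X.Incidence} {i : ℕ}
    (h : ∀ (G : X.Cell i) (F : X.Cell (i + 1)), G.1 ⊆ F.1 → X.label a G.1 ≠ X.label a F.1)
    (w : X.Cell (i + 1) → MvPolynomial σ k) (G : X.Cell i) :
    X.boundary a k ε i w G ∈ Ideal.span (Set.range (MvPolynomial.X : σ → MvPolynomial σ k)) := by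
  refine Ideal.sum_mem _ fun F _ => Ideal.mul_mem_right _ _ ?_
  simp only [Matrix.of_apply]
  by_cases hGF : G.1 ⊆ F.1
  · have hle := label_mono (a := a) i G F hGF
    have hne := h G F hGF
    rw [← pow_one (Ideal.span _)]
    refine (monomial_mem_pow_idealOfVars_iff 1 _ (sign_ne_zero_of_subset ε hGF)).2 ?_
    rw [Nat.one_le_iff_ne_zero, Ne, Finsupp.degree_eq_zero_iff, tsub_eq_zero_iff_le]
    exact fun hcon => hne (le_antisymm hle hcon)
  · rw [ε.sign_of_not_facet G F hGF]
    simp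

/-- If G and F had the same label, the boundary of the basis element of F would have the entry 1 or
-1 at G, outside the ideal of the variables. -/
theorem label_ne_of_boundary_mem {a : X.Cell 0 → σ →₀ ℕ} {ε : X.Incidence} {i : ℕ}
    (h : ∀ (w : X.Cell (i + 1) → MvPolynomial σ k) (G : X.Cell i), X.boundary a k ε i w G ∈
      Ideal.span (Set.range (MvPolynomial.X : σ → MvPolynomial σ k)))
    (G : X.Cell i) (F : X.Cell (i + 1)) (hGF : G.1 ⊆ F.1) : X.label a G.1 ≠ X.label a F.1 := by
  classical
  intro heq
  have h1 := h (Pi.single F 1) G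
  have h2 : X.boundary a k ε i (Pi.single F 1) G = monomial 0 (ε.sign G F : k) := by
    rw [boundary, Matrix.mulVecLin_apply, Matrix.mulVec_single_one]
    simp [heq]
  rw [h2, ← pow_one (Ideal.span _)] at h1
  have h3 := (monomial_mem_pow_idealOfVars_iff 1 _ (sign_ne_zero_of_subset ε hGF)).1 h1
  simp at h3

end PolyhedralComplex

/-! ### Dimensions and incidences of the cells in a realization of Δ -/

section DeltaComplexes

variable {d : ℕ} {τ : DownTriangle d → Fin 3}

theorem degree_of_mem_deltaCells {c : Set (Fin 3 →₀ ℕ)} (hc : c ∈ deltaCells τ)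
    {p : Fin 3 →₀ ℕ} (hp : p ∈ c) : p.degree = d := by
  rcases mem_deltaCells.1 hc with ⟨p', h, rfl⟩ | ⟨q, w, h, -, rfl⟩ | ⟨q, h, rfl⟩
  · rw [Set.mem_singleton_iff.1 hp, h]
  · rcases hp with rfl | hp
    · rw [map_add, Finsupp.degree_single, h]
    · rw [Set.mem_singleton_iff.1 hp, map_add, Finsupp.degree_single, h]
  · exact degree_of_mem_regionSet h hp

theorem add_single_ne_add_single (q : Fin 3 →₀ ℕ) {i j : Fin 3} (h : i ≠ j) :
    q + 𝐞 i ≠ q + 𝐞 j := fun hcon =>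
  h ((Finsupp.single_left_inj one_ne_zero).1 (add_left_cancel hcon))

theorem edgeSet_not_subsingleton (q : Fin 3 →₀ ℕ) (w : Fin 3) : ¬ (edgeSet q w).Subsingleton :=
  fun h => add_single_ne_add_single q ((by decide : ∀ w : Fin 3, w + 1 ≠ w + 2) w)
    (h (Set.mem_insert _ _) (Set.mem_insert_of_mem _ rfl))

theorem not_regionSet_subset_edgeSet {q q' : Fin 3 →₀ ℕ} {w : Fin 3} :
    ¬ regionSet τ q ⊆ edgeSet q' w := by
  intro h
  have h0 := h (Or.inl ⟨0, rfl⟩)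
  have h1 := h (Or.inl ⟨1, rfl⟩)
  have h2 := h (Or.inl ⟨2, rfl⟩)
  have n01 := add_single_ne_add_single q (show (0 : Fin 3) ≠ 1 by decide)
  have n02 := add_single_ne_add_single q (show (0 : Fin 3) ≠ 2 by decide)
  have n12 := add_single_ne_add_single q (show (1 : Fin 3) ≠ 2 by decide)
  simp only [edgeSet, Set.mem_insert_iff, Set.mem_singleton_iff] at h0 h1 h2
  rcases h0 with h0 | h0 <;> rcases h1 with h1 | h1 <;> rcases h2 with h2 | h2 <;>
    first
      | exact n01 (h0.trans h1.symm)
      | exact n02 (h0.trans h2.symm)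
      | exact n12 (h1.trans h2.symm)

variable {N : ℕ} {X : PolyhedralComplex N} {a : X.Cell 0 → (Fin 3 →₀ ℕ)}

namespace IsDelta

variable (H : IsDelta τ X a)
include H

theorem mem_deltaCells {P : Set (EuclideanSpace ℝ (Fin N))} (hP : P ∈ X.faces)
    (hne : P.Nonempty) : a '' X.verts P ∈ deltaCells τ := by
  rw [← H.2]
  exact ⟨P, hP, hne, rfl⟩

theorem exists_face {c : Set (Fin 3 →₀ ℕ)} (hc : c ∈ deltaCells τ) :
    ∃ P ∈ X.faces, P.Nonempty ∧ a '' X.verts P = c := by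
  rw [← H.2] at hc
  obtain ⟨P, h1, h2, h3⟩ := hc
  exact ⟨P, h1, h2, h3.symm⟩

theorem image_subset_iff {P Q : Set (EuclideanSpace ℝ (Fin N))} (hP : P ∈ X.faces)
    (hQ : Q ∈ X.faces) : a '' X.verts P ⊆ a '' X.verts Q ↔ P ⊆ Q := by
  rw [Set.image_subset_image_iff H.1]
  exact ⟨PolyhedralComplex.subset_of_verts_subset hP hQ, PolyhedralComplex.verts_mono⟩

theorem image_inj {P Q : Set (EuclideanSpace ℝ (Fin N))} (hP : P ∈ X.faces)
    (hQ : Q ∈ X.faces) (h : a '' X.verts P = a '' X.verts Q) : P = Q :=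
  ((H.image_subset_iff hP hQ).1 h.subset).antisymm ((H.image_subset_iff hQ hP).1 h.symm.subset)

theorem finrank_of_singleton {P : Set (EuclideanSpace ℝ (Fin N))} (hP : P ∈ X.faces)
    {p : Fin 3 →₀ ℕ} (h : a '' X.verts P = {p}) : Module.finrank ℝ (vectorSpan ℝ P) = 0 := by
  obtain ⟨v, hv, rfl⟩ : p ∈ a '' X.verts P := by rw [h]; rfl
  have : P = v.1 := H.image_inj hP v.2.1 (by rw [h, PolyhedralComplex.verts_cell_zero,
    Set.image_singleton])
  rw [this]
  exact v.2.2.2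

/-- `IsDelta` prescribes only vertex sets, so dimensions are recovered from facets: a facet around
one of the two vertices has a proper nonempty part of the pair as vertex set, hence is a point. -/
theorem finrank_of_edge {P : Set (EuclideanSpace ℝ (Fin N))} (hP : P ∈ X.faces)
    (hne : P.Nonempty) {q : Fin 3 →₀ ℕ} {w : Fin 3} (h : a '' X.verts P = edgeSet q w) :
    Module.finrank ℝ (vectorSpan ℝ P) = 1 := by
  obtain ⟨v, hv⟩ := PolyhedralComplex.verts_nonempty hP hne
  have hvP : v.1 ≠ P := by
    intro hcon
    refine edgeSet_not_subsingleton q w ?_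
    rw [← h, ← hcon, PolyhedralComplex.verts_cell_zero, Set.image_singleton]
    exact Set.subsingleton_singleton
  obtain ⟨P', h1, h2, h3, h4, h5⟩ := X.exists_facet_of_subset v.2.1 hP hv v.2.2.1 hvP
  have h6 : a '' X.verts P' ⊆ edgeSet q w := by
    rw [← h]
    exact (H.image_subset_iff h1 hP).2 h3
  have h7 : (a '' X.verts P').Nonempty :=
    (PolyhedralComplex.verts_nonempty h1 (v.2.2.1.mono h2)).image a
  have h8 : a '' X.verts P' ≠ edgeSet q w := fun hcon => h4 (H.image_inj h1 hP (hcon.trans h.symm))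
  rcases Set.subset_pair_iff_eq.1 h6 with h9 | h9 | h9 | h9
  · exact absurd h9 h7.ne_empty
  · rw [← h5, H.finrank_of_singleton h1 h9]
  · rw [← h5, H.finrank_of_singleton h1 h9]
  · exact absurd h9 h8

/-- A facet around a kept edge of the region is a cell of Δ strictly inside the region and
containing an edge. It cannot be a region, so it is 1-dimensional. -/
theorem finrank_of_region {P : Set (EuclideanSpace ℝ (Fin N))} (hP : P ∈ X.faces)
    {q : Fin 3 →₀ ℕ} (hq : q.degree + 1 = d) (h : a '' X.verts P = regionSet τ q) :
    Module.finrank ℝ (vectorSpan ℝ P) = 2 := by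
  obtain ⟨q', w, h1, h2, h3, -⟩ := exists_edgeSet_of_mem_regionSet hq
    (p := q + 𝐞 0) (τ := τ) (Or.inl ⟨0, rfl⟩)
  obtain ⟨Q, h4, h5, h6⟩ := H.exists_face (_root_.mem_deltaCells.2 (Or.inr (Or.inl
    ⟨q', w, h1, h2, rfl⟩)))
  have h7 : Q ⊆ P := (H.image_subset_iff h4 hP).1 (by rwa [h6, h])
  have h8 : Q ≠ P := by
    rintro rfl
    exact not_regionSet_subset_edgeSet (h.symm.trans h6).subset
  obtain ⟨P', g1, g2, g3, g4, g5⟩ := X.exists_facet_of_subset h4 hP h7 h5 h8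
  have g6 : edgeSet q' w ⊆ a '' X.verts P' := h6 ▸ (H.image_subset_iff h4 g1).2 g2
  have g7 : a '' X.verts P' ⊆ regionSet τ q := h ▸ (H.image_subset_iff g1 hP).2 g3
  rcases _root_.mem_deltaCells.1 (H.mem_deltaCells g1 (h5.mono g2)) with
    ⟨p, -, g8⟩ | ⟨q1, w1, -, -, g8⟩ | ⟨q1, g9, g8⟩
  · refine absurd ?_ (edgeSet_not_subsingleton q' w)
    exact Set.Subsingleton.anti (g8 ▸ Set.subsingleton_singleton) g6
  · rw [← g5, H.finrank_of_edge g1 (h5.mono g2) g8]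
  · refine absurd (H.image_inj g1 hP ?_) g4
    rw [g8] at g7
    rw [g8, h, eq_of_upVertices_subset_regionSet g9 hq (Set.subset_union_left.trans g7)]

theorem cases_cell {i : ℕ} (P : X.Cell i) :
    (i = 0 ∧ ∃ p : Fin 3 →₀ ℕ, p.degree = d ∧ a '' X.verts P.1 = {p}) ∨
    (i = 1 ∧ ∃ (q : Fin 3 →₀ ℕ) (w : Fin 3), q.degree + 1 = d ∧ ¬ IsRemoved τ q w ∧
      a '' X.verts P.1 = edgeSet q w) ∨
    (i = 2 ∧ ∃ q : Fin 3 →₀ ℕ, q.degree + 1 = d ∧ a '' X.verts P.1 = regionSet τ q) := by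
  have hi := P.2.2.2
  rcases _root_.mem_deltaCells.1 (H.mem_deltaCells P.2.1 P.2.2.1) with
    ⟨p, h1, h2⟩ | ⟨q, w, h1, h2, h3⟩ | ⟨q, h1, h2⟩
  · exact Or.inl ⟨by rw [← hi, H.finrank_of_singleton P.2.1 h2], p, h1, h2⟩
  · exact Or.inr (Or.inl ⟨by rw [← hi, H.finrank_of_edge P.2.1 P.2.2.1 h3], q, w, h1, h2, h3⟩)
  · exact Or.inr (Or.inr ⟨by rw [← hi, H.finrank_of_region P.2.1 h1 h2], q, h1, h2⟩)

theorem isEmpty_cell (i : ℕ) : IsEmpty (X.Cell (i + 3)) :=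
  ⟨fun P => by rcases H.cases_cell P with h | h | h <;> omega⟩

theorem exists_edge (e : X.Cell 1) : ∃ x : (Fin 3 →₀ ℕ) × Fin 3, x.1.degree + 1 = d ∧
    ¬ IsRemoved τ x.1 x.2 ∧ a '' X.verts e.1 = edgeSet x.1 x.2 := by
  rcases H.cases_cell e with ⟨h, -⟩ | ⟨-, q, w, h⟩ | ⟨h, -⟩
  · simp at h
  · exact ⟨(q, w), h⟩
  · simp at h

theorem exists_region (f : X.Cell 2) : ∃ q : Fin 3 →₀ ℕ, q.degree + 1 = d ∧
    a '' X.verts f.1 = regionSet τ q := by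
  rcases H.cases_cell f with ⟨h, -⟩ | ⟨h, -⟩ | ⟨-, h⟩
  · simp at h
  · simp at h
  · exact h

/-- The edge of `Γ` corresponding to a `1`-cell. -/
noncomputable def edge (e : X.Cell 1) : (Fin 3 →₀ ℕ) × Fin 3 := (H.exists_edge e).choose

/-- The monomial of the up triangle contained in a `2`-cell. -/
noncomputable def region (f : X.Cell 2) : Fin 3 →₀ ℕ := (H.exists_region f).choose

theorem image_edge (e : X.Cell 1) : a '' X.verts e.1 = edgeSet (H.edge e).1 (H.edge e).2 :=
  (H.exists_edge e).choose_spec.2.2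

theorem image_region (f : X.Cell 2) : a '' X.verts f.1 = regionSet τ (H.region f) :=
  (H.exists_region f).choose_spec.2

theorem subset_edge_iff (v : X.Cell 0) (e : X.Cell 1) :
    v.1 ⊆ e.1 ↔ a v ∈ edgeSet (H.edge e).1 (H.edge e).2 := by
  rw [← H.image_subset_iff v.2.1 e.2.1, PolyhedralComplex.verts_cell_zero, Set.image_singleton,
    Set.singleton_subset_iff, H.image_edge]

theorem subset_region_iff (e : X.Cell 1) (f : X.Cell 2) :
    e.1 ⊆ f.1 ↔ edgeSet (H.edge e).1 (H.edge e).2 ⊆ regionSet τ (H.region f) := by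
  rw [← H.image_subset_iff e.2.1 f.2.1, H.image_edge, H.image_region]

theorem vertex_range (x : Fin 3 →₀ ℕ) : (∃ v, a v = x) ↔ x.degree = d := by
  constructor
  · rintro ⟨v, rfl⟩
    refine degree_of_mem_deltaCells (H.mem_deltaCells v.2.1 v.2.2.1) ⟨v, ?_, rfl⟩
    exact Set.Subset.refl v.1
  · intro hx
    obtain ⟨P, h1, h2, h3⟩ := H.exists_face (_root_.mem_deltaCells.2 (Or.inl ⟨x, hx, rfl⟩))
    obtain ⟨v, -, hv⟩ : x ∈ a '' X.verts P := by rw [h3]; rfl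
    exact ⟨v, hv⟩

theorem edge_injective : Function.Injective H.edge := fun e e' h =>
  Subtype.ext (H.image_inj e.2.1 e'.2.1 (by rw [H.image_edge, H.image_edge, h]))

theorem region_injective : Function.Injective H.region := fun f f' h =>
  Subtype.ext (H.image_inj f.2.1 f'.2.1 (by rw [H.image_region, H.image_region, h]))

theorem edge_range (q : Fin 3 →₀ ℕ) (w : Fin 3) :
    (∃ e, H.edge e = (q, w)) ↔ q.degree + 1 = d ∧ ¬ IsRemoved τ q w := by
  constructor
  · rintro ⟨e, he⟩
    have := (H.exists_edge e).choose_spec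
    change (H.edge e).1.degree + 1 = d ∧ ¬ IsRemoved τ (H.edge e).1 (H.edge e).2 ∧ _ at this
    rw [he] at this
    exact ⟨this.1, this.2.1⟩
  · rintro ⟨h1, h2⟩
    obtain ⟨P, h3, h4, h5⟩ := H.exists_face (_root_.mem_deltaCells.2 (Or.inr (Or.inl
      ⟨q, w, h1, h2, rfl⟩)))
    refine ⟨⟨P, h3, h4, H.finrank_of_edge h3 h4 h5⟩, ?_⟩
    have := H.image_edge ⟨P, h3, h4, H.finrank_of_edge h3 h4 h5⟩
    obtain ⟨h6, h7⟩ := edgeSet_injective (this.symm.trans h5)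
    exact Prod.ext h6 h7

theorem region_range (q : Fin 3 →₀ ℕ) : (∃ f, H.region f = q) ↔ q.degree + 1 = d := by
  constructor
  · rintro ⟨f, rfl⟩
    exact (H.exists_region f).choose_spec.1
  · intro h1
    obtain ⟨P, h3, h4, h5⟩ := H.exists_face (_root_.mem_deltaCells.2 (Or.inr (Or.inr
      ⟨q, h1, rfl⟩)))
    refine ⟨⟨P, h3, h4, H.finrank_of_region h3 h1 h5⟩, ?_⟩
    have := H.image_region ⟨P, h3, h4, H.finrank_of_region h3 h1 h5⟩
    refine eq_of_upVertices_subset_regionSet (H.exists_region _).choose_spec.1 h1 (τ := τ) ?_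
    exact Set.subset_union_left.trans (this.symm.trans h5).subset

theorem deltaSigns (ε : X.Incidence) : DeltaSigns τ a H.edge H.region
    (fun v e => ε.sign v e) (fun e f => ε.sign e f) where
  p_inj := H.1
  p_range := H.vertex_range
  E_inj := H.edge_injective
  E_range := H.edge_range
  R_inj := H.region_injective
  R_range := H.region_range
  s1_unit v e h := ε.sign_facet v e ((H.subset_edge_iff v e).2 h)
  s1_zero v e h := ε.sign_of_not_facet v e fun h' => h ((H.subset_edge_iff v e).1 h')
  s2_unit e f h := ε.sign_facet e f ((H.subset_region_iff e f).2 h)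
  s2_zero e f h := ε.sign_of_not_facet e f fun h' => h ((H.subset_region_iff e f).1 h')
  sum1 := ε.sum_vertices
  sum2 := ε.sum_facets

/-- The standard signs work, with the value 0 above dimension 2, where there are no cells. -/
theorem nonempty_incidence : Nonempty X.Incidence := by
  have D := deltaSigns_std τ H.1 H.vertex_range H.edge_injective H.edge_range H.region_injective
    H.region_range
  let s : ∀ {i : ℕ}, X.Cell i → X.Cell (i + 1) → ℤ := fun {i} => match i with
    | 0 => fun v e => stdSign1 (a v) (H.edge e)
    | 1 => fun e f => stdSign2 τ (H.edge e) (H.region f)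
    | _ + 2 => fun _ _ => 0
  refine ⟨⟨s, ?_, ?_, D.sum1, ?_⟩⟩
  · rintro (_ | _ | i) G F h
    · exact D.s1_unit G F ((H.subset_edge_iff G F).1 h)
    · exact D.s2_unit G F ((H.subset_region_iff G F).1 h)
    · exact (H.isEmpty_cell i).elim F
  · rintro (_ | _ | i) G F h
    · exact D.s1_zero G F fun h' => h ((H.subset_edge_iff G F).2 h')
    · exact D.s2_zero G F fun h' => h ((H.subset_region_iff G F).2 h')
    · exact (H.isEmpty_cell i).elim F
  · rintro (_ | i) G F
    · exact D.sum2 G F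
    · exact (H.isEmpty_cell i).elim F

end IsDelta

end DeltaComplexes

namespace PolyhedralComplex

theorem label_le_iff {N : ℕ} {X : PolyhedralComplex N} {σ : Type*} {a : X.Cell 0 → σ →₀ ℕ}
    {P : Set (EuclideanSpace ℝ (Fin N))} {m : σ →₀ ℕ} :
    X.label a P ≤ m ↔ ∀ p ∈ a '' X.verts P, p ≤ m := by
  classical
  rw [label, Finset.sup_le_iff]
  simp

end PolyhedralComplex

/-- Divisibility of renamed monomials is divisibility by the part of m in the renamed variables;
this reduces multidegrees in a larger ring to multidegrees in three variables. -/
theorem mapDomain_le_iff {α β : Type*} [Finite α] {ι : α → β} (hι : Function.Injective ι)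
    {p : α →₀ ℕ} {m : β →₀ ℕ} :
    p.mapDomain ι ≤ m ↔ p ≤ Finsupp.equivFunOnFinite.symm (m ∘ ι) := by
  constructor
  · intro h j
    have := h (ι j)
    rwa [Finsupp.mapDomain_apply hι] at this
  · intro h b
    by_cases hb : b ∈ Set.range ι
    · obtain ⟨j, rfl⟩ := hb
      rw [Finsupp.mapDomain_apply hι]
      exact h j
    · rw [Finsupp.mapDomain_of_notMem_range _ _ hb]
      exact Nat.zero_le _

/-! ### Resolutions supported on Δ, from m^d to its polarization -/

section DeltaResolutions

variable {d : ℕ} {τ : DownTriangle d → Fin 3} {N : ℕ} {X : PolyhedralComplex N}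
  {a : X.Cell 0 → (Fin 3 →₀ ℕ)}

theorem label_eq_edgeLabel {P : Set (EuclideanSpace ℝ (Fin N))} {x : (Fin 3 →₀ ℕ) × Fin 3} (h : a '' X.verts P = edgeSet x.1 x.2) :
    X.label a P = edgeLabel x := by
  refine le_antisymm ?_ ?_
  · rw [PolyhedralComplex.label_le_iff, h]
    exact fun p hp => le_edgeLabel_of_mem hp
  · have := PolyhedralComplex.label_le_iff.1 (le_refl (X.label a P))
    rw [h] at this
    exact edgeLabel_le_of_subset this

theorem label_eq_regionLabel {P : Set (EuclideanSpace ℝ (Fin N))} {q : Fin 3 →₀ ℕ}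
    (h : a '' X.verts P = regionSet τ q) : X.label a P = regionLabel q := by
  refine le_antisymm ?_ ?_
  · rw [PolyhedralComplex.label_le_iff, h]
    exact fun p hp => le_of_mem_regionSet hp
  · have := PolyhedralComplex.label_le_iff.1 (le_refl (X.label a P))
    rw [h] at this
    intro j
    have h1 := this _ (Or.inl ⟨j, rfl⟩) j
    refine le_trans (le_of_eq ?_) h1
    simp only [regionLabel, Finsupp.add_apply, Finsupp.single_apply]
    fin_cases j <;> simp

/-- The map replacing the variables in `S` by the first variable of the same colour. -/
def collapse [NeZero d] (S : Finset ((_ : Fin 3) × Fin d)) (t : (_ : Fin 3) × Fin d) :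
    (_ : Fin 3) × Fin d :=
  if t ∈ S then ⟨t.1, 0⟩ else t

theorem collapse_insert [NeZero d] {S : Finset ((_ : Fin 3) × Fin d)} {s : (_ : Fin 3) × Fin d}
    (hs : s.2 ≠ 0) : collapse (insert s S) =
      (fun t => if t = s then ⟨s.1, 0⟩ else t) ∘ collapse S := by
  funext t
  simp only [Function.comp, collapse, Finset.mem_insert]
  by_cases h1 : t ∈ S
  · simp only [h1, or_true, if_true]
    rw [if_neg]
    rintro rfl
    exact hs rfl
  · simp only [h1, or_false, if_false]
    by_cases h2 : t = s
    · rw [if_pos h2, if_pos h2, h2]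
    · rw [if_neg h2, if_neg h2]

namespace IsDelta

theorem label_edge (H : IsDelta τ X a) (e : X.Cell 1) : X.label a e.1 = edgeLabel (H.edge e) :=
  label_eq_edgeLabel (H.image_edge e)

theorem label_region (H : IsDelta τ X a) (f : X.Cell 2) :
    X.label a f.1 = regionLabel (H.region f) :=
  label_eq_regionLabel (H.image_region f)

theorem degree_label (H : IsDelta τ X a) {i : ℕ} (F : X.Cell i) :
    (X.label a F.1).degree = d + i := by
  match i, F with
  | 0, v => rw [PolyhedralComplex.label_cell_zero, add_zero, ← H.vertex_range]; exact ⟨v, rfl⟩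
  | 1, e =>
    have := ((H.edge_range (H.edge e).1 (H.edge e).2).1 ⟨e, rfl⟩).1
    simp only [H.label_edge, edgeLabel, map_add, Finsupp.degree_single]
    omega
  | 2, f =>
    have := (H.region_range _).1 ⟨f, rfl⟩
    simp only [H.label_region, regionLabel, map_add, Finsupp.degree_single]
    omega
  | i + 3, F => exact (H.isEmpty_cell i).elim F

theorem mapDomain_label (H : IsDelta τ X a) {P : Set (EuclideanSpace ℝ (Fin N))}
    (hP : P ∈ X.faces) :
    (X.label (fun v => polarizedExponent τ (a v)) P).mapDomain Sigma.fst = X.label a P := by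
  classical
  refine mapDomain_fst_sup_polarizedExponent τ _ a (fun v _ => (H.vertex_range _).1 ⟨v, rfl⟩) ?_
  intro w
  rcases P.eq_empty_or_nonempty with rfl | hne
  · left
    rw [Finset.filter_eq_empty_iff]
    intro v _ hv
    exact v.2.2.1.ne_empty (Set.subset_eq_empty hv rfl)
  · right
    obtain ⟨_, ⟨m, hm, rfl⟩, h⟩ := exists_max_polarIndices τ w (H.mem_deltaCells hP hne)
    refine ⟨m, by simpa using hm, fun v hv => h _ ⟨v, by simpa using hv, rfl⟩⟩

variable {k : Type*} [Field k]

/-- This is the base of the induction on identified variables, stated for any injective renaming so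
as to serve both in S and inside the larger ring. -/
theorem cellExact_mapDomain [NeZero d] (H : IsDelta τ X a) (ε : X.Incidence) {σ : Type*}
    {ι : Fin 3 → σ} (hι : Function.Injective ι) :
    X.CellExact k ε fun _ F => (X.label a F.1).mapDomain ι := by
  have D := H.deltaSigns ε
  refine PolyhedralComplex.CellExact.of_graded (PolyhedralComplex.label_mono.mapDomain ι) ε ?_ ?_
  · intro m z hz hsum
    simp only [mapDomain_le_iff hι, H.label_edge, PolyhedralComplex.label_cell_zero] at hz ⊢
    exact D.exact_vertices _ z hz hsum
  · rintro (_ | _ | i) m z hz hsum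
    · simp only [mapDomain_le_iff hι, H.label_edge, H.label_region] at hz ⊢
      exact D.exact_edges _ z hz hsum
    · have h0 : z = 0 := D.eq_zero_of_sum_s2_eq_zero z hsum
      exact ⟨0, fun e h => absurd rfl h, fun v => by simp [h0]⟩
    · exact ⟨0, fun e h => absurd rfl h, fun v => (H.isEmpty_cell i).elim v⟩

/-- The complexes interpolating between the resolution of a power of the maximal ideal and the
resolution of its polarization are exact. -/
theorem cellExact_collapse [NeZero d] (H : IsDelta τ X a) (ε : X.Incidence)
    (S : Finset ((_ : Fin 3) × Fin d)) :
    X.CellExact k ε fun _ F =>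
      (X.label (fun v => polarizedExponent τ (a v)) F.1).mapDomain (collapse S) := by
  -- T bounds the variables that may still be separate from the first of their colour. The induction
  -- starts with everything identified and separates one more variable at each step.
  suffices key : ∀ T : Finset ((_ : Fin 3) × Fin d), (∀ t ∈ T, t.2 ≠ 0) →
      ∀ S : Finset ((_ : Fin 3) × Fin d), (∀ t, t.2 ≠ 0 → t ∈ S ∨ t ∈ T) →
      X.CellExact k ε fun _ F =>
        (X.label (fun v => polarizedExponent τ (a v)) F.1).mapDomain (collapse S) from
    key (Finset.univ.filter fun t => t.2 ≠ 0) (by simp) S (by simp +contextual)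
  intro T
  induction T using Finset.induction_on with
  | empty =>
    intro _ S hS
    have hι : Function.Injective fun v : Fin 3 => (⟨v, 0⟩ : (_ : Fin 3) × Fin d) :=
      fun v w h => congrArg Sigma.fst h
    -- With T empty, S contains every variable except possibly first ones, and collapsing is
    -- depolarization followed by x_v ↦ the first variable of colour v.
    have hc : collapse S = (fun v : Fin 3 => (⟨v, 0⟩ : (_ : Fin 3) × Fin d)) ∘ Sigma.fst := by
      funext t
      simp only [collapse, Function.comp]
      split_ifs with h
      · rfl
      · obtain ⟨v, l⟩ := t
        have : l = 0 := by
          by_contra hl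
          simpa [h] using hS ⟨v, l⟩ hl
        rw [this]
    have := H.cellExact_mapDomain (k := k) ε hι
    refine cast (congrArg _ ?_) this
    funext i F
    rw [← H.mapDomain_label F.2.1, ← Finsupp.mapDomain_comp, hc]
  | insert s T _ ih =>
    intro hT S hS
    have hs : s.2 ≠ 0 := hT s (Finset.mem_insert_self _ _)
    have hne : s ≠ ⟨s.1, 0⟩ := fun h => hs (by rw [h])
    -- Identifying s with the first variable of its colour turns the labels collapsed along S into
    -- those collapsed along S ∪ {s}, which are exact by induction.
    refine PolyhedralComplex.CellExact.of_rename (PolyhedralComplex.label_mono.mapDomain _) hne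
      (ρ := fun t => if t = s then ⟨s.1, 0⟩ else t) (fun t => by congr) ?_
    have := ih (fun t ht => hT t (Finset.mem_insert_of_mem ht)) (insert s S) fun t ht => by
      rcases hS t ht with h | h
      · exact Or.inl (Finset.mem_insert_of_mem h)
      · rw [Finset.mem_insert] at h ⊢
        tauto
    simp only [collapse_insert hs, Finsupp.mapDomain_comp] at this
    exact this

/-- The case S = ∅ of `cellExact_collapse`. Labels of a cell and of its facet differ since their
depolarizations have degrees d + i + 1 and d + i. -/
theorem isMinimalResolution_polarized [NeZero d] (H : IsDelta τ X a) (ε : X.Incidence) :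
    X.IsMinimalResolution (fun v => polarizedExponent τ (a v)) k ε (polarizedIdeal k τ) := by
  have hex : X.CellExact k ε fun _ F => X.label (fun v => polarizedExponent τ (a v)) F.1 := by
    have := H.cellExact_collapse (k := k) ε ∅
    have hid : collapse (∅ : Finset ((_ : Fin 3) × Fin d)) = id := rfl
    simpa only [hid, Finsupp.mapDomain_id] using this
  obtain ⟨h1, h2⟩ := PolyhedralComplex.cellExact_iff.1 hex
  refine ⟨?_, h1, h2, fun i w G => PolyhedralComplex.boundary_mem_span_X (fun G F _ h => ?_) w G⟩
  · rw [PolyhedralComplex.range_augmentation_eq, polarizedIdeal]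
    congr 1
    ext f
    constructor
    · rintro ⟨v, rfl⟩
      exact ⟨a v, (H.vertex_range _).1 ⟨v, rfl⟩, rfl⟩
    · rintro ⟨p, hp, rfl⟩
      obtain ⟨v, rfl⟩ := (H.vertex_range _).2 hp
      exact ⟨v, rfl⟩
  · have h3 := congrArg (fun p => (p.mapDomain Sigma.fst).degree) h
    simp only [H.mapDomain_label G.2.1, H.mapDomain_label F.2.1, H.degree_label] at h3
    omega

theorem isMinimalResolution [NeZero d] (H : IsDelta τ X a) (ε : X.Incidence) :
    X.IsMinimalResolution a k ε
      (Ideal.span (Set.range (MvPolynomial.X : Fin 3 → MvPolynomial (Fin 3) k)) ^ d) := by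
  have hex : X.CellExact k ε fun _ F => X.label a F.1 := by
    simpa only [Finsupp.mapDomain_id] using
      H.cellExact_mapDomain (k := k) ε (ι := id) Function.injective_id
  obtain ⟨h1, h2⟩ := PolyhedralComplex.cellExact_iff.1 hex
  refine ⟨?_, h1, h2, fun i w G => PolyhedralComplex.boundary_mem_span_X (fun G F _ h => ?_) w G⟩
  · refine Eq.trans ?_ (pow_idealOfVars_eq_span d).symm
    rw [PolyhedralComplex.range_augmentation_eq]
    congr 1
    ext f
    constructor
    · rintro ⟨v, rfl⟩
      exact ⟨a v, (H.vertex_range _).1 ⟨v, rfl⟩, rfl⟩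
    · rintro ⟨p, hp, rfl⟩
      obtain ⟨v, rfl⟩ := (H.vertex_range _).2 hp
      exact ⟨v, rfl⟩
  · have h3 := congrArg Finsupp.degree h
    simp only [H.degree_label] at h3
    omega

end IsDelta

end DeltaResolutions

/-! ### Identification of variables as passage to a quotient -/

section QuotientModules

theorem mk_mem_smul_top_iff {R : Type*} [CommRing R] {I J : Ideal R} {x : R} :
    (Ideal.Quotient.mk J x) ∈ (I • ⊤ : Submodule R (R ⧸ J)) ↔ x ∈ J ⊔ I := by
  have h : (I • ⊤ : Submodule R (R ⧸ J)) = Submodule.map J.mkQ I := by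
    rw [← Submodule.range_mkQ J, LinearMap.range_eq_map, ← Submodule.map_smul'']
    congr 1
    simp
  rw [h]
  change J.mkQ x ∈ _ ↔ _
  rw [← Submodule.mem_comap, Submodule.comap_map_mkQ]

end QuotientModules

namespace PolyhedralComplex

variable {N : ℕ} {X : PolyhedralComplex N} {σ : Type*} {k : Type*} [Field k]

/-- If the complex with collapsed labels is exact, an element of the ideal of vertex labels that
vanishes under the collapse is a combination with coefficients that vanish. -/
theorem CellExact.exists_of_rename_eq_zero {ℓ : ∀ i, X.Cell i → σ →₀ ℕ} (hℓ : X.LabelMono ℓ)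
    {ε : X.Incidence} {ρ : σ → σ} (hρ : ρ ∘ ρ = ρ)
    (h : X.CellExact k ε fun i F => (ℓ i F).mapDomain ρ) {f : MvPolynomial σ k}
    (hf : f ∈ Ideal.span (Set.range fun v => monomial (ℓ 0 v) (1 : k))) (hf0 : rename ρ f = 0) :
    ∃ w : X.Cell 0 → MvPolynomial σ k, f = ∑ v, w v * monomial (ℓ 0 v) 1 ∧
      ∀ v, rename ρ (w v) = 0 := by
  obtain ⟨w, rfl⟩ := (Ideal.mem_span_range_iff_exists_fun).1 hf
  set A := monoMatrix (ℓ 0) (fun _ : Unit => 0) (fun _ _ => (1 : k)) with hA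
  set B := monoMatrix (ℓ 1) (ℓ 0) (fun G F => (ε.sign G F : k)) with hB
  have hAw : ∀ w : X.Cell 0 → MvPolynomial σ k,
      A.mulVec w () = ∑ v, w v * monomial (ℓ 0 v) 1 := by
    intro w
    simp only [hA, Matrix.mulVec, dotProduct, monoMatrix, Matrix.of_apply, tsub_zero]
    exact Finset.sum_congr rfl fun v _ => mul_comm _ _
  have hAB : A * B = 0 := augmentation_mul_boundary hℓ ε
  have hren : ∀ {C D : Type} [Fintype D] (M : Matrix C D (MvPolynomial σ k))
      (u : D → MvPolynomial σ k) (c : C), rename ρ (M.mulVec u c) =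
        (M.map (rename ρ)).mulVec (fun x => rename ρ (u x)) c := by
    intro C D _ M u c
    simp [Matrix.mulVec, dotProduct]
  have hρρ : ∀ g : MvPolynomial σ k, rename ρ (rename ρ g) = rename ρ g := fun g => by
    rw [rename_rename, hρ]
  -- The collapsed coefficients form a syzygy of the collapsed generators, hence a boundary.
  -- Subtracting the corresponding boundary before the collapse leaves f unchanged and makes all
  -- coefficients collapse to zero.
  obtain ⟨u, hu⟩ := h.zero (fun v => rename ρ (w v)) (by
    funext c
    have h1 := monoMatrix_map_rename ρ (ℓ 0) (fun _ : Unit => 0) (fun _ _ => (1 : k))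
      (fun _ _ _ => zero_le)
    simp only [Finsupp.mapDomain_zero] at h1
    rw [h1]
    have h2 := hren A w c
    rw [← hA, ← h2]
    exact (congrArg (rename ρ) (hAw w)).trans hf0)
  rw [monoMatrix_map_rename ρ _ _ _ (hℓ.le_of_sign_ne_zero ε)] at hu
  refine ⟨w - B.mulVec u, ?_, fun v => ?_⟩
  · rw [← hAw, ← hAw, Matrix.mulVec_sub, Matrix.mulVec_mulVec, hAB, Matrix.zero_mulVec, sub_zero]
  · have h3 := congrArg (rename ρ) (congrFun hu v)
    rw [hρρ, hren] at h3
    have h4 : ((B.map (rename ρ)).map (rename ρ) : Matrix _ _ (MvPolynomial σ k)) =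
        B.map (rename ρ) := by
      ext1 G F
      simp only [Matrix.map_apply, hρρ]
    rw [← hB, h4, ← hren] at h3
    rw [Pi.sub_apply, map_sub, h3, sub_self]

end PolyhedralComplex

section Collapse

variable {d : ℕ} [NeZero d] {k : Type*} [Field k]

theorem collapse_comp_self {S : Finset ((_ : Fin 3) × Fin d)} (hS : ∀ t ∈ S, t.2 ≠ 0) :
    collapse S ∘ collapse S = collapse S := by
  funext t
  simp only [Function.comp]
  by_cases h : t ∈ S
  · simp only [collapse, h, if_true]
    exact if_neg fun h' => hS _ h' rfl
  · simp only [collapse, h, if_false]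

/-- The ideal generated by the differences of variables that are identified by `collapse S`. -/
noncomputable def collapseIdeal (k : Type*) [Field k] (S : Finset ((_ : Fin 3) × Fin d)) :
    Ideal (MvPolynomial ((_ : Fin 3) × Fin d) k) :=
  Ideal.span ((fun t => X ⟨t.1, 0⟩ - X t) '' S)

theorem sub_rename_collapse_mem (S : Finset ((_ : Fin 3) × Fin d))
    (f : MvPolynomial ((_ : Fin 3) × Fin d) k) :
    f - rename (collapse S) f ∈ collapseIdeal k S := by
  rw [← Ideal.Quotient.mk_eq_mk_iff_sub_mem]
  have : (Ideal.Quotient.mkₐ k (collapseIdeal k S)) =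
      (Ideal.Quotient.mkₐ k (collapseIdeal k S)).comp (rename (collapse S)) := by
    refine MvPolynomial.algHom_ext fun t => ?_
    simp only [AlgHom.comp_apply, rename_X, Ideal.Quotient.mkₐ_eq_mk, collapse]
    split_ifs with h
    · rw [eq_comm, Ideal.Quotient.mk_eq_mk_iff_sub_mem]
      exact Ideal.subset_span ⟨t, h, rfl⟩
    · rfl
  exact DFunLike.congr_fun this f

theorem rename_collapse_eq_zero_iff {S : Finset ((_ : Fin 3) × Fin d)} (hS : ∀ t ∈ S, t.2 ≠ 0)
    {f : MvPolynomial ((_ : Fin 3) × Fin d) k} :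
    rename (collapse S) f = 0 ↔ f ∈ collapseIdeal k S := by
  constructor
  · intro h
    simpa [h] using sub_rename_collapse_mem S f
  · intro h
    have : collapseIdeal k S ≤ RingHom.ker (rename (collapse S)) := by
      refine Ideal.span_le.2 ?_
      rintro _ ⟨t, ht, rfl⟩
      have h0 : (⟨t.1, 0⟩ : (_ : Fin 3) × Fin d) ∉ S := fun h => hS _ h rfl
      have ht' : t ∈ S := ht
      simp [RingHom.mem_ker, collapse, h0, ht']
    exact this h

end Collapse

section PolarizationSequence

variable {d : ℕ} [NeZero d] {k : Type*} [Field k]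

/-- The variables other than the first one of each colour, in the order of the polarization
sequence. -/
def polarVariables (d : ℕ) : List ((_ : Fin 3) × Fin d) :=
  (List.finRange 3).flatMap fun i => (List.finRange d).tail.map fun j => ⟨i, j⟩

theorem polarizationSequence_eq : polarizationSequence k (fun _ : Fin 3 => d) =
    (polarVariables d).map fun t => (X ⟨t.1, 0⟩ - X t : MvPolynomial ((_ : Fin 3) × Fin d) k) := by
  simp only [polarizationSequence, polarVariables, List.map_flatMap, List.map_map]
  rfl

theorem mem_tail_finRange {j : Fin d} : j ∈ (List.finRange d).tail ↔ j ≠ 0 := by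
  obtain ⟨n, rfl⟩ := Nat.exists_eq_succ_of_ne_zero (NeZero.ne d)
  rw [List.finRange_succ, List.tail_cons]
  simp only [List.mem_map, List.mem_finRange, true_and]
  exact Fin.exists_succ_eq

theorem mem_polarVariables {t : (_ : Fin 3) × Fin d} : t ∈ polarVariables d ↔ t.2 ≠ 0 := by
  obtain ⟨i, j⟩ := t
  simp only [polarVariables, List.mem_flatMap, List.mem_finRange, true_and, List.mem_map,
    mem_tail_finRange]
  constructor
  · rintro ⟨i', j', h, h'⟩
    obtain ⟨rfl, h⟩ := Sigma.mk.inj_iff.1 h'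
    rwa [← eq_of_heq h]
  · exact fun h => ⟨i, j, h, rfl⟩

theorem nodup_polarVariables (d : ℕ) : (polarVariables d).Nodup := by
  rw [polarVariables, List.nodup_flatMap]
  constructor
  · intro i _
    refine List.Nodup.map (fun j j' h => ?_) (List.nodup_finRange d).tail
    exact eq_of_heq (Sigma.mk.inj_iff.1 h).2
  · refine (List.nodup_finRange 3).imp fun {i i'} h => ?_
    rw [Function.onFun, List.disjoint_left]
    intro t h1 h2
    obtain ⟨j, -, rfl⟩ := List.mem_map.1 h1
    obtain ⟨j', -, h3⟩ := List.mem_map.1 h2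
    exact h (Sigma.mk.inj_iff.1 h3).1.symm

theorem ofList_map_sub (l : List ((_ : Fin 3) × Fin d)) :
    Ideal.ofList (l.map fun t => (X ⟨t.1, 0⟩ - X t : MvPolynomial ((_ : Fin 3) × Fin d) k)) =
      collapseIdeal k l.toFinset := by
  rw [Ideal.ofList, collapseIdeal]
  congr 1
  ext f
  simp

end PolarizationSequence

/-! ### The polarized ideal is a polarization of m^d -/

section Polarizations

variable {d : ℕ} [NeZero d] {τ : DownTriangle d → Fin 3} {N : ℕ} {X : PolyhedralComplex N}
  {a : X.Cell 0 → (Fin 3 →₀ ℕ)} {k : Type*} [Field k]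

omit [NeZero d] in
theorem isSquarefreeMonomialIdeal_polarizedIdeal :
    IsSquarefreeMonomialIdeal (polarizedIdeal k τ) := by
  refine ⟨{s | ∃ p : Fin 3 →₀ ℕ, p.degree = d ∧ s = polarizedSupport τ p}, ?_⟩
  have h : ∀ p : Fin 3 →₀ ℕ, (monomial (polarizedExponent τ p) (1 : k)) =
      ∏ t ∈ polarizedSupport τ p, MvPolynomial.X t := fun p => by
    rw [polarizedExponent, monomial_sum_one]
    rfl
  rw [polarizedIdeal]
  congr 1
  ext f
  constructor
  · rintro ⟨p, hp, rfl⟩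
    exact ⟨_, ⟨p, hp, rfl⟩, (h p).symm⟩
  · rintro ⟨_, ⟨p, hp, rfl⟩, rfl⟩
    exact ⟨p, hp, (h p).symm⟩

/-- The generators of the polarized ideal after some variables have been identified. -/
noncomputable def collapsedIdeal (k : Type*) [Field k] (τ : DownTriangle d → Fin 3)
    (S : Finset ((_ : Fin 3) × Fin d)) : Ideal (MvPolynomial ((_ : Fin 3) × Fin d) k) :=
  Ideal.span {f | ∃ p : Fin 3 →₀ ℕ, p.degree = d ∧
    f = monomial ((polarizedExponent τ p).mapDomain (collapse S)) 1}

/-- Membership modulo an initial part of the sequence of differences becomes membership in a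
monomial ideal of the same ring. -/
theorem mem_sup_collapseIdeal_iff {S : Finset ((_ : Fin 3) × Fin d)} (hS : ∀ t ∈ S, t.2 ≠ 0)
    {f : MvPolynomial ((_ : Fin 3) × Fin d) k} :
    f ∈ polarizedIdeal k τ ⊔ collapseIdeal k S ↔
      rename (collapse S) f ∈ collapsedIdeal k τ S := by
  constructor
  · intro h
    obtain ⟨g, hg, y, hy, rfl⟩ := Submodule.mem_sup.1 h
    rw [map_add, (rename_collapse_eq_zero_iff hS).2 hy, add_zero]
    have : polarizedIdeal k τ ≤ (collapsedIdeal k τ S).comap (rename (collapse S)) := by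
      refine Ideal.span_le.2 ?_
      rintro _ ⟨p, hp, rfl⟩
      rw [SetLike.mem_coe, Ideal.mem_comap, rename_monomial]
      exact Ideal.subset_span ⟨p, hp, rfl⟩
    exact this hg
  · intro h
    have h1 : collapsedIdeal k τ S ≤ polarizedIdeal k τ ⊔ collapseIdeal k S := by
      refine Ideal.span_le.2 ?_
      rintro _ ⟨p, hp, rfl⟩
      rw [← rename_monomial]
      have h2 := sub_rename_collapse_mem S (monomial (polarizedExponent τ p) (1 : k))
      rw [← sub_sub_cancel (monomial (polarizedExponent τ p) (1 : k)) (rename _ _)]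
      exact Ideal.sub_mem _ (Ideal.mem_sup_left (Ideal.subset_span ⟨p, hp, rfl⟩))
        (Ideal.mem_sup_right h2)
    rw [← add_sub_cancel (rename (collapse S) f) f]
    exact Ideal.add_mem _ (h1 h) (Ideal.mem_sup_right (sub_rename_collapse_mem S f))

namespace IsDelta

theorem collapsedIdeal_eq (H : IsDelta τ X a) (S : Finset ((_ : Fin 3) × Fin d)) :
    collapsedIdeal k τ S = Ideal.span (Set.range fun v : X.Cell 0 =>
      monomial ((X.label (fun v => polarizedExponent τ (a v)) v.1).mapDomain (collapse S)) 1) := by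
  simp only [PolyhedralComplex.label_cell_zero]
  rw [collapsedIdeal]
  congr 1
  ext f
  constructor
  · rintro ⟨p, hp, rfl⟩
    obtain ⟨v, rfl⟩ := (H.vertex_range _).2 hp
    exact ⟨v, rfl⟩
  · rintro ⟨v, rfl⟩
    exact ⟨a v, (H.vertex_range _).1 ⟨v, rfl⟩, rfl⟩

/-- The product vanishes when s is identified, so by exactness of the next complex it is a
combination of generators whose coefficients are all divisible by the difference; that factor is
cancelled. -/
theorem mem_collapsedIdeal_of_mul_mem (H : IsDelta τ X a) {S : Finset ((_ : Fin 3) × Fin d)}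
    {s : (_ : Fin 3) × Fin d} (hs : s.2 ≠ 0)
    {f : MvPolynomial ((_ : Fin 3) × Fin d) k}
    (hf : (MvPolynomial.X ⟨s.1, 0⟩ - MvPolynomial.X s) * f ∈ collapsedIdeal k τ S) :
    f ∈ collapsedIdeal k τ S := by
  obtain ⟨ε⟩ := H.nonempty_incidence
  have hne : s ≠ ⟨s.1, 0⟩ := fun h => hs (by rw [h])
  set ρ : (_ : Fin 3) × Fin d → (_ : Fin 3) × Fin d := fun t => if t = s then ⟨s.1, 0⟩ else t
    with hρ
  have hρρ : ρ ∘ ρ = ρ := by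
    funext t
    simp only [hρ, Function.comp]
    by_cases h : t = s
    · simp only [h, if_true]
      exact if_neg hne.symm
    · simp only [h, if_false]
  rw [H.collapsedIdeal_eq] at hf ⊢
  have hex := H.cellExact_collapse (k := k) ε (insert s S)
  simp only [collapse_insert hs, Finsupp.mapDomain_comp] at hex
  obtain ⟨w, h1, h2⟩ := PolyhedralComplex.CellExact.exists_of_rename_eq_zero
    (PolyhedralComplex.label_mono.mapDomain (collapse S)) hρρ hex hf (by
      simp [hρ, hne.symm])
  choose z hz using fun v => exists_eq_mul_of_rename_eq_zero (s := s) (s' := ⟨s.1, 0⟩)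
    (fun t => by rw [hρ]) (h2 v)
  have hy : (MvPolynomial.X ⟨s.1, 0⟩ - MvPolynomial.X s :
      MvPolynomial ((_ : Fin 3) × Fin d) k) ≠ 0 :=
    sub_ne_zero.2 fun h => hne (X_injective h).symm
  have h3 : f = ∑ v : X.Cell 0, (-z v) * monomial ((X.label
      (fun v => polarizedExponent τ (a v)) v.1).mapDomain (collapse S)) 1 := by
    refine mul_left_cancel₀ hy ?_
    rw [h1, Finset.mul_sum]
    refine Finset.sum_congr rfl fun v _ => ?_
    rw [hz v]
    ring
  rw [h3]
  exact Ideal.mem_span_range_iff_exists_fun.2 ⟨_, rfl⟩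

theorem isPolarization (H : IsDelta τ X a) : IsPolarization (fun _ : Fin 3 => d)
    (Ideal.span (Set.range (MvPolynomial.X : Fin 3 → MvPolynomial (Fin 3) k)) ^ d)
    (polarizedIdeal k τ) where
  squarefree := isSquarefreeMonomialIdeal_polarizedIdeal
  regular := by
    rw [polarizationSequence_eq]
    refine ⟨⟨fun i hi => ?_⟩, ?_⟩
    · rw [isSMulRegular_quotient_iff_mem_of_smul_mem]
      intro x hx
      obtain ⟨f, rfl⟩ := Ideal.Quotient.mk_surjective x
      have hi' : i < (polarVariables d).length := by simpa using hi
      have hs : (polarVariables d)[i].2 ≠ 0 := mem_polarVariables.1 (List.getElem_mem hi')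
      set S := ((polarVariables d).take i).toFinset with hS
      have hS0 : ∀ t ∈ S, t.2 ≠ 0 := fun t ht =>
        mem_polarVariables.1 (List.mem_of_mem_take (List.mem_toFinset.1 ht))
      -- The list has no repetitions, so the i-th difference is not affected by collapsing the
      -- earlier variables.
      have hsS : (polarVariables d)[i] ∉ S := by
        rw [hS, List.mem_toFinset]
        intro h
        obtain ⟨j, hj, hj'⟩ := List.mem_take_iff_getElem.1 h
        have := (nodup_polarVariables d).getElem_inj_iff.1 hj'
        omega
      rw [← List.map_take, ofList_map_sub, ← hS] at hx ⊢
      rw [List.getElem_map] at hx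
      have hx' := mk_mem_smul_top_iff.1 hx
      simp only [smul_eq_mul] at hx'
      rw [mem_sup_collapseIdeal_iff hS0, map_mul, map_sub, rename_X, rename_X] at hx'
      rw [mk_mem_smul_top_iff, mem_sup_collapseIdeal_iff hS0]
      refine H.mem_collapsedIdeal_of_mul_mem hs ?_
      rwa [collapse, collapse, if_neg hsS, if_neg fun h => hS0 _ h rfl] at hx'
    · intro h
      -- The quotient is not zero: as d > 0, neither the generators nor the differences have a
      -- constant term.
      have h1 : Ideal.Quotient.mk (polarizedIdeal k τ) 1 ∈ (⊤ : Submodule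
        (MvPolynomial ((_ : Fin 3) × Fin d) k) (_ ⧸ polarizedIdeal k τ)) := trivial
      rw [h, mk_mem_smul_top_iff, ofList_map_sub] at h1
      have h2 : polarizedIdeal k τ ⊔ collapseIdeal k (polarVariables d).toFinset ≤
          RingHom.ker (constantCoeff : MvPolynomial ((_ : Fin 3) × Fin d) k →+* k) := by
        refine sup_le (Ideal.span_le.2 ?_) (Ideal.span_le.2 ?_)
        · rintro _ ⟨p, hp, rfl⟩
          rw [SetLike.mem_coe, RingHom.mem_ker, constantCoeff_monomial, if_neg]
          obtain ⟨v, rfl⟩ := (H.vertex_range _).2 hp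
          intro h0
          have h3 := H.mapDomain_label v.2.1
          rw [PolyhedralComplex.label_cell_zero, PolyhedralComplex.label_cell_zero, h0,
            Finsupp.mapDomain_zero] at h3
          rw [← h3, map_zero] at hp
          exact NeZero.ne d hp.symm
        · rintro _ ⟨t, -, rfl⟩
          simp [RingHom.mem_ker]
      have := h2 h1
      rw [RingHom.mem_ker, map_one] at this
      exact one_ne_zero this
  surj := by
    have hsurj : Function.Surjective (depolarize k (fun _ : Fin 3 => d)) :=
      rename_surjective _ fun v => ⟨⟨v, 0⟩, rfl⟩
    have h1 : (polarizedIdeal k τ).map (depolarize k (fun _ : Fin 3 => d)) =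
        Ideal.span (Set.range (MvPolynomial.X : Fin 3 → MvPolynomial (Fin 3) k)) ^ d := by
      refine Eq.trans ?_ (pow_idealOfVars_eq_span d).symm
      rw [polarizedIdeal, Ideal.map_span]
      congr 1
      have h2 : ∀ p : Fin 3 →₀ ℕ, p.degree = d → depolarize k (fun _ : Fin 3 => d)
          (monomial (polarizedExponent τ p) 1) = monomial p 1 := by
        intro p hp
        obtain ⟨v, rfl⟩ := (H.vertex_range _).2 hp
        have h3 := H.mapDomain_label v.2.1
        rw [PolyhedralComplex.label_cell_zero, PolyhedralComplex.label_cell_zero] at h3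
        rw [depolarize, rename_monomial, h3]
      ext f
      constructor
      · rintro ⟨_, ⟨p, hp, rfl⟩, rfl⟩
        exact ⟨p, hp, (h2 p hp).symm⟩
      · rintro ⟨p, hp, rfl⟩
        exact ⟨_, ⟨p, hp, rfl⟩, h2 p hp⟩
    rw [← h1]
    ext f
    exact (Ideal.mem_map_iff_of_surjective _ hsurj).symm
  inj f hf hf0 := by
    rw [polarizationSequence_eq, ofList_map_sub]
    set S := (polarVariables d).toFinset with hS
    have hS0 : ∀ t ∈ S, t.2 ≠ 0 := fun t ht => mem_polarVariables.1 (List.mem_toFinset.1 ht)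
    obtain ⟨ε⟩ := H.nonempty_incidence
    -- Collapsing all variables is depolarization followed by an embedding, so f collapses to zero
    -- and its coefficients may be taken in the ideal of the differences.
    have hc : collapse S = (fun v : Fin 3 => (⟨v, 0⟩ : (_ : Fin 3) × Fin d)) ∘ Sigma.fst := by
      funext t
      simp only [collapse, Function.comp]
      split_ifs with h
      · rfl
      · rw [hS, List.mem_toFinset, mem_polarVariables, not_not] at h
        rw [← h]
    have h0 : rename (collapse S) f = 0 := by
      rw [hc, ← rename_rename]
      exact (congrArg _ hf0).trans (map_zero _)
    have hJ : polarizedIdeal k τ = Ideal.span (Set.range fun v : X.Cell 0 =>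
        monomial (X.label (fun v => polarizedExponent τ (a v)) v.1) 1) := by
      rw [← (H.isMinimalResolution_polarized (k := k) ε).range_augmentation,
        PolyhedralComplex.range_augmentation_eq]
      simp only [PolyhedralComplex.label_cell_zero]
    obtain ⟨w, rfl, h2⟩ := PolyhedralComplex.CellExact.exists_of_rename_eq_zero
      PolyhedralComplex.label_mono (collapse_comp_self hS0)
      (H.cellExact_collapse (k := k) ε S) (hJ ▸ hf) h0
    refine Ideal.sum_mem _ fun v _ => Ideal.mul_mem_mul
      ((rename_collapse_eq_zero_iff hS0).1 (h2 v)) ?_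
    rw [hJ]
    exact Ideal.subset_span ⟨v, rfl⟩

end IsDelta

end Polarizations

/-! ### The converse: consequences of minimality, and the vertices -/

namespace PolyhedralComplex

variable {N : ℕ} {X : PolyhedralComplex N} {σ : Type*} {k : Type*} [Field k]

/-- Every positive-dimensional cell containing a smaller face has a facet around that face. -/
theorem exists_facet_cell {i j : ℕ} (G : X.Cell j) (F : X.Cell (i + 1)) (h : G.1 ⊆ F.1)
    (hne : G.1 ≠ F.1) : ∃ F' : X.Cell i, G.1 ⊆ F'.1 ∧ F'.1 ⊆ F.1 := by
  obtain ⟨P, h1, h2, h3, -, h4⟩ := X.exists_facet_of_subset G.2.1 F.2.1 h G.2.2.1 hne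
  rw [F.2.2.2] at h4
  exact ⟨⟨P, h1, G.2.2.1.mono h2, by omega⟩, h2, h3⟩

theorem exists_facet_cell_of_vertex {i : ℕ} (v : X.Cell 0) (F : X.Cell (i + 1)) (h : v.1 ⊆ F.1) :
    ∃ F' : X.Cell i, v.1 ⊆ F'.1 ∧ F'.1 ⊆ F.1 := by
  refine exists_facet_cell v F h fun hcon => ?_
  have h1 := v.2.2.2
  rw [hcon, F.2.2.2] at h1
  exact Nat.succ_ne_zero i h1

theorem exists_vertex {i : ℕ} (F : X.Cell i) : ∃ v : X.Cell 0, v.1 ⊆ F.1 :=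
  verts_nonempty F.2.1 F.2.2.1

theorem le_label {a : X.Cell 0 → σ →₀ ℕ} {P : Set (EuclideanSpace ℝ (Fin N))} {v : X.Cell 0}
    (h : v.1 ⊆ P) : a v ≤ X.label a P :=
  label_le_iff.1 le_rfl _ ⟨v, h, rfl⟩

/-- The augmented cellular complex is exact and no facet has the label of its cell. -/
structure MinimalExact (k : Type*) [Field k] (a : X.Cell 0 → σ →₀ ℕ) (ε : X.Incidence) :
    Prop where
  exact : X.CellExact k ε fun _ F => X.label a F.1
  strict : ∀ {i : ℕ} (G : X.Cell i) (F : X.Cell (i + 1)), G.1 ⊆ F.1 →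
    X.label a G.1 ≠ X.label a F.1

namespace MinimalExact

variable {a : X.Cell 0 → σ →₀ ℕ} {ε : X.Incidence} (M : X.MinimalExact k a ε)
include M

/-- The difference of v and v' bounds a chain of edges below m, and some edge of this chain has to
contain v. -/
theorem exists_edge {v v' : X.Cell 0} (hne : v ≠ v') {m : σ →₀ ℕ} (hv : a v ≤ m)
    (hv' : a v' ≤ m) : ∃ e : X.Cell 1, v.1 ⊆ e.1 ∧ X.label a e.1 ≤ m := by
  classical
  obtain ⟨u, hu, huz⟩ := M.exact.graded_zero label_mono m
    (Pi.single v 1 - Pi.single v' 1) (fun x hx => by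
      rw [label_cell_zero]
      by_cases h1 : x = v
      · rwa [h1]
      · by_cases h2 : x = v'
        · rwa [h2]
        · simp [h1, h2] at hx) (by simp)
  have h := huz v
  rw [Pi.sub_apply, Pi.single_eq_same, Pi.single_eq_of_ne hne, sub_zero] at h
  obtain ⟨e, -, he⟩ := Finset.exists_ne_zero_of_sum_ne_zero (h ▸ one_ne_zero)
  exact ⟨e, subset_of_sign_ne_zero ε (left_ne_zero_of_mul he), hu e (right_ne_zero_of_mul he)⟩

/-- Otherwise some edge at v' would have a label dividing that of v', hence equal to it, against
minimality. -/
theorem eq_of_le {v v' : X.Cell 0} (h : a v ≤ a v') : v = v' := by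
  by_contra hne
  obtain ⟨e, h1, h2⟩ := M.exists_edge (Ne.symm hne) le_rfl h
  refine M.strict v' e h1 ?_
  rw [label_cell_zero]
  exact le_antisymm (le_label h1) h2

/-- The cycle bounds a chain with labels at most that of F. If F occurred in it, a cell of that
chain having F as a facet would have the label of F. -/
theorem eq_zero_of_cycle {i : ℕ} {z : X.Cell (i + 1) → k} {F : X.Cell (i + 1)}
    (hz : ∀ G, z G ≠ 0 → X.label a G.1 ≤ X.label a F.1)
    (hz' : ∀ v : X.Cell i, ∑ e, (ε.sign v e : k) * z e = 0) : z F = 0 := by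
  obtain ⟨u, hu, huz⟩ := M.exact.graded_succ label_mono _ z hz hz'
  by_contra hF
  rw [huz] at hF
  obtain ⟨G, -, hG⟩ := Finset.exists_ne_zero_of_sum_ne_zero hF
  have hFG := subset_of_sign_ne_zero ε (left_ne_zero_of_mul hG)
  exact M.strict F G hFG (le_antisymm (label_mono _ _ _ hFG) (hu G (right_ne_zero_of_mul hG)))

end MinimalExact

theorem IsMinimalResolution.minimalExact {a : X.Cell 0 → σ →₀ ℕ} {ε : X.Incidence}
    {I : Ideal (MvPolynomial σ k)} (h : X.IsMinimalResolution a k ε I) : X.MinimalExact k a ε where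
  exact := cellExact_iff.2 ⟨h.exact_zero, h.exact_succ⟩
  strict G F hGF := label_ne_of_boundary_mem (fun w G => h.minimal _ w G) G F hGF

/-- All labels have degree at least d, and a label dividing a given monomial of degree d must equal
it. A label of larger degree would be a proper multiple of one of degree d, against `eq_of_le`. -/
theorem IsMinimalResolution.vertex_range {d : ℕ} {a : X.Cell 0 → (Fin 3 →₀ ℕ)} {ε : X.Incidence}
    (h : X.IsMinimalResolution a k ε
      (Ideal.span (Set.range (MvPolynomial.X : Fin 3 → MvPolynomial (Fin 3) k)) ^ d))
    (x : Fin 3 →₀ ℕ) : (∃ v, a v = x) ↔ x.degree = d := by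
  have hr := h.range_augmentation
  rw [range_augmentation_eq] at hr
  have h1 : ∀ v, d ≤ (a v).degree := fun v => by
    refine (monomial_mem_pow_idealOfVars_iff d (a v) (one_ne_zero (α := k))).1 ?_
    refine hr.le ?_
    exact Ideal.subset_span ⟨v, rfl⟩
  have h2 : ∀ x : Fin 3 →₀ ℕ, x.degree = d → ∃ v, a v = x := by
    intro x hx
    have h3 := hr.ge ((monomial_mem_pow_idealOfVars_iff d x (one_ne_zero (α := k))).2 hx.ge)
    have h4 : (Set.range fun v => monomial (a v) (1 : k)) =
        (fun s => monomial s (1 : k)) '' Set.range a := by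
      rw [← Set.range_comp]
      rfl
    rw [h4, mem_ideal_span_monomial_image] at h3
    obtain ⟨_, ⟨v, rfl⟩, hv⟩ := h3 x (by simp)
    refine ⟨v, ?_⟩
    obtain ⟨δ, rfl⟩ := exists_add_of_le hv
    have h5 := h1 v
    rw [map_add] at hx
    have : δ = 0 := (Finsupp.degree_eq_zero_iff δ).1 (by omega)
    rw [this, add_zero]
  refine ⟨?_, h2 x⟩
  rintro ⟨v, rfl⟩
  have h3 : ∃ p : Fin 3 →₀ ℕ, p ≤ a v ∧ p.degree = d := by
    have := h1 v
    rw [degree_fin_three] at this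
    -- A divisor of degree d, chosen greedily: as much x as possible, then y, then z.
    refine ⟨Finsupp.equivFunOnFinite.symm ![min (a v 0) d, min (a v 1) (d - min (a v 0) d),
      d - min (a v 0) d - min (a v 1) (d - min (a v 0) d)], ?_, ?_⟩
    · simp [finsupp_fin_three_le]
      omega
    · simp [degree_fin_three]
  obtain ⟨p, hp, hd⟩ := h3
  obtain ⟨v', rfl⟩ := h2 p hd
  rw [← h.minimalExact.eq_of_le hp, hd]

end PolyhedralComplex

/-! ### The converse: edges are edges of Γ -/

section Exchange

variable {d : ℕ}

theorem degree_edgeLabel (x : (Fin 3 →₀ ℕ) × Fin 3) : (edgeLabel x).degree = x.1.degree + 2 := by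
  simp only [edgeLabel, map_add, Finsupp.degree_single]

theorem degree_regionLabel (q : Fin 3 →₀ ℕ) : (regionLabel q).degree = q.degree + 3 := by
  simp only [regionLabel, map_add, Finsupp.degree_single]

theorem eq_of_le_of_degree_le {p q : Fin 3 →₀ ℕ} (h : p ≤ q) (hd : q.degree ≤ p.degree) :
    p = q := by
  simp only [finsupp_fin_three_le, finsupp_fin_three_ext, degree_fin_three] at *
  omega

/-- Two monomials of the same degree differ by exchanging variables. -/
theorem exists_exchange {p p' : Fin 3 →₀ ℕ} (hd : p.degree = p'.degree) (hne : p ≠ p') :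
    ∃ (q : Fin 3 →₀ ℕ) (i j : Fin 3), i ≠ j ∧ p = q + 𝐞 i ∧ q + 𝐞 i + 𝐞 j ≤ p ⊔ p' ∧
      (q + 𝐞 j) j ≤ p' j ∧ p' i < p i ∧ p j < p' j := by
  obtain ⟨i, hi⟩ : ∃ i, p' i < p i := by
    by_contra! h
    exact hne (eq_of_le_of_degree_le h hd.ge)
  obtain ⟨j, hj⟩ : ∃ j, p j < p' j := by
    by_contra! h
    exact hne (eq_of_le_of_degree_le h hd.le).symm
  have hij : i ≠ j := by
    rintro rfl
    omega
  have hpi : p = (p - 𝐞 i) + 𝐞 i := by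
    rw [tsub_add_cancel_of_le]
    exact Finsupp.single_le_iff.2 (by omega)
  refine ⟨p - 𝐞 i, i, j, hij, hpi, ?_, ?_, hi, hj⟩
  · rw [← hpi]
    intro l
    simp only [Finsupp.add_apply, Finsupp.sup_apply, Finsupp.single_apply]
    split_ifs with h
    · subst h
      omega
    · omega
  · simp [hij.symm]
    omega

/-- Two monomials of degree `d` whose least common multiple has degree `d + 1` span an edge. -/
theorem exists_pair_eq_edgeSet {p p' : Fin 3 →₀ ℕ} (hp : p.degree = d) (hp' : p'.degree = d)
    (hne : p ≠ p') (h : (p ⊔ p').degree = d + 1) : ∃ (q : Fin 3 →₀ ℕ) (w : Fin 3),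
      q.degree + 1 = d ∧ {p, p'} = edgeSet q w := by
  obtain ⟨q, i, j, hij, rfl, h1, -, h5, h2⟩ := exists_exchange (hp.trans hp'.symm) hne
  have h3 : p' ≤ q + 𝐞 i + 𝐞 j := by
    have h4 := eq_of_le_of_degree_le h1 (by
      rw [h, map_add, hp, Finsupp.degree_single])
    rw [h4]
    exact le_sup_right
  have h4 : p' = q + 𝐞 j := by
    rw [map_add, Finsupp.degree_single] at hp
    clear h h1 hne
    simp only [finsupp_fin_three_le, finsupp_fin_three_ext, degree_fin_three, Finsupp.add_apply,
      Finsupp.single_apply] at hp hp' h2 h3 h5 ⊢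
    fin_cases i <;> fin_cases j <;> simp at hij h2 h3 h5 ⊢ <;> omega
  refine ⟨q, -(i + j), by rwa [map_add, Finsupp.degree_single] at hp, ?_⟩
  rw [h4, edgeSet]
  clear h4 h3 h2 h1 h5 h hp hp' hne
  fin_cases i <;> fin_cases j <;> first | exact absurd rfl hij | rfl | exact Set.pair_comm _ _

end Exchange

namespace PolyhedralComplex

namespace MinimalExact

variable {N : ℕ} {X : PolyhedralComplex N} {k : Type*} [Field k] {d : ℕ}
  {a : X.Cell 0 → (Fin 3 →₀ ℕ)} {ε : X.Incidence} (M : X.MinimalExact k a ε)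
  (hr : ∀ x : Fin 3 →₀ ℕ, (∃ v, a v = x) ↔ x.degree = d)
include M

theorem label_injective : Function.Injective a := fun _ _ h => M.eq_of_le h.le

include hr

/-- Vertices with labels dividing `m` are connected by edges whose labels divide `m` properly, if
the degree of `m` is large. -/
theorem exists_path {m : Fin 3 →₀ ℕ} (hm : d + 1 < m.degree) (x x' : X.Cell 0) (hx : a x ≤ m)
    (hx' : a x' ≤ m) [DecidableEq (X.Cell 0)] : ∃ y : X.Cell 1 → k,
      (∀ e, y e ≠ 0 → X.label a e.1 ≤ m ∧ X.label a e.1 ≠ m) ∧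
      ∀ v, (Pi.single x 1 - Pi.single x' 1 : X.Cell 0 → k) v = ∑ e, (ε.sign v e : k) * y e := by
  induction hn : (a x' - a x).degree using Nat.strong_induction_on generalizing x with
  | _ n ih =>
    by_cases hxx : x = x'
    · exact ⟨0, fun e h => absurd rfl h, fun v => by simp [hxx]⟩
    have hdx := (hr _).1 ⟨x, rfl⟩
    have hdx' := (hr _).1 ⟨x', rfl⟩
    -- One exchange brings x closer to x'. The edges that realize it have labels dividing q x_i x_j,
    -- of degree d + 1, so they stay properly below m.
    obtain ⟨q, i, j, hij, h1, h2, h3, h4, h5⟩ := exists_exchange (hdx.trans hdx'.symm)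
      fun h => hxx (M.label_injective h)
    obtain ⟨x1, hx1⟩ := (hr (q + 𝐞 j)).2 (by
      rw [← hdx, h1, map_add, map_add, Finsupp.degree_single, Finsupp.degree_single])
    have h6 : q + 𝐞 i + 𝐞 j ≤ m := h2.trans (sup_le hx hx')
    have h7 : a x1 ≤ q + 𝐞 i + 𝐞 j := by
      rw [hx1, add_right_comm]
      exact le_self_add
    have h8 : a x ≤ q + 𝐞 i + 𝐞 j := by
      rw [h1]
      exact le_self_add
    have h9 : (q + 𝐞 i + 𝐞 j).degree = d + 1 := by
      rw [map_add, ← h1, hdx, Finsupp.degree_single]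
    obtain ⟨y1, hy1, hy1'⟩ := M.exact.graded_zero label_mono (q + 𝐞 i + 𝐞 j)
      (Pi.single x 1 - Pi.single x1 1) (fun v hv => by
        rw [label_cell_zero]
        by_cases g1 : v = x
        · rwa [g1]
        · by_cases g2 : v = x1
          · rwa [g2]
          · simp [g1, g2] at hv) (by simp)
    obtain ⟨y2, hy2, hy2'⟩ := ih (a x' - a x1).degree (by
      rw [← hn, hx1, h1]
      rw [hx1] at *
      rw [h1] at h4 h5
      clear h2 h6 h7 h8 h9 hy1 hy1' hn ih hx hx' hx1
      simp only [degree_fin_three, Finsupp.tsub_apply, Finsupp.add_apply,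
        Finsupp.single_apply] at h3 h4 h5 ⊢
      fin_cases i <;> fin_cases j <;> simp at hij h3 h4 h5 ⊢ <;> omega) x1 (h7.trans h6) rfl
    refine ⟨y1 + y2, fun e he => ?_, fun v => ?_⟩
    · by_cases g : y1 e = 0
      · refine hy2 e ?_
        simpa [g] using he
      · refine ⟨(hy1 e g).trans h6, fun hcon => ?_⟩
        have g1 := Finsupp.degree_mono (hy1 e g)
        rw [hcon, h9] at g1
        omega
    · simp only [Pi.add_apply, mul_add, Finset.sum_add_distrib]
      rw [← hy1', ← hy2']
      simp

/-- An edge with label of larger degree could be replaced by a path of edges with properly smaller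
labels. Edge and path together form a cycle with coefficient 1 at the edge, against
`eq_zero_of_cycle`. -/
theorem degree_label_edge (e : X.Cell 1) : (X.label a e.1).degree = d + 1 := by
  classical
  obtain ⟨u, v, huv, he⟩ := exists_verts_eq_pair e
  have hu : u.1 ⊆ e.1 := by
    change u ∈ X.verts e.1
    simp [he]
  have hv : v.1 ⊆ e.1 := by
    change v ∈ X.verts e.1
    simp [he]
  refine le_antisymm ?_ ?_
  · by_contra! hlt
    obtain ⟨y, hy, hy'⟩ := M.exists_path hr hlt u v (le_label hu) (le_label hv)
    have hsum : (ε.sign u e : k) + ε.sign v e = 0 := by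
      rw [← sum_sign_vertices (k := k) ε e]
      symm
      refine Finset.sum_eq_add u v huv (fun x _ hx => ?_)
        (fun h => absurd (Finset.mem_univ _) h) fun h => absurd (Finset.mem_univ _) h
      rw [ε.sign_of_not_facet, Int.cast_zero]
      intro hxe
      have : x ∈ X.verts e.1 := hxe
      simp [he, hx.1, hx.2] at this
    -- The signs of the two ends of e are opposite, so multiplying the path by the sign of u gives
    -- it the same boundary as e.
    have hz := M.eq_zero_of_cycle (F := e) (z := Pi.single e 1 - (ε.sign u e : k) • y) (by
      intro G hG
      by_cases hGe : G = e
      · rw [hGe]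
      · refine (hy G fun h0 => ?_).1
        simp [hGe, h0] at hG) (by
      intro x
      have h1 : ∑ G : X.Cell 1, (ε.sign x G : k) *
          (Pi.single e 1 - (ε.sign u e : k) • y : X.Cell 1 → k) G =
          ε.sign x e - ε.sign u e * ∑ G, (ε.sign x G : k) * y G := by
        simp only [Pi.sub_apply, Pi.smul_apply, smul_eq_mul, mul_sub, Finset.sum_sub_distrib,
          Finset.mul_sum, Pi.single_apply, mul_ite, mul_one, mul_zero, Finset.sum_ite_eq',
          Finset.mem_univ, if_true]
        congr 1
        exact Finset.sum_congr rfl fun G _ => by ring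
      change ∑ G : X.Cell 1, _ = _
      rw [h1, ← hy']
      by_cases hxu : x = u
      · subst hxu
        simp [huv]
      · by_cases hxv : x = v
        · subst hxv
          simp only [Pi.sub_apply, Pi.single_eq_same, Pi.single_eq_of_ne hxu]
          linear_combination hsum
        · rw [ε.sign_of_not_facet x e fun h => by
            have : x ∈ X.verts e.1 := h
            simp [he, hxu, hxv] at this]
          simp [hxu, hxv])
    have h0 : y e = 0 := by
      by_contra h
      exact (hy e h).2 rfl
    simp [h0] at hz
  · have h1 := Finsupp.degree_mono (le_label (a := a) hu)
    rw [(hr _).1 ⟨u, rfl⟩] at h1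
    refine h1.lt_of_ne fun h2 => M.strict u e hu ?_
    rw [label_cell_zero]
    exact eq_of_le_of_degree_le (le_label hu) (by rw [← h2, (hr _).1 ⟨u, rfl⟩])

theorem exists_image_eq_edgeSet (e : X.Cell 1) : ∃ x : (Fin 3 →₀ ℕ) × Fin 3, x.1.degree + 1 = d ∧
    a '' X.verts e.1 = edgeSet x.1 x.2 := by
  obtain ⟨u, v, huv, he⟩ := exists_verts_eq_pair e
  have h1 : a u ⊔ a v = X.label a e.1 := by
    refine le_antisymm (sup_le ?_ ?_) (label_le_iff.2 ?_)
    · exact le_label (show u ∈ X.verts e.1 by simp [he])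
    · exact le_label (show v ∈ X.verts e.1 by simp [he])
    · rw [he, Set.image_pair]
      rintro p (rfl | rfl)
      · exact le_sup_left
      · exact le_sup_right
  obtain ⟨q, w, h2, h3⟩ := exists_pair_eq_edgeSet ((hr _).1 ⟨u, rfl⟩) ((hr _).1 ⟨v, rfl⟩)
    (fun h => huv (M.label_injective h)) (h1 ▸ M.degree_label_edge hr e)
  exact ⟨(q, w), h2, by rw [he, Set.image_pair, h3]⟩

end MinimalExact

end PolyhedralComplex

/-! ### The converse: which edges of Γ occur -/

section Exchange

variable {d : ℕ}

/-- This concerns edges in no down triangle: the label omits x_{w'}, which an edge opposite to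
another variable would involve. -/
theorem eq_of_edgeLabel_eq {q q' : Fin 3 →₀ ℕ} {w w' : Fin 3}
    (h : edgeLabel (q, w) = edgeLabel (q', w')) (h0 : q' w' = 0) : (q, w) = (q', w') := by
  simp only [edgeLabel, finsupp_fin_three_ext, Finsupp.add_apply, Finsupp.single_apply,
    Prod.mk.injEq] at *
  fin_cases w <;> fin_cases w' <;> simp at h h0 ⊢ <;> omega

theorem eq_of_edgeLabel_eq_regionLabel {q n : Fin 3 →₀ ℕ} {w : Fin 3}
    (h : edgeLabel (q, w) = regionLabel n) : q = n + 𝐞 w := by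
  rw [← edgeLabel_add_single n w] at h
  simp only [edgeLabel] at h
  exact add_right_cancel (add_right_cancel h)

end Exchange

namespace PolyhedralComplex

namespace MinimalExact

variable {N : ℕ} {X : PolyhedralComplex N} {k : Type*} [Field k] {d : ℕ}
  {a : X.Cell 0 → (Fin 3 →₀ ℕ)} {ε : X.Incidence} (M : X.MinimalExact k a ε)
  (hr : ∀ x : Fin 3 →₀ ℕ, (∃ v, a v = x) ↔ x.degree = d)
include M hr

/-- The edge of `Γ` given by a `1`-cell. -/
noncomputable def edge (e : X.Cell 1) : (Fin 3 →₀ ℕ) × Fin 3 :=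
  (M.exists_image_eq_edgeSet hr e).choose

theorem degree_edge (e : X.Cell 1) : (M.edge hr e).1.degree + 1 = d :=
  (M.exists_image_eq_edgeSet hr e).choose_spec.1

theorem image_edge (e : X.Cell 1) :
    a '' X.verts e.1 = edgeSet (M.edge hr e).1 (M.edge hr e).2 :=
  (M.exists_image_eq_edgeSet hr e).choose_spec.2

theorem label_edge (e : X.Cell 1) : X.label a e.1 = edgeLabel (M.edge hr e) :=
  label_eq_edgeLabel (M.image_edge hr e)

theorem edge_injective : Function.Injective (M.edge hr) := fun e e' h =>
  Subtype.ext (eq_of_verts_eq e.2.1 e'.2.1 (M.label_injective.image_injective (by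
    rw [M.image_edge hr, M.image_edge hr, h])))

theorem subset_edge_iff (v : X.Cell 0) (e : X.Cell 1) :
    v.1 ⊆ e.1 ↔ a v ∈ edgeSet (M.edge hr e).1 (M.edge hr e).2 := by
  rw [← M.image_edge hr, M.label_injective.mem_set_image]
  rfl

/-- The incidences of an edge with its two ends sum to zero, so up to one unit per edge they are the
standard ones. -/
theorem exists_orientation : ∃ η : X.Cell 1 → ℤ, (∀ e, η e = 1 ∨ η e = -1) ∧
    ∀ v e, ε.sign v e = η e * stdSign1 (a v) (M.edge hr e) := by
  suffices h : ∀ e, ∃ η : ℤ, (η = 1 ∨ η = -1) ∧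
      ∀ v, ε.sign v e = η * stdSign1 (a v) (M.edge hr e) by
    choose η h1 h2 using h
    exact ⟨η, h1, fun v e => h2 e v⟩
  intro e
  have hd := M.degree_edge hr e
  set x := M.edge hr e with hx
  have hne := add_single_ne_add_single x.1 ((by decide : ∀ w : Fin 3, w + 1 ≠ w + 2) x.2)
  obtain ⟨u, hu⟩ := (hr (x.1 + 𝐞 (x.2 + 2))).2 (by rw [map_add, Finsupp.degree_single, hd])
  obtain ⟨v, hv⟩ := (hr (x.1 + 𝐞 (x.2 + 1))).2 (by rw [map_add, Finsupp.degree_single, hd])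
  have huv : u ≠ v := by
    rintro rfl
    exact hne (hv.symm.trans hu)
  have hue : u.1 ⊆ e.1 := (M.subset_edge_iff hr u e).2 (by rw [hu]; exact Or.inr rfl)
  have h0 : ∀ y, y ≠ u ∧ y ≠ v → ε.sign y e = 0 := fun y hy => by
    refine ε.sign_of_not_facet y e fun h => ?_
    rcases (M.subset_edge_iff hr y e).1 h with h | h
    · exact hy.2 (M.label_injective (h.trans hv.symm))
    · exact hy.1 (M.label_injective ((Set.mem_singleton_iff.1 h).trans hu.symm))
  have hsum : ε.sign u e + ε.sign v e = 0 := by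
    rw [← ε.sum_vertices e]
    symm
    exact Finset.sum_eq_add u v huv (fun y _ hy => h0 y hy)
      (fun h => absurd (Finset.mem_univ _) h) fun h => absurd (Finset.mem_univ _) h
  refine ⟨ε.sign u e, ε.sign_facet u e hue, fun y => ?_⟩
  by_cases hyu : y = u
  · rw [hyu, stdSign1, if_pos hu, if_neg (by rw [hu]; exact hne.symm), sub_zero, mul_one]
  by_cases hyv : y = v
  · rw [hyv, stdSign1, if_pos hv, if_neg (by rw [hv]; exact hne)]
    linarith
  · rw [h0 y ⟨hyu, hyv⟩, stdSign1, if_neg, if_neg, sub_zero, mul_zero]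
    · exact fun h => hyv (M.label_injective (h.trans hv.symm))
    · exact fun h => hyu (M.label_injective (h.trans hu.symm))

theorem exists_edge_of_ne {p p' m : Fin 3 →₀ ℕ} (hp : p.degree = d) (hp' : p'.degree = d)
    (hne : p ≠ p') (hm : m.degree = d + 1) (hpm : p ≤ m) (hpm' : p' ≤ m) :
    ∃ e, p ∈ edgeSet (M.edge hr e).1 (M.edge hr e).2 ∧ edgeLabel (M.edge hr e) = m := by
  obtain ⟨v, rfl⟩ := (hr p).2 hp
  obtain ⟨v', rfl⟩ := (hr p').2 hp'
  obtain ⟨e, h1, h2⟩ := M.exists_edge (fun h => hne (congrArg a h)) hpm hpm'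
  refine ⟨e, (M.subset_edge_iff hr v e).1 h1, ?_⟩
  rw [← M.label_edge hr]
  exact eq_of_le_of_degree_le h2 (by rw [hm, M.degree_label_edge hr])

theorem exists_edge_eq {q : Fin 3 →₀ ℕ} {w : Fin 3} (hq : q.degree + 1 = d) (h0 : q w = 0) :
    ∃ e, M.edge hr e = (q, w) := by
  have hd : ∀ i, (q + 𝐞 i).degree = d := fun i => by rw [map_add, Finsupp.degree_single, hq]
  obtain ⟨e, -, he⟩ := M.exists_edge_of_ne hr (hd (w + 1)) (hd (w + 2))
    (add_single_ne_add_single q ((by decide : ∀ w : Fin 3, w + 1 ≠ w + 2) w))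
    (m := edgeLabel (q, w)) (by rw [degree_edgeLabel, ← hq])
    (le_edgeLabel_of_mem (Or.inl rfl)) (le_edgeLabel_of_mem (Or.inr rfl))
  exact ⟨e, eq_of_edgeLabel_eq he h0⟩

/-- The vertex of n off the edge of direction w must lie on an edge with label nxyz, which is one of
the two other edges of n. Applied to all w, this shows that at least two edges of n are present. -/
theorem exists_edge_eq_add_single (n : DownTriangle d) (w : Fin 3) :
    ∃ w' e, w' ≠ w ∧ M.edge hr e = (n.1 + 𝐞 w', w') := by
  have h1 : ∀ i, n.1 + 𝐞 (i + 1) + 𝐞 (i + 2) ≤ regionLabel n.1 := fun i => by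
    have h : regionLabel n.1 = n.1 + 𝐞 (i + 1) + 𝐞 (i + 2) + 𝐞 i := by
      rw [regionLabel_eq n.1 i]
      abel
    rw [h]
    exact le_self_add
  have h2 : ∀ i, (n.1 + 𝐞 (i + 1) + 𝐞 (i + 2)).degree = d := fun i => by
    rw [map_add, Finsupp.degree_single, n.degree_add_single]
  obtain ⟨e, h3, h4⟩ := M.exists_edge_of_ne hr (h2 w) (h2 (w + 1)) (fun h => by
    rw [(by decide : ∀ w : Fin 3, w + 1 + 1 = w + 2) w, (by decide : ∀ w : Fin 3, w + 1 + 2 = w) w,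
      add_right_comm] at h
    exact (by decide : ∀ w : Fin 3, w + 1 ≠ w) w
      ((Finsupp.single_left_inj one_ne_zero).1 (add_left_cancel h)))
    (m := regionLabel n.1) (by
      rw [degree_regionLabel]
      have := n.2
      omega) (h1 _) (h1 _)
  have h5 := eq_of_edgeLabel_eq_regionLabel (show edgeLabel ((M.edge hr e).1, (M.edge hr e).2) =
    regionLabel n.1 from h4)
  refine ⟨(M.edge hr e).2, e, ?_, Prod.ext h5 rfl⟩
  intro h6
  rw [h5, h6] at h3
  simp only [edgeSet, Set.mem_insert_iff, Set.mem_singleton_iff, finsupp_fin_three_ext,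
    Finsupp.add_apply, Finsupp.single_apply] at h3
  clear h1 h2 h4 h5 h6
  fin_cases w <;> simp at h3

/-- If all three edges were present, the cycle around n, with unit coefficients and all labels equal
to nxyz, would contradict `eq_zero_of_cycle`. -/
theorem exists_edge_ne (n : DownTriangle d) : ∃ w, ∀ e, M.edge hr e ≠ (n.1 + 𝐞 w, w) := by
  classical
  by_contra! hcon
  choose E hE using hcon
  obtain ⟨η, h1, h2⟩ := M.exists_orientation hr
  have hinj : ∀ w, E w = E 0 → w = 0 := fun w h => by
    have := hE w
    rw [h, hE 0] at this
    exact (congrArg Prod.snd this).symm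
  have hz := M.eq_zero_of_cycle (F := E 0)
    (z := fun e => ∑ w, if e = E w then (η (E w) : k) else 0) (by
      intro G hG
      obtain ⟨w, -, hw⟩ := Finset.exists_ne_zero_of_sum_ne_zero hG
      have : G = E w := by
        by_contra h
        simp [h] at hw
      rw [this, M.label_edge hr, M.label_edge hr, hE, hE, edgeLabel_add_single,
        edgeLabel_add_single]) (by
      intro v
      change ∑ e : X.Cell 1, (ε.sign v e : k) * _ = 0
      have h3 : ∀ e : X.Cell 1, (ε.sign v e : k) * ∑ w, (if e = E w then (η (E w) : k) else 0) =
          ∑ w, if e = E w then (stdSign1 (a v) (n.1 + 𝐞 w, w) : k) else 0 := by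
        intro e
        rw [Finset.mul_sum]
        refine Finset.sum_congr rfl fun w _ => ?_
        split_ifs with h
        · rw [h, h2, hE]
          rcases h1 (E w) with h | h <;> simp [h]
        · rw [mul_zero]
      simp only [h3]
      rw [Finset.sum_comm]
      simp only [Finset.sum_ite_eq', Finset.mem_univ, if_true]
      rw [← Int.cast_sum, sum_stdSign1_down, Int.cast_zero])
  change ∑ w, (if E 0 = E w then (η (E w) : k) else 0) = 0 at hz
  rw [Finset.sum_eq_single 0 (fun w _ hw => if_neg fun h => hw (hinj w h.symm))
    (fun h => absurd (Finset.mem_univ _) h), if_pos rfl] at hz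
  rcases h1 (E 0) with h | h <;> simp [h] at hz

/-- Each down triangle has exactly one edge that is not a cell. -/
theorem exists_edge_range : ∃ τ : DownTriangle d → Fin 3, ∀ q w,
    (∃ e, M.edge hr e = (q, w)) ↔ q.degree + 1 = d ∧ ¬ IsRemoved τ q w := by
  choose τ hτ using M.exists_edge_ne hr
  refine ⟨τ, fun q w => ⟨?_, ?_⟩⟩
  · rintro ⟨e, he⟩
    refine ⟨by have := M.degree_edge hr e; rwa [he] at this, ?_⟩
    rintro ⟨n, h1, rfl⟩
    exact hτ n e (by rw [he, h1])
  · rintro ⟨h1, h2⟩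
    by_cases h0 : q w = 0
    · exact M.exists_edge_eq hr h1 h0
    · have h3 : q - 𝐞 w + 𝐞 w = q := tsub_add_cancel_of_le (Finsupp.single_le_iff.2 (by omega))
      let n : DownTriangle d := ⟨q - 𝐞 w, by
        rw [← h3, map_add, Finsupp.degree_single] at h1
        exact h1⟩
      by_contra hcon
      obtain ⟨w', hw', hw''⟩ : ∃ w' : Fin 3, w' ≠ w ∧ ∀ e, M.edge hr e ≠ (n.1 + 𝐞 w', w') :=
        ⟨τ n, fun h => h2 ⟨n, h3, h⟩, hτ n⟩
      have h4 : ∀ e, M.edge hr e ≠ (n.1 + 𝐞 w, w) := fun e he => hcon ⟨e, by rw [he, h3]⟩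
      -- If the edges of directions w and w' were both missing, only the third direction -(w + w')
      -- would remain, and it is excluded here.
      obtain ⟨w1, e1, g1, g2⟩ := M.exists_edge_eq_add_single hr n
        (-(w + w'))
      rcases (by decide : ∀ w w' w1 : Fin 3, w' ≠ w → w1 ≠ -(w + w') → w1 = w ∨ w1 = w')
        w w' w1 hw' g1 with rfl | rfl
      · exact h4 e1 g2
      · exact hw'' e1 g2

end MinimalExact

end PolyhedralComplex

/-! ### The converse: 2-cells are regions, and there are no 3-cells -/

instance (d : ℕ) : Finite {q : Fin 3 →₀ ℕ // q.degree + 1 = d} :=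
  ((finite_degree_le d).subset fun n (hn : n.degree + 1 = d) => by
    change n.degree ≤ d
    omega : {n : Fin 3 →₀ ℕ | n.degree + 1 = d}.Finite)

noncomputable instance (d : ℕ) : Fintype {q : Fin 3 →₀ ℕ // q.degree + 1 = d} :=
  Fintype.ofFinite _

theorem intCast_mul_self_of_unit {k : Type*} [Field k] {n : ℤ} (h : n = 1 ∨ n = -1) :
    (n : k) * n = 1 := by
  rcases h with h | h <;> simp [h]

namespace PolyhedralComplex

namespace MinimalExact

variable {N : ℕ} {X : PolyhedralComplex N} {k : Type*} [Field k] {d : ℕ}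
  {a : X.Cell 0 → (Fin 3 →₀ ℕ)} {ε : X.Incidence} (M : X.MinimalExact k a ε)
  (hr : ∀ x : Fin 3 →₀ ℕ, (∃ v, a v = x) ↔ x.degree = d)
  {τ : DownTriangle d → Fin 3} (hτ : ∀ q w,
    (∃ e, M.edge hr e = (q, w)) ↔ q.degree + 1 = d ∧ ¬ IsRemoved τ q w)
  {η : X.Cell 1 → ℤ} (h1 : ∀ e, η e = 1 ∨ η e = -1)
  (h2 : ∀ v e, ε.sign v e = η e * stdSign1 (a v) (M.edge hr e))
include hτ

/-- The regions are indexed abstractly by the up triangles, as the 2-cells of X are not yet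
identified. -/
theorem deltaSigns : DeltaSigns τ a (M.edge hr)
    (Subtype.val : {q : Fin 3 →₀ ℕ // q.degree + 1 = d} → _)
    (fun v e => stdSign1 (a v) (M.edge hr e)) (fun e q => stdSign2 τ (M.edge hr e) q.1) :=
  deltaSigns_std τ M.label_injective hr (M.edge_injective hr) hτ Subtype.val_injective
    fun q => by simp

include h1 h2

theorem region_cycle (q : {q : Fin 3 →₀ ℕ // q.degree + 1 = d}) (v : X.Cell 0) :
    ∑ e, (ε.sign v e : k) * (η e * stdSign2 τ (M.edge hr e) q.1) = 0 := by
  have := congrArg (Int.cast : ℤ → k) ((M.deltaSigns hr hτ).sum2 v q)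
  push_cast at this
  rw [← this]
  refine Finset.sum_congr rfl fun e _ => ?_
  have h3 := intCast_mul_self_of_unit (k := k) (h1 e)
  rw [h2]
  push_cast
  linear_combination ((stdSign1 (a v) (M.edge hr e) : k) * stdSign2 τ (M.edge hr e) q.1) * h3

theorem exists_of_cycle [NeZero d] {b : Fin 3 →₀ ℕ} {z : X.Cell 1 → k}
    (hz : ∀ e, z e ≠ 0 → X.label a e.1 ≤ b) (hz' : ∀ v, ∑ e, (ε.sign v e : k) * z e = 0) :
    ∃ u : {q : Fin 3 →₀ ℕ // q.degree + 1 = d} → k, (∀ q, u q ≠ 0 → regionLabel q.1 ≤ b) ∧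
      ∀ e, z e = ∑ q, (η e : k) * stdSign2 τ (M.edge hr e) q.1 * u q := by
  have h3 := fun e => intCast_mul_self_of_unit (k := k) (h1 e)
  obtain ⟨u, hu, hu'⟩ := (M.deltaSigns hr hτ).exact_edges b (fun e => η e * z e) (fun e he => by
    rw [← M.label_edge hr]
    exact hz e (right_ne_zero_of_mul he)) (fun v => by
    rw [← hz' v]
    refine Finset.sum_congr rfl fun e _ => ?_
    rw [h2]
    push_cast
    ring)
  refine ⟨u, hu, fun e => ?_⟩
  have h4 := congrArg (fun x => (η e : k) * x) (hu' e)
  simp only [← mul_assoc, h3, one_mul] at h4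
  rw [h4, Finset.mul_sum]
  exact Finset.sum_congr rfl fun q _ => by ring

omit h2 in
-- The hypothesis says that F and the region have the same edges. Every vertex of a 2-cell, and
-- every vertex of a region, lies on one of its edges.
theorem image_eq_regionSet {q : Fin 3 →₀ ℕ} (hq : q.degree + 1 = d) {F : X.Cell 2} {c : k}
    (hc : c ≠ 0) (hF : ∀ e, (ε.sign e F : k) = η e * stdSign2 τ (M.edge hr e) q * c) :
    a '' X.verts F.1 = regionSet τ q := by
  have D := M.deltaSigns hr hτ
  have h3 : ∀ e : X.Cell 1, e.1 ⊆ F.1 ↔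
      edgeSet (M.edge hr e).1 (M.edge hr e).2 ⊆ regionSet τ q := by
    intro e
    rw [← D.s2_ne_zero_iff (k := k) (f := ⟨q, hq⟩)]
    constructor
    · intro h
      have h4 := sign_ne_zero_of_subset (k := k) ε h
      rw [hF] at h4
      exact right_ne_zero_of_mul (left_ne_zero_of_mul h4)
    · intro h
      refine subset_of_sign_ne_zero (k := k) ε ?_
      rw [hF]
      exact mul_ne_zero (mul_ne_zero (left_ne_zero_of_mul_eq_one
        (intCast_mul_self_of_unit (h1 e))) h) hc
  ext p
  constructor
  · rintro ⟨v, hv, rfl⟩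
    obtain ⟨e, h4, h5⟩ := exists_facet_cell_of_vertex v F hv
    exact (h3 e).1 h5 ((M.subset_edge_iff hr v e).1 h4)
  · intro hp
    obtain ⟨q', w, g1, g2, g3, g4⟩ := exists_edgeSet_of_mem_regionSet hq hp
    obtain ⟨e, he⟩ := (hτ q' w).2 ⟨g1, g2⟩
    obtain ⟨v, rfl⟩ := (hr p).2 (degree_of_mem_regionSet hq hp)
    refine ⟨v, ?_, rfl⟩
    exact Set.Subset.trans ((M.subset_edge_iff hr v e).2 (by rw [he]; exact g4))
      ((h3 e).2 (by rw [he]; exact g3))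

/-- The cycle of the region bounds a chain of 2-cells below the label of the region. The boundary of
a cell F occurring in it is a combination of regions with labels below the same bound, and for
degree reasons q is the only one. -/
theorem exists_cell_of_region [NeZero d] (q : {q : Fin 3 →₀ ℕ // q.degree + 1 = d}) :
    ∃ (F : X.Cell 2) (c : k), c ≠ 0 ∧
      ∀ e, (ε.sign e F : k) = η e * stdSign2 τ (M.edge hr e) q.1 * c := by
  have D := M.deltaSigns hr hτ
  have h3 := fun e => intCast_mul_self_of_unit (k := k) (h1 e)
  obtain ⟨y, hy, hy'⟩ := M.exact.graded_succ label_mono (regionLabel q.1)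
    (fun e => (η e : k) * stdSign2 τ (M.edge hr e) q.1) (fun e he => by
      rw [M.label_edge hr]
      exact edgeLabel_le_regionLabel ((D.s2_ne_zero_iff (k := k) (f := q)).1
        (right_ne_zero_of_mul he))) (M.region_cycle hr hτ h1 h2 q)
  obtain ⟨e, he, -⟩ := D.exists_edge_subset_regionSet q
  have h4 := hy' e
  have h5 : (η e : k) * stdSign2 τ (M.edge hr e) q.1 ≠ 0 :=
    mul_ne_zero (left_ne_zero_of_mul_eq_one (h3 e)) ((D.s2_ne_zero_iff (k := k) (f := q)).2 he)
  rw [h4] at h5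
  obtain ⟨F, -, hF⟩ := Finset.exists_ne_zero_of_sum_ne_zero h5
  have hF1 := hy F (right_ne_zero_of_mul hF)
  obtain ⟨u, hu, hu'⟩ := M.exists_of_cycle hr hτ h1 h2 (b := regionLabel q.1)
    (z := fun e => (ε.sign e F : k)) (fun e he =>
      (label_mono _ _ _ (subset_of_sign_ne_zero ε he)).trans hF1) (fun v => sum_sign_facets ε v F)
  have h6 : ∀ q', u q' ≠ 0 → q' = q := by
    intro q' hq'
    have h7 := eq_of_le_of_degree_le (hu q' hq') (by
      rw [degree_regionLabel, degree_regionLabel]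
      have := q.2
      have := q'.2
      omega)
    exact Subtype.ext (add_right_cancel (add_right_cancel (add_right_cancel h7)))
  have h7 : ∀ e, (ε.sign e F : k) = η e * stdSign2 τ (M.edge hr e) q.1 * u q := by
    intro e
    refine (hu' e).trans (Finset.sum_eq_single q (fun q' _ hq' => ?_) (by simp))
    by_contra h
    exact hq' (h6 q' (right_ne_zero_of_mul h))
  refine ⟨F, u q, ?_, h7⟩
  intro h0
  have := h7 e
  rw [h0, mul_zero] at this
  exact left_ne_zero_of_mul hF this

/-- The boundary of F is a combination of region boundaries, hence of boundaries of the 2-cells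
already found. If F is none of these, subtracting them gives a 2-cycle with coefficient 1 at F and
labels at most that of F. -/
theorem exists_region_of_cell [NeZero d] (F : X.Cell 2) :
    ∃ (q : {q : Fin 3 →₀ ℕ // q.degree + 1 = d}) (c : k), c ≠ 0 ∧
      ∀ e, (ε.sign e F : k) = η e * stdSign2 τ (M.edge hr e) q.1 * c := by
  classical
  choose G c hc hG using M.exists_cell_of_region hr hτ h1 h2
  by_cases hFG : ∃ q, G q = F
  · obtain ⟨q, rfl⟩ := hFG
    exact ⟨q, c q, hc q, hG q⟩
  exfalso
  obtain ⟨u, hu, hu'⟩ := M.exists_of_cycle hr hτ h1 h2 (b := X.label a F.1)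
    (z := fun e => (ε.sign e F : k)) (fun e he =>
      label_mono _ _ _ (subset_of_sign_ne_zero ε he)) (fun v => sum_sign_facets ε v F)
  have hz := M.eq_zero_of_cycle (F := F)
    (z := fun F' => (if F' = F then 1 else 0) - ∑ q, if F' = G q then (c q)⁻¹ * u q else 0) (by
      intro F' hF'
      by_cases h : F' = F
      · rw [h]
      · simp only [h, if_false, zero_sub, ne_eq, neg_eq_zero] at hF'
        obtain ⟨q, -, hq⟩ := Finset.exists_ne_zero_of_sum_ne_zero hF'
        have h3 : F' = G q := by
          by_contra h
          simp [h] at hq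
        rw [if_pos h3] at hq
        rw [h3, label_eq_regionLabel (M.image_eq_regionSet hr hτ h1 q.2 (hc q) (hG q))]
        exact hu q (right_ne_zero_of_mul hq)) (by
      intro e
      change ∑ F', (ε.sign e F' : k) * ((if F' = F then 1 else 0) - _) = 0
      simp only [mul_sub, Finset.sum_sub_distrib, Finset.mul_sum, mul_ite, mul_one, mul_zero,
        Finset.sum_ite_eq', Finset.mem_univ, if_true]
      rw [Finset.sum_comm]
      simp only [Finset.sum_ite_eq', Finset.mem_univ, if_true]
      rw [sub_eq_zero]
      refine (hu' e).trans (Finset.sum_congr rfl fun q _ => ?_)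
      rw [hG q e, mul_assoc _ (c q), mul_inv_cancel_left₀ (hc q)])
  refine one_ne_zero (α := k) ?_
  rw [← hz]
  simp only [if_true]
  rw [Finset.sum_eq_zero, sub_zero]
  intro q _
  exact if_neg fun h => hFG ⟨q, h.symm⟩

/-- The facets of a 3-cell would give a nontrivial relation among boundaries of distinct regions. In
higher dimension a facet reduces to the previous case. -/
theorem isEmpty_cell [NeZero d] (i : ℕ) : IsEmpty (X.Cell (i + 3)) := by
  induction i with
  | succ i ih =>
    refine ⟨fun F => ?_⟩
    obtain ⟨v, hv⟩ := exists_vertex F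
    obtain ⟨F', -⟩ := exists_facet_cell_of_vertex v F hv
    exact ih.elim F'
  | zero =>
    classical
    refine ⟨fun T => ?_⟩
    have D := M.deltaSigns hr hτ
    choose Q c hc hQ using M.exists_region_of_cell hr hτ h1 h2
    have hinj : Function.Injective Q := fun F F' h =>
      Subtype.ext (eq_of_verts_eq F.2.1 F'.2.1 (M.label_injective.image_injective (by
        rw [M.image_eq_regionSet hr hτ h1 (Q F).2 (hc F) (hQ F),
          M.image_eq_regionSet hr hτ h1 (Q F').2 (hc F') (hQ F'), h])))
    have h0 := D.eq_zero_of_sum_s2_eq_zero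
      (u := fun q => ∑ F, if Q F = q then c F * (ε.sign F T : k) else 0) (by
        intro e
        simp only [Finset.mul_sum, mul_ite, mul_zero]
        rw [Finset.sum_comm]
        simp only [Finset.sum_ite_eq, Finset.mem_univ, if_true]
        have h3 := sum_sign_facets (k := k) ε e T
        have h4 := congrArg (fun x => (η e : k) * x) h3
        simp only [Finset.mul_sum, mul_zero] at h4
        rw [← h4]
        refine Finset.sum_congr rfl fun F _ => ?_
        rw [hQ F e]
        linear_combination (-(stdSign2 τ (M.edge hr e) (Q F).1 : k) * c F * ε.sign F T) *
          intCast_mul_self_of_unit (k := k) (h1 e))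
    obtain ⟨v, hv⟩ := exists_vertex T
    obtain ⟨F, -, hF⟩ := exists_facet_cell_of_vertex v T hv
    have h5 := congrFun h0 (Q F)
    simp only [hinj.eq_iff, Finset.sum_ite_eq', Finset.mem_univ, if_true, Pi.zero_apply] at h5
    exact mul_ne_zero (hc F) (sign_ne_zero_of_subset ε hF) h5

end MinimalExact

/-- A cellular minimal resolution of a power of the maximal ideal comes from a choice of edges. -/
theorem IsMinimalResolution.exists_isDelta {N : ℕ} {X : PolyhedralComplex N} {k : Type*} [Field k]
    {d : ℕ} [NeZero d] {a : X.Cell 0 → (Fin 3 →₀ ℕ)} {ε : X.Incidence}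
    (h : X.IsMinimalResolution a k ε
      (Ideal.span (Set.range (MvPolynomial.X : Fin 3 → MvPolynomial (Fin 3) k)) ^ d)) :
    ∃ τ : DownTriangle d → Fin 3, IsDelta τ X a := by
  have M := h.minimalExact
  have hr := h.vertex_range
  obtain ⟨τ, hτ⟩ := M.exists_edge_range hr
  obtain ⟨η, h1, h2⟩ := M.exists_orientation hr
  refine ⟨τ, M.label_injective, ?_⟩
  ext c
  rw [mem_deltaCells]
  constructor
  · rintro ⟨P, hP, hne, rfl⟩
    obtain ⟨i, hi⟩ : ∃ i, Module.finrank ℝ (vectorSpan ℝ P) = i := ⟨_, rfl⟩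
    match i, hi with
    | 0, hi =>
      let v : X.Cell 0 := ⟨P, hP, hne, hi⟩
      have hv : X.verts P = {v} := verts_cell_zero v
      exact Or.inl ⟨a v, (hr _).1 ⟨v, rfl⟩, by rw [hv, Set.image_singleton]⟩
    | 1, hi =>
      have h3 := (hτ _ _).1 ⟨⟨P, hP, hne, hi⟩, rfl⟩
      exact Or.inr (Or.inl ⟨_, _, h3.1, h3.2, M.image_edge hr ⟨P, hP, hne, hi⟩⟩)
    | 2, hi =>
      obtain ⟨q, c, hc, hq⟩ := M.exists_region_of_cell hr hτ h1 h2 ⟨P, hP, hne, hi⟩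
      exact Or.inr (Or.inr ⟨q.1, q.2, M.image_eq_regionSet hr hτ h1 q.2 hc hq⟩)
    | i + 3, hi => exact ((M.isEmpty_cell hr hτ h1 h2 i).false ⟨P, hP, hne, hi⟩).elim
  · rintro (⟨p, hp, rfl⟩ | ⟨q, w, hq, hw, rfl⟩ | ⟨q, hq, rfl⟩)
    · obtain ⟨v, rfl⟩ := (hr p).2 hp
      exact ⟨v.1, v.2.1, v.2.2.1, by rw [verts_cell_zero, Set.image_singleton]⟩
    · obtain ⟨e, he⟩ := (hτ q w).2 ⟨hq, hw⟩
      exact ⟨e.1, e.2.1, e.2.2.1, by rw [M.image_edge hr, he]⟩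
    · obtain ⟨F, c, hc, hF⟩ := M.exists_cell_of_region hr hτ h1 h2 ⟨q, hq⟩
      exact ⟨F.1, F.2.1, F.2.2.1, (M.image_eq_regionSet hr hτ h1 hq hc hF).symm⟩

end PolyhedralComplex

/-! ### Faces of convex hulls cut out by functionals -/

section ExposedFaces

variable {E : Type*} [AddCommGroup E] [Module ℝ E] [TopologicalSpace E]

theorem le_of_mem_convexHull {s : Set E} {l : E →L[ℝ] ℝ} {c : ℝ} (hs : ∀ x ∈ s, l x ≤ c) {x : E}
    (hx : x ∈ convexHull ℝ s) : l x ≤ c :=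
  convexHull_min hs (convex_halfSpace_le l.isLinear c) hx

/-- The face of a convex hull on which a functional is maximal. -/
theorem convexHull_inter_eq_of_le {s : Set E} {l : E →L[ℝ] ℝ} {c : ℝ} (hs : ∀ x ∈ s, l x ≤ c) :
    {x ∈ convexHull ℝ s | l x = c} = convexHull ℝ {x ∈ s | l x = c} := by
  ext x
  constructor
  · rintro ⟨hx, hxc⟩
    have hle : ∀ y ∈ convexHull ℝ {x ∈ s | l x = c}, l y ≤ c := fun y hy =>
      le_of_mem_convexHull (fun z hz => hz.2.le) hy
    -- The points strictly below the level c, together with the hull of the generators at that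
    -- level, form a convex set containing s.
    have hconv : Convex ℝ {y | l y < c ∨ y ∈ convexHull ℝ {x ∈ s | l x = c}} := by
      intro y hy z hz α β hα hβ hαβ
      have hy' : l y ≤ c := hy.elim le_of_lt (hle y)
      have hz' : l z ≤ c := hz.elim le_of_lt (hle z)
      rcases hα.eq_or_lt with rfl | hα'
      · rw [zero_add] at hαβ
        simpa [hαβ] using hz
      rcases hβ.eq_or_lt with rfl | hβ'
      · rw [add_zero] at hαβ
        simpa [hαβ] using hy
      have hcomb : l (α • y + β • z) = α * l y + β * l z := by simp
      have hc : c = α * c + β * c := by rw [← add_mul, hαβ, one_mul]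
      rcases hy with hy | hy
      · left
        rw [hcomb, hc]
        exact add_lt_add_of_lt_of_le (mul_lt_mul_of_pos_left hy hα')
          (mul_le_mul_of_nonneg_left hz' hβ)
      rcases hz with hz | hz
      · left
        rw [hcomb, hc]
        exact add_lt_add_of_le_of_lt (mul_le_mul_of_nonneg_left hy' hα)
          (mul_lt_mul_of_pos_left hz hβ')
      · exact Or.inr (convex_convexHull ℝ _ hy hz hα hβ hαβ)
    have hsub : s ⊆ {y | l y < c ∨ y ∈ convexHull ℝ {x ∈ s | l x = c}} := fun y hy =>
      (hs y hy).lt_or_eq.imp id fun h => subset_convexHull ℝ _ ⟨hy, h⟩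
    exact (convexHull_min hsub hconv hx).resolve_left hxc.not_lt
  · intro hx
    refine ⟨convexHull_mono (Set.sep_subset _ _) hx, ?_⟩
    exact convexHull_min (fun y hy => hy.2) (convex_hyperplane l.isLinear c) hx

theorem isExposed_convexHull_of_le {s : Set E} {l : E →L[ℝ] ℝ} {c : ℝ} (hs : ∀ x ∈ s, l x ≤ c) :
    IsExposed ℝ (convexHull ℝ s) (convexHull ℝ {x ∈ s | l x = c}) := by
  intro hne
  refine ⟨l, ?_⟩
  rw [← convexHull_inter_eq_of_le hs] at hne ⊢
  obtain ⟨x0, hx0, hx0c⟩ := hne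
  ext x
  refine and_congr_right fun hx => ⟨fun h y hy => ?_, fun h => ?_⟩
  · rw [h]
    exact le_of_mem_convexHull hs hy
  · exact le_antisymm (le_of_mem_convexHull hs hx) (hx0c ▸ h x0 hx0)

theorem IsExposed.exists_eq_convexHull {s F : Set E} (h : IsExposed ℝ (convexHull ℝ s) F)
    (hF : F.Nonempty) : ∃ (l : E →L[ℝ] ℝ) (c : ℝ), (∀ x ∈ s, l x ≤ c) ∧
      F = convexHull ℝ {x ∈ s | l x = c} := by
  obtain ⟨l, rfl⟩ := h hF
  obtain ⟨x0, hx0, hmax⟩ := hF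
  have hs : ∀ x ∈ s, l x ≤ l x0 := fun x hx => hmax x (subset_convexHull ℝ s hx)
  refine ⟨l, l x0, hs, ?_⟩
  rw [← convexHull_inter_eq_of_le hs]
  ext x
  refine and_congr_right fun hx => ⟨fun h => ?_, fun h y hy => ?_⟩
  · exact le_antisymm (hmax x hx) (h x0 hx0)
  · rw [h]
    exact hmax y hy

theorem convexHull_inter_convexHull_eq {s t : Set E} {l : E →L[ℝ] ℝ} {c : ℝ}
    (hs : ∀ x ∈ s, c ≤ l x) (ht : ∀ x ∈ t, l x ≤ c) (h : ∀ x ∈ s, l x = c → x ∈ t) :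
    convexHull ℝ s ∩ convexHull ℝ t = convexHull ℝ {x ∈ s | l x = c} := by
  have hs' : ∀ x ∈ s, (-l) x ≤ -c := fun x hx => neg_le_neg (hs x hx)
  have heq : {x ∈ s | l x = c} = {x ∈ s | (-l) x = -c} := by
    ext x
    simp
  refine Set.Subset.antisymm ?_ (Set.subset_inter (convexHull_mono (Set.sep_subset _ _))
    (convexHull_mono fun x hx => h x hx.1 hx.2))
  rintro x ⟨hx, hx'⟩
  rw [heq, ← convexHull_inter_eq_of_le hs']
  refine ⟨hx, ?_⟩
  have h1 := le_of_mem_convexHull hs' hx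
  have h2 := le_of_mem_convexHull ht hx'
  simp only [neg_apply] at h1 ⊢
  linarith

/-- The vectors u and v form a basis of the plane, and g, h are its dual basis up to scaling. -/
theorem exists_eq_smul_add_smul {E : Type*} [NormedAddCommGroup E] [NormedSpace ℝ E]
    (hE : Module.finrank ℝ E = 2) {g h : E →L[ℝ] ℝ} {u v : E} (hgu : g u = 0) (hhu : h u ≠ 0)
    (hgv : g v ≠ 0) (hhv : h v = 0) (l : E →L[ℝ] ℝ) :
    ∃ α β : ℝ, ∀ x, l x = α * g x + β * h x := by
  have hli : LinearIndependent ℝ ![u, v] := by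
    rw [LinearIndependent.pair_iff]
    intro s t hst
    have h1 := congrArg g hst
    have h2 := congrArg h hst
    simp only [map_add, map_smul, hgu, hhv, smul_eq_mul, map_zero, mul_zero, zero_add, add_zero,
      mul_eq_zero, hhu, hgv, or_false] at h1 h2
    exact ⟨h2, h1⟩
  let b := basisOfLinearIndependentOfCardEqFinrank hli (by simp [hE])
  refine ⟨l v / g v, l u / h u, fun x => ?_⟩
  have : (l : E →ₗ[ℝ] ℝ) = (l v / g v) • (g : E →ₗ[ℝ] ℝ) + (l u / h u) • (h : E →ₗ[ℝ] ℝ) := by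
    refine b.ext fun i => ?_
    fin_cases i
    · simp [b, hgu, hhu]
    · simp [b, hgv, hhv]
  exact DFunLike.congr_fun this x

end ExposedFaces

/-! ### The positions of the vertices in the plane -/

section Realization

/-- The planar positions of the vertices. -/
noncomputable def position (p : Fin 3 →₀ ℕ) : EuclideanSpace ℝ (Fin 2) :=
  !₂[(p 0 : ℝ) ^ 2 - (p 2 : ℝ) ^ 2, (p 1 : ℝ) ^ 2 - (p 2 : ℝ) ^ 2]

/-- The quadratic form in the position of a vertex given by weights for two of the variables. -/
def quadForm (w : Fin 3) (b c : ℤ) (p : Fin 3 →₀ ℕ) : ℤ :=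
  b * (p (w + 1) : ℤ) ^ 2 + c * (p (w + 2) : ℤ) ^ 2 - (b + c) * (p w : ℤ) ^ 2

/-- The weights b, c, -(b + c) sum to zero, so the form depends only on differences of squares, that
is, linearly on the position. -/
theorem exists_functional (w : Fin 3) (b c : ℤ) :
    ∃ l : EuclideanSpace ℝ (Fin 2) →L[ℝ] ℝ, ∀ p, l (position p) = quadForm w b c p := by
  have h : ∀ μ ν : ℝ, ∃ l : EuclideanSpace ℝ (Fin 2) →L[ℝ] ℝ, ∀ p, l (position p) =
      μ * ((p 0 : ℝ) ^ 2 - (p 2 : ℝ) ^ 2) + ν * ((p 1 : ℝ) ^ 2 - (p 2 : ℝ) ^ 2) := fun μ ν =>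
    ⟨μ • EuclideanSpace.proj 0 + ν • EuclideanSpace.proj 1, fun p => by simp [position]⟩
  fin_cases w
  · obtain ⟨l, hl⟩ := h (-(b + c)) b
    refine ⟨l, fun p => (hl p).trans ?_⟩
    simp [quadForm]
    ring
  · obtain ⟨l, hl⟩ := h c (-(b + c))
    refine ⟨l, fun p => (hl p).trans ?_⟩
    simp [quadForm]
    ring
  · obtain ⟨l, hl⟩ := h b c
    refine ⟨l, fun p => (hl p).trans ?_⟩
    simp [quadForm]
    ring

/-- If one exponent were larger, equality of the differences of squares would make all three larger,
changing the degree. -/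
theorem position_injective_of_degree_eq {p p' : Fin 3 →₀ ℕ} (hd : p.degree = p'.degree)
    (h : position p = position p') : p = p' := by
  have h0 : ((p 0 : ℤ) ^ 2 - (p 2 : ℤ) ^ 2) = (p' 0 : ℤ) ^ 2 - (p' 2 : ℤ) ^ 2 := by
    have : (p 0 : ℝ) ^ 2 - (p 2 : ℝ) ^ 2 = (p' 0 : ℝ) ^ 2 - (p' 2 : ℝ) ^ 2 :=
      congrArg (fun x : EuclideanSpace ℝ (Fin 2) => x 0) h
    exact_mod_cast this
  have h1 : ((p 1 : ℤ) ^ 2 - (p 2 : ℤ) ^ 2) = (p' 1 : ℤ) ^ 2 - (p' 2 : ℤ) ^ 2 := by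
    have : (p 1 : ℝ) ^ 2 - (p 2 : ℝ) ^ 2 = (p' 1 : ℝ) ^ 2 - (p' 2 : ℝ) ^ 2 :=
      congrArg (fun x : EuclideanSpace ℝ (Fin 2) => x 1) h
    exact_mod_cast this
  simp only [degree_fin_three, finsupp_fin_three_ext] at hd ⊢
  have key : ∀ {a b c a' b' c' : ℕ}, a + b + c = a' + b' + c' →
      (a : ℤ) ^ 2 - (c : ℤ) ^ 2 = (a' : ℤ) ^ 2 - (c' : ℤ) ^ 2 →
      (b : ℤ) ^ 2 - (c : ℤ) ^ 2 = (b' : ℤ) ^ 2 - (c' : ℤ) ^ 2 → c ≤ c' := by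
    intro a b c a' b' c' hs ha hb
    by_contra! hlt
    have hlt' : ((c' : ℤ)) ^ 2 < (c : ℤ) ^ 2 := by
      have : (c' : ℤ) < c := by exact_mod_cast hlt
      nlinarith [Int.natCast_nonneg c']
    have ha' : a' < a := by
      have : (a' : ℤ) ^ 2 < (a : ℤ) ^ 2 := by linarith
      exact_mod_cast lt_of_pow_lt_pow_left₀ 2 (Int.natCast_nonneg a) this
    have hb' : b' < b := by
      have : (b' : ℤ) ^ 2 < (b : ℤ) ^ 2 := by linarith
      exact_mod_cast lt_of_pow_lt_pow_left₀ 2 (Int.natCast_nonneg b) this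
    omega
  have h2 : p 2 = p' 2 := le_antisymm (key hd h0 h1) (key hd.symm h0.symm h1.symm)
  have h3 : (p 0 : ℤ) ^ 2 = (p' 0 : ℤ) ^ 2 := by
    rw [h2] at h0
    linarith
  have h4 : p 0 = p' 0 := by
    have := (pow_left_inj₀ (Int.natCast_nonneg _) (Int.natCast_nonneg _) two_ne_zero).1 h3
    exact_mod_cast this
  exact ⟨h4, by omega, h2⟩

end Realization

/-! ### Inequalities for the quadratic forms -/

section QuadraticEstimates

theorem mul_pred_self_nonneg (α : ℤ) : 0 ≤ α * (α - 1) := by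
  rcases le_or_gt α 0 with h | h
  · exact mul_nonneg_of_nonpos_of_nonpos h (by omega)
  · exact mul_nonneg (by omega) (by omega)

theorem eq_zero_or_one_of_mul_pred_self {α : ℤ} (h : α * (α - 1) = 0) : α = 0 ∨ α = 1 := by
  rcases mul_eq_zero.1 h with h | h
  · exact Or.inl h
  · exact Or.inr (by omega)

/-- The quadratic form tangent to an edge, on the far side. -/
theorem edge_le_quadratic {x y z X Y Z : ℤ} (hy : 0 ≤ y) (hz : 0 ≤ z) (h0 : 0 ≤ X)
    (hX : X ≤ x) (hs : X + Y + Z = x + y + z + 1) :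
    (2 * z + 1) * (y + 1) ^ 2 + (2 * y + 1) * z ^ 2 - (2 * z + 1 + (2 * y + 1)) * x ^ 2 ≤
        (2 * z + 1) * Y ^ 2 + (2 * y + 1) * Z ^ 2 - (2 * z + 1 + (2 * y + 1)) * X ^ 2 ∧
      ((2 * z + 1) * Y ^ 2 + (2 * y + 1) * Z ^ 2 - (2 * z + 1 + (2 * y + 1)) * X ^ 2 =
        (2 * z + 1) * (y + 1) ^ 2 + (2 * y + 1) * z ^ 2 - (2 * z + 1 + (2 * y + 1)) * x ^ 2 →
        X = x ∧ (Y = y + 1 ∧ Z = z ∨ Y = y ∧ Z = z + 1)) := by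
  -- Each summand on the right is nonnegative; α(α - 1) ≥ 0 on integers, with zeros only at 0 and 1,
  -- is what singles out the two ends of the edge.
  have key : (2 * z + 1) * Y ^ 2 + (2 * y + 1) * Z ^ 2 - (2 * z + 1 + (2 * y + 1)) * X ^ 2 -
      ((2 * z + 1) * (y + 1) ^ 2 + (2 * y + 1) * z ^ 2 - (2 * z + 1 + (2 * y + 1)) * x ^ 2) =
      (2 * y + 1) * (2 * z + 1) * (x - X) + (2 * z + 1) * ((Y - y) * (Y - y - 1)) +
        (2 * y + 1) * ((Z - z) * (Z - z - 1)) +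
        (2 * z + 1 + (2 * y + 1)) * ((x - X) * (x + X)) := by
    obtain rfl : X = x + y + z + 1 - Y - Z := by linarith
    ring
  have t1 : 0 ≤ (2 * y + 1) * (2 * z + 1) * (x - X) :=
    mul_nonneg (by positivity) (by linarith)
  have t2 : 0 ≤ (2 * z + 1) * ((Y - y) * (Y - y - 1)) :=
    mul_nonneg (by positivity) (mul_pred_self_nonneg _)
  have t3 : 0 ≤ (2 * y + 1) * ((Z - z) * (Z - z - 1)) :=
    mul_nonneg (by positivity) (mul_pred_self_nonneg _)
  have t4 : 0 ≤ (2 * z + 1 + (2 * y + 1)) * ((x - X) * (x + X)) :=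
    mul_nonneg (by positivity) (mul_nonneg (by linarith) (by linarith))
  refine ⟨by linarith, fun h => ?_⟩
  have e1 : (2 * y + 1) * (2 * z + 1) * (x - X) = 0 := by linarith
  have e2 : (2 * z + 1) * ((Y - y) * (Y - y - 1)) = 0 := by linarith
  have hX' := (mul_eq_zero.1 e1).resolve_left (by positivity)
  have hY := eq_zero_or_one_of_mul_pred_self ((mul_eq_zero.1 e2).resolve_left (by positivity))
  omega

/-- The quadratic form tangent to an edge, on the near side. -/
theorem quadratic_lt_edge {x y z X Y Z : ℤ} (hx : 0 ≤ x) (hy : 0 ≤ y) (hz : 0 ≤ z) (hY : 0 ≤ Y)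
    (hZ : 0 ≤ Z) (hX : X = x + 1) (hY' : Y ≤ y + 1) (hZ' : Z ≤ z + 1)
    (hs : X + Y + Z = x + y + z + 1) :
    (2 * z + 1) * Y ^ 2 + (2 * y + 1) * Z ^ 2 - (2 * z + 1 + (2 * y + 1)) * X ^ 2 <
      (2 * z + 1) * (y + 1) ^ 2 + (2 * y + 1) * z ^ 2 - (2 * z + 1 + (2 * y + 1)) * x ^ 2 := by
  subst hX
  have t : 0 ≤ y * z := mul_nonneg hy hz
  have t1 : 0 ≤ y * x := mul_nonneg hy hx
  have t2 : 0 ≤ z * x := mul_nonneg hz hx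
  obtain h | h | h : Y = y - 1 ∨ Y = y ∨ Y = y + 1 := by omega
  · obtain rfl : Z = z + 1 := by omega
    subst h
    nlinarith
  · obtain rfl : Z = z := by omega
    subst h
    nlinarith
  · obtain rfl : Z = z - 1 := by omega
    subst h
    nlinarith

/-- The quadratic form tangent at a corner, on the far side. -/
theorem corner_le_quadratic {x y z X Y Z : ℤ} (hy : 0 < y) (hz : 0 < z) (h0 : 0 ≤ X)
    (hX : X ≤ x) (hs : X + Y + Z = x + y + z) :
    z * y ^ 2 + y * z ^ 2 - (z + y) * x ^ 2 ≤ z * Y ^ 2 + y * Z ^ 2 - (z + y) * X ^ 2 ∧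
      (z * Y ^ 2 + y * Z ^ 2 - (z + y) * X ^ 2 = z * y ^ 2 + y * z ^ 2 - (z + y) * x ^ 2 →
        X = x ∧ Y = y ∧ Z = z) := by
  have key : z * Y ^ 2 + y * Z ^ 2 - (z + y) * X ^ 2 -
      (z * y ^ 2 + y * z ^ 2 - (z + y) * x ^ 2) = 2 * (y * z) * (x - X) + z * (Y - y) ^ 2 +
        y * (Z - z) ^ 2 + (z + y) * ((x - X) * (x + X)) := by
    obtain rfl : X = x + y + z - Y - Z := by linarith
    ring
  have t1 : 0 ≤ 2 * (y * z) * (x - X) := mul_nonneg (by positivity) (by linarith)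
  have t2 : 0 ≤ z * (Y - y) ^ 2 := by positivity
  have t3 : 0 ≤ y * (Z - z) ^ 2 := by positivity
  have t4 : 0 ≤ (z + y) * ((x - X) * (x + X)) :=
    mul_nonneg (by positivity) (mul_nonneg (by linarith) (by linarith))
  refine ⟨by linarith, fun h => ?_⟩
  have e2 : z * (Y - y) ^ 2 = 0 := by linarith
  have e3 : y * (Z - z) ^ 2 = 0 := by linarith
  have hY := pow_eq_zero_iff two_ne_zero |>.1 ((mul_eq_zero.1 e2).resolve_left hz.ne')
  have hZ := pow_eq_zero_iff two_ne_zero |>.1 ((mul_eq_zero.1 e3).resolve_left hy.ne')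
  omega

/-- The quadratic form tangent at a corner, on the near side. -/
theorem quadratic_le_corner {x y z X Y Z : ℤ} (hx : 0 ≤ x) (hy : 0 < y) (hz : 0 < z) (hY : 0 ≤ Y)
    (hZ : 0 ≤ Z) (hX : x ≤ X) (hY' : Y ≤ y) (hZ' : Z ≤ z) :
    z * Y ^ 2 + y * Z ^ 2 - (z + y) * X ^ 2 ≤ z * y ^ 2 + y * z ^ 2 - (z + y) * x ^ 2 := by
  have t1 : Y ^ 2 ≤ y ^ 2 := pow_le_pow_left₀ hY hY' 2
  have t2 : Z ^ 2 ≤ z ^ 2 := pow_le_pow_left₀ hZ hZ' 2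
  have t3 : x ^ 2 ≤ X ^ 2 := pow_le_pow_left₀ hx hX 2
  have := mul_le_mul_of_nonneg_left t1 hz.le
  have := mul_le_mul_of_nonneg_left t2 hy.le
  have := mul_le_mul_of_nonneg_left t3 (by positivity : 0 ≤ z + y)
  linarith

end QuadraticEstimates

/-! ### Supporting and separating lines of the regions -/

section Tangents

variable {d : ℕ} {τ : DownTriangle d → Fin 3}

theorem mem_edgeSet_iff {p q : Fin 3 →₀ ℕ} {w : Fin 3} : p ∈ edgeSet q w ↔
    p w = q w ∧ (p (w + 1) = q (w + 1) + 1 ∧ p (w + 2) = q (w + 2) ∨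
      p (w + 1) = q (w + 1) ∧ p (w + 2) = q (w + 2) + 1) := by
  simp only [edgeSet, Set.mem_insert_iff, Set.mem_singleton_iff, finsupp_fin_three_ext,
    Finsupp.add_apply, Finsupp.single_apply]
  fin_cases w <;> simp <;> omega

theorem regionSet_le {p q : Fin 3 →₀ ℕ} (hp : p ∈ regionSet τ q) (i : Fin 3) : p i ≤ q i + 1 := by
  have h := le_of_mem_regionSet hp i
  refine h.trans (le_of_eq ?_)
  simp only [Finsupp.add_apply, Finsupp.single_apply]
  fin_cases i <;> simp

/-- Triangles merged across the other two sides add vertices whose exponent of x_w is q_w + 1, like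
the corner q x_w. -/
theorem le_of_mem_regionSet_of_not_isRemoved {p q : Fin 3 →₀ ℕ} {w : Fin 3}
    (hw : ¬ IsRemoved τ q w) (hp : p ∈ regionSet τ q) :
    p ∈ edgeSet q w ∨ p w = q w + 1 := by
  rcases mem_regionSet.1 hp with ⟨i, rfl⟩ | ⟨n, rfl, rfl⟩
  · by_cases h : i = w
    · subst h
      right
      simp
    · left
      rcases (by decide : ∀ i w : Fin 3, i ≠ w → i = w + 1 ∨ i = w + 2) i w h with rfl | rfl
      · exact Or.inl rfl
      · exact Or.inr rfl
  · have h : τ n ≠ w := by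
      rintro rfl
      exact hw ⟨n, rfl, rfl⟩
    right
    generalize τ n = v at h
    simp only [Finsupp.add_apply, Finsupp.single_apply]
    fin_cases v <;> fin_cases w <;> simp at h ⊢

/-- A kept edge lies on a line separating its up triangle from the points further away. -/
theorem exists_tangent_edge {q : Fin 3 →₀ ℕ} {w : Fin 3} (hq : q.degree + 1 = d)
    (hw : ¬ IsRemoved τ q w) : ∃ (l : EuclideanSpace ℝ (Fin 2) →L[ℝ] ℝ) (γ : ℝ),
      (∀ p ∈ regionSet τ q, l (position p) ≤ γ ∧ (l (position p) = γ ↔ p ∈ edgeSet q w)) ∧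
      ∀ p : Fin 3 →₀ ℕ, p.degree = d → p w ≤ q w →
        γ ≤ l (position p) ∧ (l (position p) = γ ↔ p ∈ edgeSet q w) := by
  set y := q (w + 1) with hy
  set z := q (w + 2) with hz
  set γ : ℤ := (2 * z + 1) * (y + 1) ^ 2 + (2 * y + 1) * z ^ 2 -
    (2 * z + 1 + (2 * y + 1)) * (q w : ℤ) ^ 2 with hγ
  -- These weights give both ends the same value, since (2z+1)((y+1)² - y²) = (2y+1)((z+1)² - z²).
  obtain ⟨l, hl⟩ := exists_functional w (2 * z + 1) (2 * y + 1)
  have hedge : ∀ p ∈ edgeSet q w, quadForm w (2 * z + 1) (2 * y + 1) p = γ := by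
    intro p hp
    rw [quadForm, hγ]
    obtain ⟨h1, ⟨h2, h3⟩ | ⟨h2, h3⟩⟩ := mem_edgeSet_iff.1 hp
    · rw [h1, h2, h3]
      push_cast
      ring
    · rw [h1, h2, h3]
      push_cast
      ring
  rw [degree_fin_three' q w] at hq
  refine ⟨l, γ, fun p hp => ?_, fun p hp hpw => ?_⟩
  · rw [hl, Int.cast_le, Int.cast_inj]
    rcases le_of_mem_regionSet_of_not_isRemoved hw hp with h | h
    · rw [hedge p h]
      simp [h]
    · have hd := degree_of_mem_regionSet (by rw [degree_fin_three' q w]; exact hq) hp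
      rw [degree_fin_three' p w] at hd
      have h1 := quadratic_lt_edge (x := q w) (y := y) (z := z) (X := p w) (Y := p (w + 1))
        (Z := p (w + 2)) (by positivity) (by positivity) (by positivity) (by positivity)
        (by positivity) (by exact_mod_cast h) (by exact_mod_cast regionSet_le hp _)
        (by exact_mod_cast regionSet_le hp _) (by omega)
      refine ⟨h1.le, fun h2 => absurd h2 h1.ne, fun h2 => ?_⟩
      have := (mem_edgeSet_iff.1 h2).1
      omega
  · rw [hl, Int.cast_le, Int.cast_inj]
    rw [degree_fin_three' p w] at hp
    have h1 := edge_le_quadratic (x := q w) (y := y) (z := z) (X := p w) (Y := p (w + 1))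
        (Z := p (w + 2)) (by positivity) (by positivity) (by positivity)
        (by exact_mod_cast hpw) (by omega)
    refine ⟨h1.1, fun h2 => mem_edgeSet_iff.2 ?_, hedge p⟩
    have h3 := h1.2 h2
    omega

/-- A corner of a region lies on a line separating the region from the points further away. -/
theorem exists_tangent_corner {q : Fin 3 →₀ ℕ} {w : Fin 3} (hq : q.degree + 1 = d)
    (hw : IsRemoved τ q w) : ∃ (l : EuclideanSpace ℝ (Fin 2) →L[ℝ] ℝ) (γ : ℝ),
      ∃ t ∈ regionSet τ q, (∀ p ∈ regionSet τ q, l (position p) ≤ γ) ∧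
      ∀ p : Fin 3 →₀ ℕ, p.degree = d → p w + 1 ≤ q w →
        γ ≤ l (position p) ∧ (l (position p) = γ → p = t) := by
  obtain ⟨n, rfl, hn⟩ := hw
  -- The corner t is the vertex added by the triangle merged across the removed edge.
  set t := n.1 + 𝐞 (w + 1) + 𝐞 (w + 2) with ht
  have htq : t ∈ regionSet τ (n.1 + 𝐞 w) := mem_regionSet.2 (Or.inr ⟨n, by rw [hn], by rw [hn]⟩)
  have t0 : t w = n.1 w := by
    simp only [ht, Finsupp.add_apply, Finsupp.single_apply]
    fin_cases w <;> simp
  have t1 : t (w + 1) = n.1 (w + 1) + 1 := by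
    simp only [ht, Finsupp.add_apply, Finsupp.single_apply]
    fin_cases w <;> simp
  have t2 : t (w + 2) = n.1 (w + 2) + 1 := by
    simp only [ht, Finsupp.add_apply, Finsupp.single_apply]
    fin_cases w <;> simp
  have q0 : (n.1 + 𝐞 w) w = n.1 w + 1 := by simp
  have q1 : (n.1 + 𝐞 w) (w + 1) = n.1 (w + 1) := by
    simp only [Finsupp.add_apply, Finsupp.single_apply]
    fin_cases w <;> simp
  have q2 : (n.1 + 𝐞 w) (w + 2) = n.1 (w + 2) := by
    simp only [Finsupp.add_apply, Finsupp.single_apply]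
    fin_cases w <;> simp
  have hdt := degree_of_mem_regionSet hq htq
  rw [degree_fin_three' t w] at hdt
  -- With the exponents y, z of t interchanged as weights, zY² + yZ² has equal partial derivatives
  -- at (y, z), so it is stationary there along Y + Z constant.
  obtain ⟨l, hl⟩ := exists_functional w (t (w + 2)) (t (w + 1))
  refine ⟨l, quadForm w (t (w + 2)) (t (w + 1)) t, t, htq, fun p hp => ?_, fun p hp hpw => ?_⟩
  · rw [hl, Int.cast_le]
    have hd := degree_of_mem_regionSet hq hp
    rw [degree_fin_three' p w] at hd
    have b1 := regionSet_le hp (w + 1)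
    have b2 := regionSet_le hp (w + 2)
    exact quadratic_le_corner (by positivity) (by omega) (by omega) (by positivity) (by positivity)
      (by omega) (by omega) (by omega)
  · rw [hl, Int.cast_le, Int.cast_inj]
    rw [degree_fin_three' p w] at hp
    have h1 := corner_le_quadratic (x := t w) (y := t (w + 1)) (z := t (w + 2)) (X := p w)
      (Y := p (w + 1)) (Z := p (w + 2)) (by omega) (by omega) (by positivity) (by omega) (by omega)
    refine ⟨h1.1, fun h2 => ?_⟩
    have h3 := h1.2 h2
    refine Finsupp.ext fun i => ?_
    obtain rfl | rfl | rfl := (by decide : ∀ w i : Fin 3, i = w ∨ i = w + 1 ∨ i = w + 2) w i <;>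
      omega

end Tangents

/-! ### Faces of the polygon of a region -/

section Realization

variable {d : ℕ} {τ : DownTriangle d → Fin 3}

theorem exists_eq_pair_of_mem_edgeSet {p q : Fin 3 →₀ ℕ} {w : Fin 3} (hp : p ∈ edgeSet q w) :
    ∃ a, a ≠ p ∧ edgeSet q w = {p, a} := by
  have hne := add_single_ne_add_single q ((by decide : ∀ w : Fin 3, w + 1 ≠ w + 2) w)
  rcases hp with rfl | hp
  · exact ⟨_, hne.symm, rfl⟩
  · rw [Set.mem_singleton_iff.1 hp]
    exact ⟨_, hne, Set.pair_comm _ _⟩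

/-- An edge that is not removed and that lies in the region of `q`. -/
def IsSide (τ : DownTriangle d → Fin 3) (q q' : Fin 3 →₀ ℕ) (w : Fin 3) : Prop :=
  q'.degree + 1 = d ∧ ¬ IsRemoved τ q' w ∧ edgeSet q' w ⊆ regionSet τ q

theorem isSide_of_down {n : DownTriangle d} {w : Fin 3} (hw : w ≠ τ n) :
    IsSide τ (n.1 + 𝐞 (τ n)) (n.1 + 𝐞 w) w :=
  ⟨n.degree_add_single w, not_isRemoved_of_ne hw,
    (edgeSet_subset_regionSet_iff (n.degree_add_single _) (n.degree_add_single w)).2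
      (Or.inr ⟨n, rfl, rfl⟩)⟩

theorem isSide_self {q : Fin 3 →₀ ℕ} {w : Fin 3} (hq : q.degree + 1 = d)
    (hw : ¬ IsRemoved τ q w) : IsSide τ q q w :=
  ⟨hq, hw, (edgeSet_subset_regionSet_iff hq hq).2 (Or.inl rfl)⟩

theorem mem_edgeSet_add_single {n : Fin 3 →₀ ℕ} {i j w : Fin 3} (hij : i ≠ j) (hw : w = i ∨ w = j) :
    n + 𝐞 i + 𝐞 j ∈ edgeSet (n + 𝐞 w) w := by
  rw [mem_edgeSet_iff]
  simp only [Finsupp.add_apply, Finsupp.single_apply]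
  rcases hw with rfl | rfl
  · fin_cases w <;> fin_cases j <;> simp at hij ⊢
  · fin_cases w <;> fin_cases i <;> simp at hij ⊢

/-- At the corner q x_i, the side opposite to x_w is used if kept; otherwise the edge at this corner
of the triangle merged across it. -/
theorem exists_side {q : Fin 3 →₀ ℕ} (hq : q.degree + 1 = d) {i w : Fin 3} (hw : w ≠ i) :
    ∃ q' w', IsSide τ q q' w' ∧ q + 𝐞 i ∈ edgeSet q' w' ∧
      (q' = q ∧ w' = w ∨ q' + 𝐞 w = q + 𝐞 i ∧ w' = i) := by
  by_cases hr : IsRemoved τ q w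
  · obtain ⟨n, rfl, rfl⟩ := hr
    refine ⟨_, i, isSide_of_down hw.symm, ?_, Or.inr ⟨add_right_comm _ _ _, rfl⟩⟩
    exact mem_edgeSet_add_single hw (Or.inr rfl)
  · refine ⟨q, w, isSide_self hq hr, ?_, Or.inl ⟨rfl, rfl⟩⟩
    rcases (by decide : ∀ i w : Fin 3, w ≠ i → i = w + 1 ∨ i = w + 2) i w hw with rfl | rfl
    · exact Or.inl rfl
    · exact Or.inr rfl

/-- Every vertex of a region lies on two of its sides. -/
theorem exists_two_sides {p q : Fin 3 →₀ ℕ} (hq : q.degree + 1 = d) (hp : p ∈ regionSet τ q) :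
    ∃ q1 w1 q2 w2, IsSide τ q q1 w1 ∧ IsSide τ q q2 w2 ∧ p ∈ edgeSet q1 w1 ∧ p ∈ edgeSet q2 w2 ∧
      (q1, w1) ≠ (q2, w2) := by
  rcases mem_regionSet.1 hp with ⟨i, rfl⟩ | ⟨n, rfl, rfl⟩
  · have n1 := (by decide : ∀ i : Fin 3, i + 1 ≠ i) i
    have n2 := (by decide : ∀ i : Fin 3, i + 2 ≠ i) i
    have n3 := (by decide : ∀ i : Fin 3, i + 1 ≠ i + 2) i
    obtain ⟨q1, w1, h1, h2, h3⟩ := exists_side (τ := τ) hq n1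
    obtain ⟨q2, w2, g1, g2, g3⟩ := exists_side (τ := τ) hq n2
    refine ⟨q1, w1, q2, w2, h1, g1, h2, g2, fun h => ?_⟩
    obtain ⟨rfl, rfl⟩ := Prod.mk.inj h
    rcases h3 with ⟨h3, h4⟩ | ⟨h3, h4⟩ <;> rcases g3 with ⟨g3, g4⟩ | ⟨g3, g4⟩
    · exact n3 (h4.symm.trans g4)
    · exact n1 (h4.symm.trans g4)
    · exact n2 (g4.symm.trans h4)
    · exact add_single_ne_add_single _ n3 (h3.trans g3.symm)
  · have n1 := (by decide : ∀ i : Fin 3, i + 1 ≠ i) (τ n)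
    have n2 := (by decide : ∀ i : Fin 3, i + 2 ≠ i) (τ n)
    have n3 := (by decide : ∀ i : Fin 3, i + 1 ≠ i + 2) (τ n)
    exact ⟨_, _, _, _, isSide_of_down n1, isSide_of_down n2,
      mem_edgeSet_add_single n3 (Or.inl rfl), mem_edgeSet_add_single n3 (Or.inr rfl),
      fun h => n3 (congrArg Prod.snd h)⟩

theorem IsSide.exists_functional {q q' : Fin 3 →₀ ℕ} {w : Fin 3} (hq : q.degree + 1 = d)
    (h : IsSide τ q q' w) : ∃ (l : EuclideanSpace ℝ (Fin 2) →L[ℝ] ℝ) (γ : ℝ),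
      ∀ p ∈ regionSet τ q, l (position p) ≤ γ ∧ (l (position p) = γ ↔ p ∈ edgeSet q' w) := by
  obtain ⟨h1, h2, h3⟩ := h
  obtain ⟨l, γ, g1, g2⟩ := exists_tangent_edge h1 h2
  rcases (edgeSet_subset_regionSet_iff hq h1).1 h3 with rfl | ⟨n, rfl, rfl⟩
  · exact ⟨l, γ, g1⟩
  · refine ⟨-l, -γ, fun p hp => ?_⟩
    have hw : w ≠ τ n := by
      rintro rfl
      exact h2 ⟨n, rfl, rfl⟩
    have h4 := g2 p (degree_of_mem_regionSet hq hp) (by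
      have := regionSet_le hp w
      simpa [hw] using this)
    simpa using h4

theorem singleton_mem_deltaCells {p : Fin 3 →₀ ℕ} (hp : p.degree = d) : {p} ∈ deltaCells τ :=
  mem_deltaCells.2 (Or.inl ⟨p, hp, rfl⟩)

theorem IsSide.mem_deltaCells {q q' : Fin 3 →₀ ℕ} {w : Fin 3} (h : IsSide τ q q' w) :
    edgeSet q' w ∈ deltaCells τ :=
  _root_.mem_deltaCells.2 (Or.inr (Or.inl ⟨q', w, h.1, h.2.1, rfl⟩))

theorem regionSet_mem_deltaCells {q : Fin 3 →₀ ℕ} (hq : q.degree + 1 = d) :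
    regionSet τ q ∈ deltaCells τ :=
  mem_deltaCells.2 (Or.inr (Or.inr ⟨q, hq, rfl⟩))

theorem image_sep (s : Set (Fin 3 →₀ ℕ)) (l : EuclideanSpace ℝ (Fin 2) →L[ℝ] ℝ) (γ : ℝ) :
    {x ∈ position '' s | l x = γ} = position '' {p ∈ s | l (position p) = γ} := by
  ext x
  constructor
  · rintro ⟨⟨p, hp, rfl⟩, h⟩
    exact ⟨p, ⟨hp, h⟩, rfl⟩
  · rintro ⟨p, ⟨hp, h⟩, rfl⟩
    exact ⟨⟨p, hp, rfl⟩, h⟩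

/-- The vertices of a region where a functional is maximal form a cell. -/
theorem maximizers_mem_deltaCells {q : Fin 3 →₀ ℕ} (hq : q.degree + 1 = d)
    {l : EuclideanSpace ℝ (Fin 2) →L[ℝ] ℝ} {γ : ℝ} (hl : ∀ p ∈ regionSet τ q, l (position p) ≤ γ)
    (hne : {p ∈ regionSet τ q | l (position p) = γ}.Nonempty) :
    {p ∈ regionSet τ q | l (position p) = γ} ∈ deltaCells τ := by
  obtain ⟨v, hv, hvγ⟩ := hne
  obtain ⟨q1, w1, q2, w2, h1, h2, hv1, hv2, hne⟩ := exists_two_sides hq hv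
  obtain ⟨a, hav, ha⟩ := exists_eq_pair_of_mem_edgeSet hv1
  obtain ⟨b, hbv, hb⟩ := exists_eq_pair_of_mem_edgeSet hv2
  have hab : a ≠ b := by
    rintro rfl
    exact hne (Prod.ext_iff.2 (edgeSet_injective (ha.trans hb.symm)))
  obtain ⟨g, γ1, hg⟩ := h1.exists_functional hq
  obtain ⟨h, γ2, hh⟩ := h2.exists_functional hq
  have haq : a ∈ regionSet τ q := h1.2.2 (by rw [ha]; exact Or.inr rfl)
  have hbq : b ∈ regionSet τ q := h2.2.2 (by rw [hb]; exact Or.inr rfl)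
  rw [ha] at hg
  rw [hb] at hh
  have gv : g (position v) = γ1 := (hg v hv).2.2 (Or.inl rfl)
  have ga : g (position a) = γ1 := (hg a haq).2.2 (Or.inr rfl)
  have gb : g (position b) < γ1 := lt_of_le_of_ne (hg b hbq).1 fun hcon => by
    rcases (hg b hbq).2.1 hcon with h | h
    · exact hbv h
    · exact hab h.symm
  have hhv : h (position v) = γ2 := (hh v hv).2.2 (Or.inl rfl)
  have hhb : h (position b) = γ2 := (hh b hbq).2.2 (Or.inr rfl)
  have hha : h (position a) < γ2 := lt_of_le_of_ne (hh a haq).1 fun hcon => by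
    rcases (hh a haq).2.1 hcon with h | h
    · exact hav h
    · exact hab h
  -- In terms of the two side functionals at v, l = αg + βh. Maximality at v compared with the
  -- neighbours b and a gives α, β ≥ 0, and which of them vanish decides whether the face is the
  -- region, a side or a vertex.
  obtain ⟨α, β, hαβ⟩ := exists_eq_smul_add_smul (by simp) (g := g) (h := h)
    (u := position a - position v) (v := position b - position v)
    (by rw [map_sub, ga, gv, sub_self]) (by rw [map_sub, hhv]; exact (sub_neg.2 hha).ne)
    (by rw [map_sub, gv]; exact (sub_neg.2 gb).ne) (by rw [map_sub, hhb, hhv, sub_self]) l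
  have hlv : γ = α * γ1 + β * γ2 := by rw [← hvγ, hαβ, gv, hhv]
  have hα : 0 ≤ α := by
    have h5 := hl b hbq
    rw [hαβ, hhb, hlv] at h5
    by_contra! hcon
    nlinarith
  have hβ : 0 ≤ β := by
    have h5 := hl a haq
    rw [hαβ, ga, hlv] at h5
    by_contra! hcon
    nlinarith
  have key : ∀ p ∈ regionSet τ q, l (position p) = γ ↔
      (α = 0 ∨ g (position p) = γ1) ∧ (β = 0 ∨ h (position p) = γ2) := by
    intro p hp
    have e1 : 0 ≤ α * (γ1 - g (position p)) := mul_nonneg hα (sub_nonneg.2 (hg p hp).1)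
    have e2 : 0 ≤ β * (γ2 - h (position p)) := mul_nonneg hβ (sub_nonneg.2 (hh p hp).1)
    rw [hαβ, hlv]
    have e3 : α * g (position p) + β * h (position p) = α * γ1 + β * γ2 ↔
        α * (γ1 - g (position p)) = 0 ∧ β * (γ2 - h (position p)) = 0 := by
      constructor
      · intro h
        constructor <;> linarith
      · rintro ⟨h1, h2⟩
        linarith
    rw [e3, mul_eq_zero, mul_eq_zero, sub_eq_zero, sub_eq_zero, eq_comm (a := γ1),
      eq_comm (a := γ2)]
  have hset : {p ∈ regionSet τ q | l (position p) = γ} = {p ∈ regionSet τ q |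
      (α = 0 ∨ g (position p) = γ1) ∧ (β = 0 ∨ h (position p) = γ2)} := by
    ext p
    exact and_congr_right fun hp => key p hp
  rw [hset]
  rcases eq_or_ne α 0 with hα0 | hα0 <;> rcases eq_or_ne β 0 with hβ0 | hβ0 <;>
    simp only [hα0, hβ0, true_or, false_or, true_and, and_true]
  · exact regionSet_mem_deltaCells hq
  · convert h2.mem_deltaCells using 1
    rw [hb]
    ext p
    exact ⟨fun hp => (hh p hp.1).2.1 hp.2, fun hp => by
      have : p ∈ regionSet τ q := h2.2.2 (by rwa [hb])
      exact ⟨this, (hh p this).2.2 hp⟩⟩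
  · convert h1.mem_deltaCells using 1
    rw [ha]
    ext p
    exact ⟨fun hp => (hg p hp.1).2.1 hp.2, fun hp => by
      have : p ∈ regionSet τ q := h1.2.2 (by rwa [ha])
      exact ⟨this, (hg p this).2.2 hp⟩⟩
  · convert singleton_mem_deltaCells (degree_of_mem_regionSet hq hv) using 1
    ext p
    constructor
    · rintro ⟨hp, hp1, hp2⟩
      rcases (hg p hp).2.1 hp1 with h | h
      · exact h
      · rcases (hh p hp).2.1 hp2 with h' | h'
        · exact h'
        · exact absurd (h.symm.trans h') hab
    · rintro rfl
      exact ⟨hv, gv, hhv⟩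

/-- The polygon spanned by a set of vertices. -/
noncomputable def polygon (c : Set (Fin 3 →₀ ℕ)) : Set (EuclideanSpace ℝ (Fin 2)) :=
  convexHull ℝ (position '' c)

theorem exists_region_of_mem_deltaCells [NeZero d] {c : Set (Fin 3 →₀ ℕ)}
    (hc : c ∈ deltaCells τ) : ∃ q : Fin 3 →₀ ℕ, q.degree + 1 = d ∧ c ⊆ regionSet τ q := by
  rcases mem_deltaCells.1 hc with ⟨p, hp, rfl⟩ | ⟨q, w, hq, -, rfl⟩ | ⟨q, hq, rfl⟩
  · obtain ⟨i, hi⟩ : ∃ i, p i ≠ 0 := by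
      by_contra! h
      have : p = 0 := Finsupp.ext h
      rw [this, map_zero] at hp
      exact NeZero.ne d hp.symm
    have h : p - 𝐞 i + 𝐞 i = p := tsub_add_cancel_of_le (Finsupp.single_le_iff.2 (by omega))
    refine ⟨p - 𝐞 i, by rw [← hp, ← h, map_add, Finsupp.degree_single, h], ?_⟩
    rw [Set.singleton_subset_iff]
    exact Or.inl ⟨i, h.symm⟩
  · exact ⟨q, hq, (edgeSet_subset_upVertices q w).trans Set.subset_union_left⟩
  · exact ⟨q, hq, subset_rfl⟩

/-- A nonempty face of the polygon of a cell is the polygon of a smaller cell. -/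
theorem exists_cell_of_isExposed [NeZero d] {c : Set (Fin 3 →₀ ℕ)} (hc : c ∈ deltaCells τ)
    {F : Set (EuclideanSpace ℝ (Fin 2))} (hF : IsExposed ℝ (polygon c) F) (hne : F.Nonempty) :
    ∃ c' ∈ deltaCells τ, c' ⊆ c ∧ F = polygon c' := by
  obtain ⟨l, γ, h1, h2⟩ := hF.exists_eq_convexHull hne
  rw [image_sep] at h2
  refine ⟨_, ?_, Set.sep_subset _ _, h2⟩
  have h3 : {p ∈ c | l (position p) = γ}.Nonempty := by
    rw [h2, convexHull_nonempty_iff, Set.image_nonempty] at hne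
    exact hne
  have h4 : ∀ p ∈ c, l (position p) ≤ γ := fun p hp => h1 _ ⟨p, hp, rfl⟩
  rcases mem_deltaCells.1 hc with ⟨p, hp, rfl⟩ | ⟨q, w, hq, hw, rfl⟩ | ⟨q, hq, rfl⟩
  · rwa [(Set.subset_singleton_iff_eq.1 (Set.sep_subset _ _)).resolve_left h3.ne_empty]
  · have hd : ∀ p ∈ edgeSet q w, p.degree = d := fun p hp => degree_of_mem_deltaCells hc hp
    rcases Set.subset_pair_iff_eq.1 (show {p ∈ edgeSet q w | l (position p) = γ} ⊆ {_, _} from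
      Set.sep_subset _ _) with h | h | h | h
    · exact absurd h h3.ne_empty
    · rw [h]
      exact singleton_mem_deltaCells (hd _ (Or.inl rfl))
    · rw [h]
      exact singleton_mem_deltaCells (hd _ (Or.inr rfl))
    · rw [h]
      exact hc
  · exact maximizers_mem_deltaCells hq h4 h3

/-- The polygons of smaller cells are faces of the polygon of a region. -/
theorem isExposed_polygon_regionSet {q : Fin 3 →₀ ℕ} (hq : q.degree + 1 = d)
    {c : Set (Fin 3 →₀ ℕ)} (hc : c ∈ deltaCells τ) (hcq : c ⊆ regionSet τ q) :
    IsExposed ℝ (polygon (regionSet τ q)) (polygon c) := by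
  have hside : ∀ {q' w}, IsSide τ q q' w →
      IsExposed ℝ (polygon (regionSet τ q)) (polygon (edgeSet q' w)) := by
    intro q' w h
    obtain ⟨l, γ, hl⟩ := h.exists_functional hq
    have h1 := isExposed_convexHull_of_le (s := position '' regionSet τ q) (l := l) (c := γ) (by
      rintro _ ⟨p, hp, rfl⟩
      exact (hl p hp).1)
    have heq : {p ∈ regionSet τ q | l (position p) = γ} = edgeSet q' w := by
      ext p
      exact ⟨fun hp => (hl p hp.1).2.1 hp.2, fun hp => ⟨h.2.2 hp, (hl p (h.2.2 hp)).2.2 hp⟩⟩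
    rwa [image_sep, heq] at h1
  rcases mem_deltaCells.1 hc with ⟨v, hv, rfl⟩ | ⟨q', w, hq', hw, rfl⟩ | ⟨q', hq', rfl⟩
  · have hv : v ∈ regionSet τ q := hcq rfl
    obtain ⟨q1, w1, q2, w2, h1, h2, hv1, hv2, hne⟩ := exists_two_sides hq hv
    obtain ⟨a, hav, ha⟩ := exists_eq_pair_of_mem_edgeSet hv1
    obtain ⟨b, hbv, hb⟩ := exists_eq_pair_of_mem_edgeSet hv2
    have hab : a ≠ b := by
      rintro rfl
      exact hne (Prod.ext_iff.2 (edgeSet_injective (ha.trans hb.symm)))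
    -- The two sides through v meet only in v, and an intersection of faces is a face.
    have h3 := (hside h1).inter (hside h2)
    obtain ⟨l, γ, hl⟩ := h1.exists_functional hq
    have hbq : b ∈ regionSet τ q := h2.2.2 (by rw [hb]; exact Or.inr rfl)
    suffices hpoly : polygon {v} = polygon (edgeSet q1 w1) ∩ polygon (edgeSet q2 w2) by
      rw [hpoly]
      exact h3
    have h4 : ∀ p ∈ edgeSet q2 w2, l (position p) ≤ γ := fun p hp => (hl p (h2.2.2 hp)).1
    refine Set.Subset.antisymm (Set.subset_inter (convexHull_mono (Set.image_mono ?_))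
      (convexHull_mono (Set.image_mono ?_))) ?_
    · exact Set.singleton_subset_iff.2 hv1
    · exact Set.singleton_subset_iff.2 hv2
    · rintro x ⟨hx1, hx2⟩
      have h5 : l x = γ :=
        convexHull_min (s := position '' edgeSet q1 w1) (t := {x | l x = γ}) (by
          rintro _ ⟨p, hp, rfl⟩
          exact (hl p (h1.2.2 hp)).2.2 hp) (convex_hyperplane l.isLinear γ) hx1
      have h6 : x ∈ {x ∈ convexHull ℝ (position '' edgeSet q2 w2) | l x = γ} := ⟨hx2, h5⟩
      rw [convexHull_inter_eq_of_le (by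
        rintro _ ⟨p, hp, rfl⟩
        exact h4 p hp), image_sep] at h6
      refine convexHull_mono (Set.image_mono ?_) h6
      rintro p ⟨hp, hpγ⟩
      rw [hb] at hp
      rcases hp with hp | hp
      · exact hp
      · have h7 := (hl b hbq).2.1 (by rwa [← Set.mem_singleton_iff.1 hp])
        rw [ha] at h7
        rcases h7 with h7 | h7
        · exact absurd h7 hbv
        · exact absurd h7.symm hab
  · exact hside ⟨hq', hw, hcq⟩
  · rw [eq_of_upVertices_subset_regionSet hq' hq (Set.subset_union_left.trans hcq)]

end Realization

/-! ### Intersections of polygons and the planar complex -/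

section Realization

variable {d : ℕ} {τ : DownTriangle d → Fin 3}

theorem polygon_mono {c c' : Set (Fin 3 →₀ ℕ)} (h : c ⊆ c') : polygon c ⊆ polygon c' :=
  convexHull_mono (Set.image_mono h)

theorem polygon_empty : polygon ∅ = ∅ := by
  rw [polygon, Set.image_empty, convexHull_empty]

theorem polygon_singleton (p : Fin 3 →₀ ℕ) : polygon {p} = {position p} := by
  rw [polygon, Set.image_singleton, convexHull_singleton]

/-- The tangent line of q', at the kept edge or at the corner beyond a removed one, has the two
polygons on opposite sides, so they meet in a face on that line. -/
theorem polygon_inter_polygon_of_le {q q' : Fin 3 →₀ ℕ} (hq : q.degree + 1 = d)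
    (hq' : q'.degree + 1 = d) {w : Fin 3}
    (h : ¬ IsRemoved τ q' w ∧ q w + 1 ≤ q' w ∨ IsRemoved τ q' w ∧ q w + 2 ≤ q' w) :
    ∃ c ⊆ regionSet τ q ∩ regionSet τ q', (c = ∅ ∨ c ∈ deltaCells τ) ∧
      polygon (regionSet τ q) ∩ polygon (regionSet τ q') = polygon c := by
  have hd : ∀ p ∈ regionSet τ q, p.degree = d := fun p => degree_of_mem_regionSet hq
  rcases h with ⟨hw, h⟩ | ⟨hw, h⟩
  · obtain ⟨l, γ, h1, h2⟩ := exists_tangent_edge hq' hw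
    have h3 : ∀ p ∈ regionSet τ q, γ ≤ l (position p) ∧
        (l (position p) = γ ↔ p ∈ edgeSet q' w) := fun p hp =>
      h2 p (hd p hp) ((regionSet_le hp w).trans h)
    have hs := isSide_self hq' hw
    have h4 := convexHull_inter_convexHull_eq (s := position '' regionSet τ q)
      (t := position '' regionSet τ q') (l := l) (c := γ) (by
        rintro _ ⟨p, hp, rfl⟩
        exact (h3 p hp).1) (by
        rintro _ ⟨p, hp, rfl⟩
        exact (h1 p hp).1) (by
        rintro _ ⟨p, hp, rfl⟩ hpγ
        exact ⟨p, hs.2.2 ((h3 p hp).2.1 hpγ), rfl⟩)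
    rw [image_sep] at h4
    have h5 : {p ∈ regionSet τ q | l (position p) = γ} ⊆ edgeSet q' w :=
      fun p hp => (h3 p hp.1).2.1 hp.2
    refine ⟨_, fun p hp => ⟨hp.1, hs.2.2 (h5 hp)⟩, ?_, h4⟩
    have hd' : ∀ p ∈ edgeSet q' w, p.degree = d := fun p =>
      degree_of_mem_deltaCells hs.mem_deltaCells
    rcases Set.subset_pair_iff_eq.1 h5 with h | h | h | h
    · exact Or.inl h
    · rw [h]
      exact Or.inr (singleton_mem_deltaCells (hd' _ (Or.inl rfl)))
    · rw [h]
      exact Or.inr (singleton_mem_deltaCells (hd' _ (Or.inr rfl)))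
    · rw [h]
      exact Or.inr hs.mem_deltaCells
  · obtain ⟨l, γ, t, ht, h1, h2⟩ := exists_tangent_corner hq' hw
    have h3 : ∀ p ∈ regionSet τ q, γ ≤ l (position p) ∧ (l (position p) = γ → p = t) :=
      fun p hp => h2 p (hd p hp) (by
        have := regionSet_le hp w
        omega)
    have h4 := convexHull_inter_convexHull_eq (s := position '' regionSet τ q)
      (t := position '' regionSet τ q') (l := l) (c := γ) (by
        rintro _ ⟨p, hp, rfl⟩
        exact (h3 p hp).1) (by
        rintro _ ⟨p, hp, rfl⟩
        exact h1 p hp) (by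
        rintro _ ⟨p, hp, rfl⟩ hpγ
        exact ⟨t, ht, by rw [(h3 p hp).2 hpγ]⟩)
    rw [image_sep] at h4
    have h5 : {p ∈ regionSet τ q | l (position p) = γ} ⊆ {t} := fun p hp => (h3 p hp.1).2 hp.2
    refine ⟨_, fun p hp => ⟨hp.1, by rwa [h5 hp]⟩, ?_, h4⟩
    rcases Set.subset_singleton_iff_eq.1 h5 with h | h
    · exact Or.inl h
    · rw [h]
      exact Or.inr (singleton_mem_deltaCells (degree_of_mem_regionSet hq' ht))

/-- Choose i with q_i > q'_i and j with q'_j > q_j. Without separation both corresponding edges are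
removed and the exponents differ by exactly 1, so both removals come from one down triangle, which
would have the two types i and j. -/
theorem exists_separation {q q' : Fin 3 →₀ ℕ} (hd : q.degree = q'.degree)
    (hne : q ≠ q') : ∃ w,
      (¬ IsRemoved τ q' w ∧ q w + 1 ≤ q' w ∨ IsRemoved τ q' w ∧ q w + 2 ≤ q' w) ∨
      (¬ IsRemoved τ q w ∧ q' w + 1 ≤ q w ∨ IsRemoved τ q w ∧ q' w + 2 ≤ q w) := by
  by_contra! hcon
  obtain ⟨r, i, j, hij, h1, -, -, h2, h3⟩ := exists_exchange hd hne
  have hi := hcon i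
  have hj := hcon j
  have ri : IsRemoved τ q i := by
    by_contra h
    have := hi.2.1 h
    omega
  have rj : IsRemoved τ q' j := by
    by_contra h
    have := hj.1.1 h
    omega
  have bi := hi.2.2 ri
  have bj := hj.1.2 rj
  obtain ⟨n, g1, g2⟩ := ri
  obtain ⟨n', g3, g4⟩ := rj
  have hnn : n = n' := by
    refine Subtype.ext ?_
    rw [← g1, ← g3] at hd h2 h3 bi bj
    clear h1 hcon hi hj
    simp only [degree_fin_three, finsupp_fin_three_ext, Finsupp.add_apply,
      Finsupp.single_apply] at hd h2 h3 bi bj ⊢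
    fin_cases i <;> fin_cases j <;> simp at hij hd h2 h3 bi bj ⊢ <;> omega
  exact hij (by rw [← g2, ← g4, hnn])

/-- Two regions meet in a common face. -/
theorem exists_polygon_inter_polygon {q q' : Fin 3 →₀ ℕ} (hq : q.degree + 1 = d)
    (hq' : q'.degree + 1 = d) (hne : q ≠ q') :
    ∃ c ⊆ regionSet τ q ∩ regionSet τ q', (c = ∅ ∨ c ∈ deltaCells τ) ∧
      polygon (regionSet τ q) ∩ polygon (regionSet τ q') = polygon c := by
  obtain ⟨w, h | h⟩ := exists_separation (τ := τ) (show q.degree = q'.degree by omega) hne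
  · exact polygon_inter_polygon_of_le hq hq' h
  · obtain ⟨c, h1, h2, h3⟩ := polygon_inter_polygon_of_le hq' hq h
    exact ⟨c, by rwa [Set.inter_comm], h2, by rwa [Set.inter_comm]⟩

/-- Cells in different regions meet inside the polygon of a common cell b of the regions. There the
trace of c' is the polygon of a cell e ⊆ b, which is also a face of the region containing c and can
be intersected with c. -/
theorem isExposed_polygon_inter [NeZero d] {c c' : Set (Fin 3 →₀ ℕ)} (hc : c ∈ deltaCells τ)
    (hc' : c' ∈ deltaCells τ) : IsExposed ℝ (polygon c) (polygon c ∩ polygon c') := by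
  obtain ⟨q, hq, hcq⟩ := exists_region_of_mem_deltaCells hc
  obtain ⟨q', hq', hcq'⟩ := exists_region_of_mem_deltaCells hc'
  have h1 := isExposed_polygon_regionSet hq hc hcq
  have h1' := isExposed_polygon_regionSet hq' hc' hcq'
  by_cases hqq : q = q'
  · subst hqq
    exact (h1.inter h1').mono (polygon_mono hcq) Set.inter_subset_left
  obtain ⟨b, hb1, hb2, hb3⟩ := exists_polygon_inter_polygon (τ := τ) hq hq' hqq
  have hsub : polygon c ∩ polygon c' ⊆ polygon b := by
    rw [← hb3]
    exact Set.inter_subset_inter (polygon_mono hcq) (polygon_mono hcq')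
  have heq : polygon c ∩ polygon c' = polygon c ∩ (polygon c' ∩ polygon b) := by
    rw [← Set.inter_assoc, Set.inter_eq_left.2 hsub]
  rcases hb2 with rfl | hb2
  · rw [polygon_empty] at hsub
    rw [Set.subset_empty_iff.1 hsub]
    exact isExposed_empty
  rcases (polygon c' ∩ polygon b).eq_empty_or_nonempty with h0 | h0
  · rw [heq, h0, Set.inter_empty]
    exact isExposed_empty
  have h2 := isExposed_polygon_regionSet hq' hb2 (hb1.trans Set.inter_subset_right)
  have h3 := (h1'.inter h2).mono (polygon_mono (hb1.trans Set.inter_subset_right))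
    Set.inter_subset_right
  obtain ⟨e, he1, he2, he3⟩ := exists_cell_of_isExposed hb2 h3 h0
  have h4 := isExposed_polygon_regionSet hq he1 ((he2.trans hb1).trans Set.inter_subset_left)
  rw [heq, he3]
  exact (h1.inter h4).mono (polygon_mono hcq) Set.inter_subset_left

/-- The position of p is an exposed point of the region, so it lies in the hull of some vertices
only if it is one of them. -/
theorem mem_of_position_mem_polygon_of_subset {q p : Fin 3 →₀ ℕ} (hq : q.degree + 1 = d)
    (hp : p ∈ regionSet τ q) {c : Set (Fin 3 →₀ ℕ)} (hcq : c ⊆ regionSet τ q)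
    (h : position p ∈ polygon c) : p ∈ c := by
  have hd := fun p => degree_of_mem_regionSet (p := p) (τ := τ) hq
  have h1 := isExposed_polygon_regionSet hq (singleton_mem_deltaCells (hd p hp))
    (Set.singleton_subset_iff.2 hp)
  rw [polygon_singleton] at h1
  obtain ⟨l, γ, h2, h3⟩ := h1.exists_eq_convexHull (Set.singleton_nonempty _)
  have h4 : l (position p) = γ := by
    have h5 : position p ∈ convexHull ℝ {x ∈ position '' regionSet τ q | l x = γ} := by
      rw [← h3]
      rfl
    rw [← convexHull_inter_eq_of_le h2] at h5
    exact h5.2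
  have h6 : position p ∈ {x ∈ convexHull ℝ (position '' c) | l x = γ} := ⟨h, h4⟩
  rw [convexHull_inter_eq_of_le fun x hx => h2 x (Set.image_mono hcq hx)] at h6
  obtain ⟨_, ⟨p', hp', rfl⟩, h7⟩ := convexHull_nonempty_iff.1 ⟨_, h6⟩
  have h8 : position p' ∈ ({position p} : Set (EuclideanSpace ℝ (Fin 2))) := by
    rw [h3]
    exact subset_convexHull ℝ _ ⟨⟨p', hcq hp', rfl⟩, h7⟩
  rwa [← position_injective_of_degree_eq ((hd _ (hcq hp')).trans (hd _ hp).symm) h8]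

theorem mem_of_position_mem_polygon [NeZero d] {p : Fin 3 →₀ ℕ} (hp : p.degree = d)
    {c : Set (Fin 3 →₀ ℕ)} (hc : c ∈ deltaCells τ) (h : position p ∈ polygon c) : p ∈ c := by
  obtain ⟨q, hq, hcq⟩ := exists_region_of_mem_deltaCells hc
  obtain ⟨q', hq', hpq'⟩ := exists_region_of_mem_deltaCells
    (singleton_mem_deltaCells (τ := τ) hp)
  have hpq' : p ∈ regionSet τ q' := hpq' rfl
  by_cases hqq : q = q'
  · subst hqq
    exact mem_of_position_mem_polygon_of_subset hq hpq' hcq h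
  obtain ⟨b, hb1, -, hb3⟩ := exists_polygon_inter_polygon (τ := τ) hq hq' hqq
  have h1 : position p ∈ polygon b := by
    rw [← hb3]
    exact ⟨polygon_mono hcq h, subset_convexHull ℝ _ ⟨p, hpq', rfl⟩⟩
  have h2 := mem_of_position_mem_polygon_of_subset hq' hpq'
    (hb1.trans Set.inter_subset_right) h1
  exact mem_of_position_mem_polygon_of_subset hq (hb1 h2).1 hcq h

theorem finite_of_mem_deltaCells {c : Set (Fin 3 →₀ ℕ)} (hc : c ∈ deltaCells τ) : c.Finite :=
  (finite_degree_le d).subset fun _ hp => (degree_of_mem_deltaCells hc hp).le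

theorem nonempty_of_mem_deltaCells {c : Set (Fin 3 →₀ ℕ)} (hc : c ∈ deltaCells τ) :
    c.Nonempty := by
  rcases mem_deltaCells.1 hc with ⟨p, -, rfl⟩ | ⟨q, w, -, -, rfl⟩ | ⟨q, -, rfl⟩
  · exact Set.singleton_nonempty p
  · exact Set.insert_nonempty _ _
  · exact ⟨_, Or.inl ⟨0, rfl⟩⟩

/-- The planar polyhedral complex realizing a choice of edges. -/
noncomputable def deltaComplex [NeZero d] (τ : DownTriangle d → Fin 3) : PolyhedralComplex 2 where
  faces := insert ∅ (polygon '' deltaCells τ)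
  finite_faces := by
    refine Set.Finite.insert _ (Set.Finite.image _ ((finite_degree_le d).finite_subsets.subset ?_))
    exact fun c hc p hp => (degree_of_mem_deltaCells hc hp).le
  isPolytope := by
    rintro _ (rfl | ⟨c, hc, rfl⟩)
    · exact ⟨∅, by simp⟩
    · exact ⟨((finite_of_mem_deltaCells hc).image position).toFinset, by simp [polygon]⟩
  face_mem := by
    rintro _ (rfl | ⟨c, hc, rfl⟩) F hF
    · exact Or.inl (Set.subset_empty_iff.1 hF.subset)
    · rcases F.eq_empty_or_nonempty with rfl | hne
      · exact Or.inl rfl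
      · obtain ⟨c', h1, -, rfl⟩ := exists_cell_of_isExposed hc hF hne
        exact Or.inr ⟨c', h1, rfl⟩
  inter_isFace := by
    rintro _ (rfl | ⟨c, hc, rfl⟩) _ (rfl | ⟨c', hc', rfl⟩)
    · simp only [Set.empty_inter]
      exact ⟨isExposed_empty, isExposed_empty⟩
    · simp only [Set.empty_inter]
      exact ⟨isExposed_empty, isExposed_empty⟩
    · simp only [Set.inter_empty]
      exact ⟨isExposed_empty, isExposed_empty⟩
    · refine ⟨isExposed_polygon_inter hc hc', ?_⟩
      rw [Set.inter_comm]
      exact isExposed_polygon_inter hc' hc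

theorem exists_eq_position [NeZero d] (v : (deltaComplex τ).Cell 0) :
    ∃ p : Fin 3 →₀ ℕ, p.degree = d ∧ v.1 = {position p} := by
  obtain ⟨x, hx⟩ := PolyhedralComplex.exists_eq_singleton v
  rcases v.2.1 with h | ⟨c, hc, h⟩
  · exact absurd h v.2.2.1.ne_empty
  · obtain ⟨p, hp⟩ := nonempty_of_mem_deltaCells hc
    refine ⟨p, degree_of_mem_deltaCells hc hp, ?_⟩
    have h1 : position p ∈ v.1 := by
      rw [← h]
      exact subset_convexHull ℝ _ ⟨p, hp, rfl⟩
    rw [hx] at h1 ⊢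
    rw [Set.mem_singleton_iff.1 h1]

/-- Every choice of edges is realized by a polyhedral complex. -/
theorem exists_isDelta [NeZero d] (τ : DownTriangle d → Fin 3) :
    ∃ (N : ℕ) (X : PolyhedralComplex N) (a : X.Cell 0 → (Fin 3 →₀ ℕ)), IsDelta τ X a := by
  choose a ha1 ha2 using exists_eq_position (τ := τ)
  have himage : ∀ c ∈ deltaCells τ, a '' (deltaComplex τ).verts (polygon c) = c := by
    intro c hc
    ext p
    constructor
    · rintro ⟨v, hv, rfl⟩
      refine mem_of_position_mem_polygon (ha1 v) hc ?_
      have hv : v.1 ⊆ polygon c := hv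
      rw [ha2 v, Set.singleton_subset_iff] at hv
      exact hv
    · intro hp
      have hd := degree_of_mem_deltaCells hc hp
      have hmem : {position p} ∈ (deltaComplex τ).faces :=
        Or.inr ⟨{p}, singleton_mem_deltaCells hd, polygon_singleton p⟩
      obtain ⟨v, hv⟩ := PolyhedralComplex.exists_cell_zero hmem
      refine ⟨v, ?_, ?_⟩
      · change v.1 ⊆ polygon c
        rw [hv, Set.singleton_subset_iff]
        exact subset_convexHull ℝ _ ⟨p, hp, rfl⟩
      · refine position_injective_of_degree_eq ((ha1 v).trans hd.symm) ?_
        exact Set.singleton_injective ((ha2 v).symm.trans hv)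
  refine ⟨2, deltaComplex τ, a, fun v v' h => Subtype.ext (by rw [ha2 v, ha2 v', h]), ?_⟩
  ext c
  constructor
  · rintro ⟨P, rfl | ⟨c', hc', rfl⟩, hne, rfl⟩
    · exact absurd rfl hne.ne_empty
    · rw [himage c' hc']
      exact hc'
  · intro hc
    refine ⟨polygon c, Or.inr ⟨c, hc, rfl⟩, ?_, (himage c hc).symm⟩
    exact convexHull_nonempty_iff.2 ((nonempty_of_mem_deltaCells hc).image _)

end Realization

/-! ### The theorem -/

theorem mainTheorem2 (k : Type*) [Field k] (d : ℕ) [NeZero d] :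
    (∀ τ : DownTriangle d → Fin 3,
      IsPolarization (fun _ : Fin 3 => d)
        (Ideal.span (Set.range (MvPolynomial.X : Fin 3 → MvPolynomial (Fin 3) k)) ^ d)
        (polarizedIdeal k τ) ∧
      (∃ (N : ℕ) (X : PolyhedralComplex N) (a : X.Cell 0 → (Fin 3 →₀ ℕ)), IsDelta τ X a) ∧
      (∀ (N : ℕ) (X : PolyhedralComplex N) (a : X.Cell 0 → (Fin 3 →₀ ℕ)), IsDelta τ X a →
        Nonempty X.Incidence ∧
        ∀ ε : X.Incidence,
          X.IsMinimalResolution (fun v => polarizedExponent τ (a v)) k ε (polarizedIdeal k τ) ∧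
          X.IsMinimalResolution a k ε
            (Ideal.span (Set.range (MvPolynomial.X : Fin 3 → MvPolynomial (Fin 3) k)) ^ d))) ∧
    (∀ (N : ℕ) (X : PolyhedralComplex N) (a : X.Cell 0 → (Fin 3 →₀ ℕ)) (ε : X.Incidence),
      X.IsMinimalResolution a k ε
        (Ideal.span (Set.range (MvPolynomial.X : Fin 3 → MvPolynomial (Fin 3) k)) ^ d) →
      ∃ τ : DownTriangle d → Fin 3, IsDelta τ X a ∧
        X.IsMinimalResolution (fun v => polarizedExponent τ (a v)) k ε (polarizedIdeal k τ) ∧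
        ∀ P ∈ X.faces,
          (X.label (fun v => polarizedExponent τ (a v)) P).mapDomain Sigma.fst = X.label a P) := by
  refine ⟨fun τ => ⟨?_, exists_isDelta τ, fun N X a H => ⟨H.nonempty_incidence, fun ε =>
    ⟨H.isMinimalResolution_polarized ε, H.isMinimalResolution ε⟩⟩⟩, fun N X a ε h => ?_⟩
  -- Being a polarization does not refer to a complex; any realization can be used to prove it.
  · obtain ⟨N, X, a, H⟩ := exists_isDelta τ
    exact H.isPolarization
  · obtain ⟨τ, H⟩ := h.exists_isDelta
    exact ⟨τ, H, H.isMinimalResolution_polarized ε, fun P hP => H.mapDomain_label hP⟩
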